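/- **Setting.** Let $\|\cdot\|_X$ be a norm on $\mathbb{R}^{n_X}$ and $\|\cdot\|_\Theta$ a norm on $\mathbb{R}^{n_\Theta}$; linear and bilinear maps carry the induced operator norms. Let $X\subseteq\mathbb{R}^{n_X}$, $\Theta\subseteq\mathbb{R}^{n_\Theta}$, let $(\Xi,\Sigma,\nu)$ be a probability space, and let $f:X\times\Xi\times\Theta\to X$ be such that $\xi\mapsto f(x,\xi,\theta)$ is measurable for all $(x,\theta)\in X\times\Theta$. Let $A$ be a map from $X$ to the invertible linear maps of $\mathbb{R}^{n_X}$ and $B$ a map from $X$ to the invertible linear maps of $\mathbb{R}^{n_\Theta}$. Derivatives of functions on $X$ are taken within $X$. Put $d_A(x,y)=\inf_\gamma\int\|A(\gamma(t))\gamma'(t)\|_X\,dt$, the infimum over all piecewise $C^1$ curves $\gamma$ in $X$ from $x$ to $y$. For bilinear $Q$ and linear $S,T$ write $Q(S\oplus T)[u,v]=Q[Su,Tv]$. Assume: 1. $X$ is closed and convex with nonempty interior, $A$ is continuous, and $\sup_{x\in X}\|A(x)^{-1}\|<\infty$. 2. $\Theta$ is open; $\xi\mapsto d_A(x,f(x,\xi,\theta))^2$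 is $\nu$-integrable for all $(x,\theta)\in X\times\Theta$; and $(x,\theta)\mapsto f(x,\xi,\theta)$ is $C^2$ on $X\times\Theta$ for each $\xi$. 3. $x\mapsto\|B(x)\|$ is Lipschitz for $d_A$. 4. The following functions are continuous and bounded on $X\times\Theta$, and $\sup L_X\le K_X$ for a constant $K_X\in[0,1)$ (arguments $(x,\xi,\theta)$ of $f$ and its derivatives are omitted): $$L_X(x,\theta)=\Big(\int\|A(f)\,\tfrac{\partial f}{\partial x}A(x)^{-1}\|^2d\nu\Big)^{1/2},\qquad L_\Theta(x,\theta)=\Big(\int\|A(f)\,\tfrac{\partial f}{\partial\theta}B(x)^{-1}\|^2d\nu\Big)^{1/2},$$ $$L_{X^2}=\int\|A(f)\tfrac{\partial^2f}{\partial x^2}(A(x)^{-1}\oplus A(x)^{-1})\|d\nu,\qquad L_{\Theta^2}=\int\|A(f)\tfrac{\partial^2f}{\partial\theta^2}(B(x)^{-1}\oplus B(x)^{-1})\|d\nu,$$ $$L_{X,\Theta}=\int\|A(f)\tfrac{\partial^2f}{\partial x\,\partial\theta}(A(x)^{-1}\oplus B(x)^{-1})\|d\nu .$$ Fix any $x_0\in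 X$. Let $\mathcal P_{2,A}(X)$ be the set of Borel probability measures $\mu$ on $X$ with $\int d_A(x,x_0)^2d\mu<\infty$. Let $\mathcal E^2$ be the set of $C^2$ functions $h:X\to\mathbb{R}$ with $\|h\|_{\mathcal E^2}<\infty$, where $$\|h\|_{\mathcal E^2}=\sup_x\frac{|h(x)|}{1+d_A(x,x_0)}+\sup_x\|\tfrac{\partial h}{\partial x}(x)A(x)^{-1}\|+\sup_x\|\tfrac{\partial^2h}{\partial x^2}(x)(A(x)^{-1}\oplus A(x)^{-1})\| .$$ Write $\mu(e)=\int e\,d\mu$, $(P_\theta e)(x)=\int_\Xi e(f(x,\xi,\theta))\,d\nu(\xi)$, and $\mu P_\theta$ for the image of $\mu$ under the Markov kernel $P_\theta$. For operators $T$ and functionals $l$ on $\mathcal E^2$ put $\|T\|_{\mathcal E^2}=\sup_{\|e\|_{\mathcal E^2}\le1}\|Te\|_{\mathcal E^2}$ and $\|l\|=\sup_{\|e\|_{\mathcal E^2}\le1}\|l(e)\|$. **Theorem.** Under these assumptions: (a) $X$ is Polish, $\mathcal E^2$ is a vector space containing the constants, $\|\cdot\|_{\mathcal E^2}$ is a norm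 on it, and for every $\mu\in\mathcal P_{2,A}(X)$ each $e\in\mathcal E^2$ is $\mu$-integrable and $\sup_{\|e\|_{\mathcal E^2}\le1}|\mu(e)|<\infty$. (b) For each $\theta\in\Theta$, $P_\theta$ has exactly one stationary measure $\pi_\theta$ in $\mathcal P_{2,A}(X)$. Put $\Pi_\theta e=\pi_\theta(e)$ (a constant function). (c) At every $\theta_0\in\Theta$: * for all $\theta\in\Theta$, $P_\theta$ is a Markov kernel and $\mu\in\mathcal P_{2,A}(X)$ implies $\mu P_\theta\in\mathcal P_{2,A}(X)$; * for all $\theta\in\Theta$ and $e\in\mathcal E^2$, $e$ is $P_\theta(x,\cdot)$-integrable for every $x\in X$ and $P_\theta e\in\mathcal E^2$; $\|P_\theta\|_{\mathcal E^2}<\infty$ for all $\theta\in\Theta$; * there is $\rho\ge0$ (depending on $\theta_0$) with $\|P_{\theta_0}^n-\Pi_{\theta_0}\|_{\mathcal E^2}\le\rho K_X^n$ for all $n\ge0$, and $\sum_{n\ge0}\|P_{\theta_0}^n-\Pi_{\theta_0}\|_{\mathcal E^2}<\infty$; * for $e\in\mathcal E^2$, $x\in X$, the map $\theta\mapsto P_\theta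 e(x)$ is differentiable at $\theta_0$; its derivative $\tfrac{\partial}{\partial\theta}P_{\theta_0}e(x)$ is $\pi_{\theta_0}$-integrable in $x$, and the functional $e\mapsto\pi_{\theta_0}(\tfrac{\partial}{\partial\theta}P_{\theta_0}e)$ has finite norm; * as $\Delta\theta\to0$, $\Delta\theta\ne0$, $$\tfrac1{\|\Delta\theta\|_\Theta}\big\|\pi_{\theta_0}[P_{\theta_0+\Delta\theta}-P_{\theta_0}-\tfrac{\partial}{\partial\theta}P_{\theta_0}(\Delta\theta)]\big\|\to0,\qquad \tfrac1{\|\Delta\theta\|_\Theta}\big\|(\pi_{\theta_0+\Delta\theta}-\pi_{\theta_0})[P_{\theta_0+\Delta\theta}-P_{\theta_0}]\big\|\to0 .$$ (d) For every $e\in\mathcal E^2$, $\theta\mapsto\pi_\theta(e)$ is differentiable at every $\theta_0\in\Theta$. -/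

import Mathlib

open MeasureTheory ProbabilityTheory Set Filter Topology
open scoped ENNReal

noncomputable section

namespace StationaryDiff

/-! ### Kernels acting on functions, and the abstract conditions for stationary differentiability -/

section Abstract

/-- The action of a Markov kernel on functions, `(P e)(x) = ∫ e(y) P(x, dy)`. -/
def kerOp {S : Type*} [MeasurableSpace S] (κ : Kernel S S) (e : S → ℝ) : S → ℝ :=
  fun x => ∫ y, e y ∂(κ x)

/-- The operator with the kernel `Π(x, ·) = π`: it sends `e` to the constant function `π(e)`. -/
def constOp {S : Type*} [MeasurableSpace S] (π : Measure S) (e : S → ℝ) : S → ℝ :=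
  fun _ => ∫ y, e y ∂π

/-- The function `∂/∂θ P_{θ₀} e`, with values in the linear forms on the parameter space. -/
def paramDeriv {S F : Type*} [MeasurableSpace S] [NormedAddCommGroup F] [NormedSpace ℝ F]
    (P : F → Kernel S S) (θ₀ : F) (e : S → ℝ) : S → (F →L[ℝ] ℝ) :=
  fun x => fderiv ℝ (fun θ => kerOp (P θ) e x) θ₀

/-- Operator norm of a map on the cost functions:
the supremum of `N (T e)` over all `e` in `ℰ` with `N e ≤ 1`. -/
def opENorm {S : Type*} (ℰ : Set (S → ℝ)) (N : (S → ℝ) → ℝ≥0∞)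
    (T : (S → ℝ) → (S → ℝ)) : ℝ≥0∞ :=
  ⨆ e ∈ ℰ, ⨆ _ : N e ≤ 1, N (T e)

/-- Norm of a functional on the cost functions (real valued, or with values in a normed space):
the supremum of `‖l e‖` over all `e` in `ℰ` with `N e ≤ 1`. -/
def funENorm {S G : Type*} [NormedAddCommGroup G] (ℰ : Set (S → ℝ)) (N : (S → ℝ) → ℝ≥0∞)
    (l : (S → ℝ) → G) : ℝ≥0∞ :=
  ⨆ e ∈ ℰ, ⨆ _ : N e ≤ 1, ‖l e‖ₑ

/-- `S` is Polish, `ℰ` is a vector space of real functions on `S` (containing the constants) on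
which `N` is a norm, `Ps` is a set of probability measures, and every `μ` in `Ps` is a bounded
functional on `ℰ`. -/
structure StateSpaceConditions {S : Type*} [TopologicalSpace S] [MeasurableSpace S]
    (ℰ : Set (S → ℝ)) (N : (S → ℝ) → ℝ≥0∞) (Ps : Set (Measure S)) : Prop where
  polish : PolishSpace S
  borel : BorelSpace S
  const_mem : ∀ c : ℝ, (fun _ => c) ∈ ℰ
  add_mem : ∀ e ∈ ℰ, ∀ g ∈ ℰ, e + g ∈ ℰ
  smul_mem : ∀ c : ℝ, ∀ e ∈ ℰ, c • e ∈ ℰ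
  norm_lt_top : ∀ e ∈ ℰ, N e < ⊤
  norm_add_le : ∀ e ∈ ℰ, ∀ g ∈ ℰ, N (e + g) ≤ N e + N g
  norm_smul : ∀ c : ℝ, ∀ e ∈ ℰ, N (c • e) = ‖c‖ₑ * N e
  norm_eq_zero : ∀ e ∈ ℰ, N e = 0 → e = 0
  prob : ∀ μ ∈ Ps, IsProbabilityMeasure μ
  integrable : ∀ μ ∈ Ps, ∀ e ∈ ℰ, Integrable e μ
  bounded : ∀ μ ∈ Ps, funENorm ℰ N (fun e => ∫ x, e x ∂μ) < ⊤

/-- The conditions on a family of kernels `P θ`, `θ ∈ Θ`, with stationary measures `π θ`,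
at the parameter `θ₀`. -/
structure KernelConditions {S F : Type*} [MeasurableSpace S]
    [NormedAddCommGroup F] [NormedSpace ℝ F]
    (ℰ : Set (S → ℝ)) (N : (S → ℝ) → ℝ≥0∞) (Ps : Set (Measure S))
    (Θ : Set F) (P : F → Kernel S S) (π : F → Measure S) (θ₀ : F) : Prop where
  markov : ∀ θ ∈ Θ, IsMarkovKernel (P θ)
  measure_mem : ∀ θ ∈ Θ, ∀ μ ∈ Ps, μ.bind (P θ) ∈ Ps
  stationary : ∀ θ ∈ Θ, π θ ∈ Ps ∧ Kernel.Invariant (P θ) (π θ)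
  integrable : ∀ θ ∈ Θ, ∀ e ∈ ℰ, ∀ x, Integrable e (P θ x)
  cost_mem : ∀ θ ∈ Θ, ∀ e ∈ ℰ, kerOp (P θ) e ∈ ℰ
  bounded : ∀ θ ∈ Θ, opENorm ℰ N (kerOp (P θ)) < ⊤
  deviation : ∑' i : ℕ, opENorm ℰ N
      (fun e => (kerOp (P θ₀))^[i] e - constOp (π θ₀) e) < ⊤
  differentiable : ∀ e ∈ ℰ, ∀ x, DifferentiableAt ℝ (fun θ => kerOp (P θ) e x) θ₀
  integrable_deriv : ∀ e ∈ ℰ, Integrable (paramDeriv P θ₀ e) (π θ₀)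
  bounded_deriv : funENorm ℰ N (fun e => ∫ x, paramDeriv P θ₀ e x ∂(π θ₀)) < ⊤
  remainder : Tendsto
      (fun Δ : F => funENorm ℰ N (fun e =>
        ∫ x, kerOp (P (θ₀ + Δ)) e x ∂(π θ₀) - ∫ x, kerOp (P θ₀) e x ∂(π θ₀)
          - ∫ x, paramDeriv P θ₀ e x Δ ∂(π θ₀)) / ‖Δ‖ₑ)
      (𝓝[≠] 0) (𝓝 0)
  cross_remainder : Tendsto
      (fun Δ : F => funENorm ℰ N (fun e =>
        ∫ x, (kerOp (P (θ₀ + Δ)) e x - kerOp (P θ₀) e x) ∂(π (θ₀ + Δ))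
          - ∫ x, (kerOp (P (θ₀ + Δ)) e x - kerOp (P θ₀) e x) ∂(π θ₀)) / ‖Δ‖ₑ)
      (𝓝[≠] 0) (𝓝 0)

end Abstract

/-! ### Derivatives on the state space, and the Finsler metric -/

section Space

variable {E : Type*} [NormedAddCommGroup E] [NormedSpace ℝ E]

/-- A function on the subset `X`, extended by zero. Only its values on `X` will matter. -/
def extZero {G : Type*} [Zero G] {X : Set E} (h : X → G) : E → G :=
  Function.extend ((↑) : X → E) h 0

/-- The derivative `∂h/∂x` of a function on `X`, taken within `X`
(it is unique if `X` is convex with nonempty interior). -/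
def dX {G : Type*} [NormedAddCommGroup G] [NormedSpace ℝ G] {X : Set E} (h : X → G) (x : X) :
    E →L[ℝ] G :=
  fderivWithin ℝ (extZero h) X x

/-- `c` is piecewise continuously differentiable on `[a, b]`. -/
def PiecewiseC1 (c : ℝ → E) (a b : ℝ) : Prop :=
  ∃ (k : ℕ) (t : ℕ → ℝ), Monotone t ∧ t 0 = a ∧ t k = b ∧
    ∀ i < k, ContDiffOn ℝ 1 c (Icc (t i) (t (i + 1)))

/-- The Finsler length `∫ ‖A(γ(t)) γ'(t)‖ dt` of a curve in `X`. -/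
def curveLength {X : Set E} (A : X → E ≃L[ℝ] E) (γ : ℝ → X) (a b : ℝ) : ℝ :=
  ∫ t in a..b, ‖A (γ t) (deriv (fun s => (γ s : E)) t)‖

/-- The distance `d_A`: the infimum of the lengths of the piecewise `C¹` curves in `X`
from `x` to `y`. -/
def dA {X : Set E} (A : X → E ≃L[ℝ] E) (x y : X) : ℝ :=
  sInf {l : ℝ | ∃ (γ : ℝ → X) (a b : ℝ), PiecewiseC1 (fun t => (γ t : E)) a b ∧
    γ a = x ∧ γ b = y ∧ l = curveLength A γ a b}

/-- The measures in `𝒫_{2,A}(X)`: Borel probability measures with `∫ d_A(x, x₀)² dμ < ∞`. -/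
def P2A [MeasurableSpace E] {X : Set E} (A : X → E ≃L[ℝ] E) (x₀ : X) : Set (Measure X) :=
  {μ | IsProbabilityMeasure μ ∧ ∫⁻ x, ENNReal.ofReal (dA A x x₀ ^ 2) ∂μ < ⊤}

/-- The norm `‖h‖_A + ‖∂h/∂x‖_A + ‖∂²h/∂x²‖_{A,A}`, with values in `[0, ∞]`. -/
def E2norm {X : Set E} (A : X → E ≃L[ℝ] E) (x₀ : X) (h : X → ℝ) : ℝ≥0∞ :=
  (⨆ x : X, ‖h x‖ₑ / ENNReal.ofReal (1 + dA A x x₀))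
  + (⨆ x : X, ‖(dX h x).comp ((A x).symm : E →L[ℝ] E)‖ₑ)
  + (⨆ x : X, ‖(dX (dX h) x).bilinearComp ((A x).symm : E →L[ℝ] E)
      ((A x).symm : E →L[ℝ] E)‖ₑ)

/-- The cost functions `ℰ²`: the `C²` functions on `X` of finite norm. -/
def E2 {X : Set E} (A : X → E ≃L[ℝ] E) (x₀ : X) : Set (X → ℝ) :=
  {h | ContDiffOn ℝ 2 (extZero h) X ∧ E2norm A x₀ h < ⊤}

end Space

/-! ### The parametrized system `x ↦ f(x, ξ, θ)` -/

section System

variable {E F Ξ : Type*} [NormedAddCommGroup E] [NormedSpace ℝ E]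
  [NormedAddCommGroup F] [NormedSpace ℝ F] {X : Set E}

/-- `∂f/∂x`. -/
def fX (f : X → Ξ → F → X) (x : X) (ξ : Ξ) (θ : F) : E →L[ℝ] E :=
  dX (fun x' => (f x' ξ θ : E)) x

/-- `∂f/∂θ`. -/
def fΘ (f : X → Ξ → F → X) (x : X) (ξ : Ξ) (θ : F) : F →L[ℝ] E :=
  fderiv ℝ (fun θ' => (f x ξ θ' : E)) θ

/-- `∂²f/∂x²`. -/
def fXX (f : X → Ξ → F → X) (x : X) (ξ : Ξ) (θ : F) : E →L[ℝ] E →L[ℝ] E :=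
  dX (fun x' => fX f x' ξ θ) x

/-- `∂²f/∂θ²`. -/
def fΘΘ (f : X → Ξ → F → X) (x : X) (ξ : Ξ) (θ : F) : F →L[ℝ] F →L[ℝ] E :=
  fderiv ℝ (fun θ' => fΘ f x ξ θ') θ

/-- `∂²f/∂x∂θ`. -/
def fXΘ (f : X → Ξ → F → X) (x : X) (ξ : Ξ) (θ : F) : E →L[ℝ] F →L[ℝ] E :=
  dX (fun x' => fΘ f x' ξ θ) x

/-- Postcomposition of a bilinear map with a linear map, `(u, v) ↦ T (Q [u, v])`. -/
def postBilin {G H : Type*} [NormedAddCommGroup G] [NormedSpace ℝ G]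
    [NormedAddCommGroup H] [NormedSpace ℝ H]
    (T : E →L[ℝ] E) (Q : G →L[ℝ] H →L[ℝ] E) : G →L[ℝ] H →L[ℝ] E :=
  (ContinuousLinearMap.compL ℝ H E E T).comp Q

variable [MeasurableSpace Ξ]

/-- `L_X(x,θ) = (∫ ‖A(f) ∂f/∂x A(x)⁻¹‖² dν)^{1/2}`. -/
def LX (ν : Measure Ξ) (f : X → Ξ → F → X) (A : X → E ≃L[ℝ] E) (x : X) (θ : F) : ℝ≥0∞ :=
  (∫⁻ ξ, ‖((A (f x ξ θ) : E →L[ℝ] E).comp (fX f x ξ θ)).comp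
    ((A x).symm : E →L[ℝ] E)‖ₑ ^ 2 ∂ν) ^ (1 / 2 : ℝ)

/-- `L_Θ(x,θ) = (∫ ‖A(f) ∂f/∂θ B(x)⁻¹‖² dν)^{1/2}`. -/
def LΘ (ν : Measure Ξ) (f : X → Ξ → F → X) (A : X → E ≃L[ℝ] E) (B : X → F ≃L[ℝ] F)
    (x : X) (θ : F) : ℝ≥0∞ :=
  (∫⁻ ξ, ‖((A (f x ξ θ) : E →L[ℝ] E).comp (fΘ f x ξ θ)).comp
    ((B x).symm : F →L[ℝ] F)‖ₑ ^ 2 ∂ν) ^ (1 / 2 : ℝ)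

/-- `L_{X²}(x,θ) = ∫ ‖A(f) ∂²f/∂x² (A(x)⁻¹ ⊕ A(x)⁻¹)‖ dν`. -/
def LXX (ν : Measure Ξ) (f : X → Ξ → F → X) (A : X → E ≃L[ℝ] E) (x : X) (θ : F) : ℝ≥0∞ :=
  ∫⁻ ξ, ‖(postBilin (A (f x ξ θ) : E →L[ℝ] E) (fXX f x ξ θ)).bilinearComp
    ((A x).symm : E →L[ℝ] E) ((A x).symm : E →L[ℝ] E)‖ₑ ∂ν

/-- `L_{Θ²}(x,θ) = ∫ ‖A(f) ∂²f/∂θ² (B(x)⁻¹ ⊕ B(x)⁻¹)‖ dν`. -/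
def LΘΘ (ν : Measure Ξ) (f : X → Ξ → F → X) (A : X → E ≃L[ℝ] E) (B : X → F ≃L[ℝ] F)
    (x : X) (θ : F) : ℝ≥0∞ :=
  ∫⁻ ξ, ‖(postBilin (A (f x ξ θ) : E →L[ℝ] E) (fΘΘ f x ξ θ)).bilinearComp
    ((B x).symm : F →L[ℝ] F) ((B x).symm : F →L[ℝ] F)‖ₑ ∂ν

/-- `L_{X,Θ}(x,θ) = ∫ ‖A(f) ∂²f/∂x∂θ (A(x)⁻¹ ⊕ B(x)⁻¹)‖ dν`. -/
def LXΘ (ν : Measure Ξ) (f : X → Ξ → F → X) (A : X → E ≃L[ℝ] E) (B : X → F ≃L[ℝ] F)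
    (x : X) (θ : F) : ℝ≥0∞ :=
  ∫⁻ ξ, ‖(postBilin (A (f x ξ θ) : E →L[ℝ] E) (fXΘ f x ξ θ)).bilinearComp
    ((A x).symm : E →L[ℝ] E) ((B x).symm : F →L[ℝ] F)‖ₑ ∂ν

/-- The state space and its Finsler structure. The nonempty interior makes derivatives of
functions on `X` unambiguous. -/
structure FinslerConditions (X : Set E) (A : X → E ≃L[ℝ] E) : Prop where
  closed : IsClosed X
  convex : Convex ℝ X
  interior : (interior X).Nonempty
  continuous : Continuous (fun x => (A x : E →L[ℝ] E))
  inv_bounded : ∃ C : ℝ, ∀ x, ‖((A x).symm : E →L[ℝ] E)‖ ≤ C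

/-- Regularity of the system: integrability, and `C²` dependence on `(x, θ)`. -/
structure SystemConditions [MeasurableSpace E] (ν : Measure Ξ) (Θ : Set F)
    (f : X → Ξ → F → X) (A : X → E ≃L[ℝ] E) : Prop where
  isOpen : IsOpen Θ
  measurable : ∀ x, ∀ θ ∈ Θ, Measurable (fun ξ => f x ξ θ)
  integrable : ∀ x, ∀ θ ∈ Θ, Integrable (fun ξ => dA A x (f x ξ θ) ^ 2) ν
  contDiff : ∀ ξ, ContDiffOn ℝ 2
    (fun p : E × F => extZero (fun x : X => (f x ξ p.2 : E)) p.1) (X ×ˢ Θ)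

/-- `x ↦ ‖B(x)‖` is Lipschitz for `d_A`. -/
def WeightCondition (A : X → E ≃L[ℝ] E) (B : X → F ≃L[ℝ] F) : Prop :=
  ∃ C : ℝ, ∀ x y : X, |‖(B x : F →L[ℝ] F)‖ - ‖(B y : F →L[ℝ] F)‖| ≤ C * dA A x y

/-- Continuity and bounds for the functions `L`, with contraction constant `K_X < 1`. -/
structure BoundConditions (ν : Measure Ξ) (Θ : Set F) (f : X → Ξ → F → X)
    (A : X → E ≃L[ℝ] E) (B : X → F ≃L[ℝ] F) (K_X : ℝ) : Prop where
  nonneg : 0 ≤ K_X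
  lt_one : K_X < 1
  cont_LX : ContinuousOn (fun p : X × F => LX ν f A p.1 p.2) (univ ×ˢ Θ)
  cont_LΘ : ContinuousOn (fun p : X × F => LΘ ν f A B p.1 p.2) (univ ×ˢ Θ)
  cont_LXX : ContinuousOn (fun p : X × F => LXX ν f A p.1 p.2) (univ ×ˢ Θ)
  cont_LΘΘ : ContinuousOn (fun p : X × F => LΘΘ ν f A B p.1 p.2) (univ ×ˢ Θ)
  cont_LXΘ : ContinuousOn (fun p : X × F => LXΘ ν f A B p.1 p.2) (univ ×ˢ Θ)
  bound_LX : ∀ x, ∀ θ ∈ Θ, LX ν f A x θ ≤ ENNReal.ofReal K_X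
  bound_LΘ : ∃ K : ℝ, ∀ x, ∀ θ ∈ Θ, LΘ ν f A B x θ ≤ ENNReal.ofReal K
  bound_LXX : ∃ K : ℝ, ∀ x, ∀ θ ∈ Θ, LXX ν f A x θ ≤ ENNReal.ofReal K
  bound_LΘΘ : ∃ K : ℝ, ∀ x, ∀ θ ∈ Θ, LΘΘ ν f A B x θ ≤ ENNReal.ofReal K
  bound_LXΘ : ∃ K : ℝ, ∀ x, ∀ θ ∈ Θ, LXΘ ν f A B x θ ≤ ENNReal.ofReal K

end System

/-- The transition kernel of `x_{n+1} = f(x_n, ξ_{n+1}, θ)` with i.i.d. `ν`-distributed inputs. -/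
def transition {E F Ξ : Type*} [MeasurableSpace E] [MeasurableSpace Ξ] {X : Set E}
    (ν : Measure Ξ) (f : X → Ξ → F → X) (θ : F) : Kernel X X :=
  (Kernel.id ×ₖ Kernel.const X ν).map (fun p : X × Ξ => f p.1 p.2 θ)

/-- `transition` is the law of `f(x, ξ, θ)` as soon as `f(·, ·, θ)` is measurable. -/
theorem transition_apply {E F Ξ : Type*} [MeasurableSpace E] [MeasurableSpace Ξ]
    {X : Set E} (ν : Measure Ξ) [IsProbabilityMeasure ν]
    (f : X → Ξ → F → X) (θ : F)
    (hf : Measurable (fun p : X × Ξ => f p.1 p.2 θ)) (x : X) :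
    transition ν f θ x = ν.map (fun ξ => f x ξ θ) := by
  rw [transition, Kernel.map_apply _ hf, Kernel.prod_apply, Kernel.id_apply, Kernel.const_apply,
    Measure.dirac_prod, Measure.map_map hf measurable_prodMk_left]
  rfl

end StationaryDiff

end

open StationaryDiff

open MeasureTheory ProbabilityTheory Set Filter Topology
open scoped ENNReal

noncomputable section

namespace StationaryDiff

/-! ### Measurability of derivatives and L² inequalities for parametrized integrals. -/

section Generic

variable {Ξ : Type*} [MeasurableSpace Ξ]

/-! Two runs of the chain driven by the same noise approach each other. The map `f(·, ξ, θ)` sends a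
curve `γ` to a curve of speed `‖A(f) (∂f/∂x) γ'‖`, and Minkowski's integral inequality in `L²(ν)`
bounds the root-mean-square length of the image by `K_X` times the length of `γ`. So `d_A` is
contracted in mean square (`lintegral_dA_f_left_le`). The same argument along a segment of
parameters bounds the displacement caused by a change `Δ` of `θ` by a multiple of `‖B(x) Δ‖`
(`lintegral_dA_f_right_le`).

Write `P` for the transition operator. Contraction keeps the second moments of the chain bounded, so
its laws are tight, and a limit point is stationary (`exists_invariant`). It also makes `Pⁿ φ`
converge to `μ(φ)` for Lipschitz `φ` and stationary `μ`, which gives uniqueness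
(`invariant_unique`). On costs, differentiation under the integral shows that bounds `n₁`, `n₂` on
the first and second derivatives become `K n₁` and `K² n₂ + L n₁` (`CostBound.meanOp`). Both then
decay like `Kⁿ` along the iterates (`CostBound.iterate_meanOp`), and this is the geometric
convergence in `ℰ²`.

For the dependence on `θ`, the mean value inequality along parameter segments gives a first-order
expansion of `P_θ e(x)` with remainder `O(‖B(x) Δ‖²)` (`abs_meanOp_sub_sub_le`), and a bound
`O(‖B(x) Δ‖)` on the `x`-derivative of `P_{θ₀+Δ} e - P_{θ₀} e` (`abs_dX_meanOp_sub_le`). Since `‖B‖`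
is Lipschitz for `d_A`, it has second moments under the stationary measures, bounded locally
uniformly in `θ`. Shared noise couples `π_{θ₀+Δ}` and `π_{θ₀}` at mean-square distance `O(‖Δ‖)`
(`exists_coupling`). The cross remainder is a product of two first-order effects, hence quadratic in
`‖Δ‖` (`abs_integral_cross_le`).

For (d), put `g_n = P_{θ₀}ⁿ e`. Stationarity gives `(π_θ - π_{θ₀})(g_n - g_{n+1}) = π_θ (P_θ -
P_{θ₀}) g_n`, which is `π_{θ₀}` of `∂P_{θ₀}(θ - θ₀) g_n` up to an error `O(Kⁿ ‖θ - θ₀‖²)`. Summing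
over `n` telescopes the left side, and the leftover `(π_θ - π_{θ₀}) g_N` tends to zero
(`CostBound.hasFDerivAt_integral`). -/

theorem stronglyMeasurable_clm_of_apply {V G : Type*} [NormedAddCommGroup V] [NormedSpace ℝ V]
    [FiniteDimensional ℝ V] [NormedAddCommGroup G] [NormedSpace ℝ G]
    {L : Ξ → V →L[ℝ] G} (h : ∀ u, StronglyMeasurable (fun ξ => L ξ u)) :
    StronglyMeasurable L := by
  classical
  let b := Module.finBasis ℝ V
  have : L = fun ξ => ∑ i, (LinearMap.toContinuousLinearMap (b.coord i)).smulRight (L ξ (b i)) := by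
    funext ξ
    ext u
    simp only [sum_apply, ContinuousLinearMap.smulRight_apply,
      LinearMap.coe_toContinuousLinearMap', Module.Basis.coord_apply]
    conv_lhs => rw [← b.sum_repr u]
    rw [map_sum]
    simp only [map_smul]
  rw [this]
  refine Finset.stronglyMeasurable_fun_sum _ fun i _ => ?_
  have hc : Continuous (fun g : G =>
      (LinearMap.toContinuousLinearMap (b.coord i)).smulRight g) :=
    (ContinuousLinearMap.smulRightL ℝ V G (LinearMap.toContinuousLinearMap (b.coord i))).continuous
  exact hc.comp_stronglyMeasurable (h (b i))

/-- The derivative of a family of functions is measurable in the parameter. -/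
theorem stronglyMeasurable_of_hasFDerivWithinAt {V G : Type*} [NormedAddCommGroup V]
    [NormedSpace ℝ V] [FiniteDimensional ℝ V] [NormedAddCommGroup G] [NormedSpace ℝ G]
    {s : Set V} {x : V} (hx : x ∈ s) (hs : UniqueDiffWithinAt ℝ s x)
    {v : V → Ξ → G} {v' : Ξ → V →L[ℝ] G} (hv : ∀ y ∈ s, StronglyMeasurable (v y))
    (hd : ∀ ξ, HasFDerivWithinAt (fun y => v y ξ) (v' ξ) s x) : StronglyMeasurable v' := by
  classical
  -- The directions in which the derivative is measurable form a subspace. It contains the tangent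
  -- cone, where the derivative is a limit of difference quotients. Unique differentiability makes
  -- the span of the cone dense, and subspaces are closed in finite dimension.
  let S : Submodule ℝ V :=
    { carrier := {u | StronglyMeasurable (fun ξ => v' ξ u)}
      add_mem' := fun {a b} ha hb => by
        simp only [mem_ofPred_eq, map_add] at *
        exact ha.add hb
      zero_mem' := by
        simp only [mem_ofPred_eq, map_zero]
        exact stronglyMeasurable_const
      smul_mem' := fun c a ha => by
        simp only [mem_ofPred_eq, map_smul] at *
        exact ha.const_smul c }
  have hcone : tangentConeAt ℝ s x ⊆ S := by
    intro u hu
    obtain ⟨c, d, hd0, hds, hcd⟩ := mem_tangentConeAt_iff_exists_seq.1 hu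
    change StronglyMeasurable (fun ξ => v' ξ u)
    -- The increments `d n` stay in `s` only eventually; the earlier quotients are replaced by zero.
    refine stronglyMeasurable_of_tendsto (f := fun (n : ℕ) ξ =>
      if x + d n ∈ s then c n • (v (x + d n) ξ - v x ξ) else 0) atTop ?_ ?_
    · intro n
      split_ifs with h
      · exact ((hv _ h).sub (hv x hx)).const_smul (c n)
      · exact stronglyMeasurable_const
    · refine tendsto_pi_nhds.2 fun ξ => ?_
      refine ((hd ξ).lim hd0 hds hcd).congr' ?_
      filter_upwards [hds] with n hn
      simp [hn]
  have htop : ∀ u, u ∈ S := by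
    intro u
    have h1 : (Submodule.span ℝ (tangentConeAt ℝ s x)) ≤ S := Submodule.span_le.2 hcone
    have h2 : IsClosed (S : Set V) := S.closed_of_finiteDimensional
    have h3 : Dense (S : Set V) := hs.dense_tangentConeAt.mono h1
    have := h3.closure_eq
    rw [h2.closure_eq] at this
    have h4 : u ∈ (S : Set V) := this ▸ mem_univ u
    exact h4
  exact stronglyMeasurable_clm_of_apply htop

/-- Cauchy–Schwarz. Squared bounds as hypotheses keep square roots of integrals out of the later
estimates. -/
theorem lintegral_mul_le_of_sq_le {ν : Measure Ξ} {g h : Ξ → ℝ≥0∞} (hg : AEMeasurable g ν)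
    (hh : AEMeasurable h ν) {a b : ℝ≥0∞} (ha : ∫⁻ ξ, g ξ ^ 2 ∂ν ≤ a ^ 2)
    (hb : ∫⁻ ξ, h ξ ^ 2 ∂ν ≤ b ^ 2) : ∫⁻ ξ, g ξ * h ξ ∂ν ≤ a * b := by
  refine (ENNReal.lintegral_mul_le_Lp_mul_Lq ν Real.HolderConjugate.two_two hg hh).trans ?_
  have key : ∀ x c : ℝ≥0∞, x ≤ c ^ 2 → x ^ (1 / 2 : ℝ) ≤ c := by
    intro x c hx
    refine (ENNReal.rpow_le_rpow hx (by norm_num)).trans ?_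
    rw [← ENNReal.rpow_natCast, ← ENNReal.rpow_mul]
    norm_num
  gcongr
  · exact key _ _ (by simpa using ha)
  · exact key _ _ (by simpa using hb)

/-- Minkowski's integral inequality in `L²`. -/
theorem lintegral_lintegral_sq_le {T : Type*} [MeasurableSpace T] {ν : Measure Ξ} [SFinite ν]
    {μ : Measure T} [SFinite μ] {h : T → Ξ → ℝ≥0∞} (hm : Measurable (Function.uncurry h))
    {w : T → ℝ≥0∞} (hw : AEMeasurable w μ)
    (hb : ∀ᵐ t ∂μ, ∫⁻ ξ, h t ξ ^ 2 ∂ν ≤ w t ^ 2) :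
    ∫⁻ ξ, (∫⁻ t, h t ξ ∂μ) ^ 2 ∂ν ≤ (∫⁻ t, w t ∂μ) ^ 2 := by
  have hmt : ∀ t, Measurable (h t) := fun t => hm.comp measurable_prodMk_left
  have hmξ : ∀ ξ, Measurable (fun t => h t ξ) := fun ξ => hm.comp measurable_prodMk_right
  -- The square is a double integral over `(t, s)`. After Tonelli, Cauchy–Schwarz in `ξ` leaves `w t
  -- * w s`, which factors again.
  have e1 : ∀ ξ, (∫⁻ t, h t ξ ∂μ) ^ 2 = ∫⁻ t, ∫⁻ s, h t ξ * h s ξ ∂μ ∂μ := by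
    intro ξ
    rw [sq, ← lintegral_mul_const _ (hmξ ξ)]
    congr 1; funext t
    rw [lintegral_const_mul _ (hmξ ξ)]
  have m3 : Measurable (fun p : (Ξ × T) × T => h p.1.2 p.1.1 * h p.2 p.1.1) :=
    (hm.comp (measurable_fst.snd.prodMk measurable_fst.fst)).mul
      (hm.comp (measurable_snd.prodMk measurable_fst.fst))
  calc ∫⁻ ξ, (∫⁻ t, h t ξ ∂μ) ^ 2 ∂ν
      = ∫⁻ ξ, ∫⁻ t, ∫⁻ s, h t ξ * h s ξ ∂μ ∂μ ∂ν := by simp_rw [e1]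
    _ = ∫⁻ t, ∫⁻ ξ, ∫⁻ s, h t ξ * h s ξ ∂μ ∂ν ∂μ := by
        refine lintegral_lintegral_swap ?_
        exact (m3.lintegral_prod_right').aemeasurable
    _ = ∫⁻ t, ∫⁻ s, ∫⁻ ξ, h t ξ * h s ξ ∂ν ∂μ ∂μ := by
        congr 1; funext t
        refine lintegral_lintegral_swap ?_
        exact (((hmt t).comp measurable_fst).mul
          (hm.comp measurable_swap)).aemeasurable
    _ ≤ ∫⁻ t, ∫⁻ s, w t * w s ∂μ ∂μ := by
        refine lintegral_mono_ae ?_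
        filter_upwards [hb] with t ht
        refine lintegral_mono_ae ?_
        filter_upwards [hb] with s hs
        exact lintegral_mul_le_of_sq_le (hmt t).aemeasurable (hmt s).aemeasurable ht hs
    _ = (∫⁻ t, w t ∂μ) ^ 2 := by
        rw [sq, ← lintegral_mul_const'' _ hw]
        congr 1; funext t
        rw [lintegral_const_mul'' _ hw]

theorem lintegral_add_sq_le {ν : Measure Ξ} {g h : Ξ → ℝ≥0∞} (hg : AEMeasurable g ν)
    (hh : AEMeasurable h ν) {a b : ℝ≥0∞} (ha : ∫⁻ ξ, g ξ ^ 2 ∂ν ≤ a ^ 2)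
    (hb : ∫⁻ ξ, h ξ ^ 2 ∂ν ≤ b ^ 2) : ∫⁻ ξ, (g ξ + h ξ) ^ 2 ∂ν ≤ (a + b) ^ 2 := by
  have e : ∀ ξ, (g ξ + h ξ) ^ 2 = g ξ ^ 2 + 2 * (g ξ * h ξ) + h ξ ^ 2 := fun ξ => by ring
  simp_rw [e]
  rw [lintegral_add_left' (by fun_prop), lintegral_add_left' (by fun_prop),
    lintegral_const_mul'' _ (by fun_prop)]
  have := lintegral_mul_le_of_sq_le hg hh ha hb
  calc _ ≤ a ^ 2 + 2 * (a * b) + b ^ 2 := by gcongr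
    _ = _ := by ring

/-- If `‖∂c/∂t‖` has integral at most `M` for each `t`, then `‖c(1) - c(0)‖` does. -/
theorem lintegral_enorm_sub_le_of_hasDerivWithinAt {G : Type*} [NormedAddCommGroup G]
    [NormedSpace ℝ G] [CompleteSpace G] {ν : Measure Ξ} [SFinite ν] {c c' : ℝ → Ξ → G}
    (hd : ∀ ξ, ∀ t ∈ Icc (0 : ℝ) 1, HasDerivWithinAt (fun s => c s ξ) (c' t ξ) (Icc 0 1) t)
    (hc : ∀ ξ, ContinuousOn (fun t => c' t ξ) (Icc 0 1))
    (hm : ∀ t ∈ Icc (0 : ℝ) 1, StronglyMeasurable (c' t)) {M : ℝ≥0∞}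
    (hM : ∀ t ∈ Icc (0 : ℝ) 1, ∫⁻ ξ, ‖c' t ξ‖ₑ ∂ν ≤ M) :
    ∫⁻ ξ, ‖c 1 ξ - c 0 ξ‖ₑ ∂ν ≤ M := by
  have h01 : (0 : ℝ) ≤ 1 := zero_le_one
  -- Clamping `t` to `[0, 1]` makes the field continuous in every `t`, as joint measurability of a
  -- function continuous in one variable and measurable in the other requires.
  let k : ℝ → Ξ → G := fun t ξ => c' (projIcc 0 1 h01 t) ξ
  have hk : ∀ t ∈ Icc (0 : ℝ) 1, k t = c' t := by
    intro t ht
    simp only [k, projIcc_of_mem h01 ht]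
  have hkm : StronglyMeasurable (Function.uncurry k) := by
    refine stronglyMeasurable_uncurry_of_continuous_of_stronglyMeasurable ?_ ?_
    · intro ξ
      exact (continuousOn_iff_continuous_domRestrict.1 (hc ξ)).comp continuous_projIcc
    · intro t
      exact hm _ (projIcc 0 1 h01 t).2
  have pt : ∀ ξ, ‖c 1 ξ - c 0 ξ‖ₑ ≤ ∫⁻ t in Ioc (0 : ℝ) 1, ‖k t ξ‖ₑ := by
    intro ξ
    have hint : IntervalIntegrable (fun t => c' t ξ) volume 0 1 :=
      (hc ξ).intervalIntegrable_of_Icc h01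
    have := intervalIntegral.integral_eq_sub_of_hasDerivAt_of_le h01
      (fun t ht => (hd ξ t ht).continuousWithinAt)
      (fun t ht => (hd ξ t (Ioo_subset_Icc_self ht)).hasDerivAt (Icc_mem_nhds ht.1 ht.2)) hint
    rw [← this, intervalIntegral.integral_of_le h01]
    refine (enorm_integral_le_lintegral_enorm _).trans ?_
    refine le_of_eq (setLIntegral_congr_fun measurableSet_Ioc fun t ht => ?_)
    simp only [hk t (Ioc_subset_Icc_self ht)]
  calc ∫⁻ ξ, ‖c 1 ξ - c 0 ξ‖ₑ ∂ν ≤ ∫⁻ ξ, (∫⁻ t in Ioc (0 : ℝ) 1, ‖k t ξ‖ₑ) ∂ν := lintegral_mono pt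
    _ = ∫⁻ t in Ioc (0 : ℝ) 1, ∫⁻ ξ, ‖k t ξ‖ₑ ∂ν := by
        refine lintegral_lintegral_swap ?_
        exact (hkm.comp_measurable measurable_swap).enorm.aemeasurable
    _ ≤ ∫⁻ t in Ioc (0 : ℝ) 1, M := by
        refine setLIntegral_mono measurable_const fun t ht => ?_
        rw [hk t (Ioc_subset_Icc_self ht)]
        exact hM t (Ioc_subset_Icc_self ht)
    _ = M := by simp

/-- Dominated convergence with a convergent sequence of dominating functions. -/
theorem tendsto_lintegral_zero_of_dominated {ι : Type*} {l : Filter ι} [l.IsCountablyGenerated]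
    {ν : Measure Ξ} {φ G : ι → Ξ → ℝ≥0∞} {G' : Ξ → ℝ≥0∞}
    (hφm : ∀ᶠ n in l, AEMeasurable (φ n) ν) (hGm : ∀ᶠ n in l, AEMeasurable (G n) ν)
    (hle : ∀ᶠ n in l, ∀ ξ, φ n ξ ≤ G n ξ)
    (hφ : ∀ ξ, Tendsto (fun n => φ n ξ) l (𝓝 0))
    (hG : ∀ ξ, Tendsto (fun n => G n ξ) l (𝓝 (G' ξ)))
    (hfin : ∫⁻ ξ, G' ξ ∂ν ≠ ⊤)
    (hI : Tendsto (fun n => ∫⁻ ξ, G n ξ ∂ν) l (𝓝 (∫⁻ ξ, G' ξ ∂ν))) :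
    Tendsto (fun n => ∫⁻ ξ, φ n ξ ∂ν) l (𝓝 0) := by
  refine tendsto_of_seq_tendsto fun u hu => ?_
  have hall : ∀ᶠ n in atTop, AEMeasurable (φ (u n)) ν ∧ AEMeasurable (G (u n)) ν ∧
      (∀ ξ, φ (u n) ξ ≤ G (u n) ξ) ∧ ∫⁻ ξ, G (u n) ξ ∂ν < ⊤ :=
    hu.eventually (hφm.and (hGm.and (hle.and (hI.eventually_lt_const (lt_top_iff_ne_top.2 hfin)))))
  obtain ⟨N, hN⟩ := eventually_atTop.1 hall
  -- Dropping the first `N` terms makes the eventual hypotheses valid for every index.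
  rw [← tendsto_add_atTop_iff_nat N]
  have hN' : ∀ n, AEMeasurable (φ (u (n + N))) ν ∧ AEMeasurable (G (u (n + N))) ν ∧
      (∀ ξ, φ (u (n + N)) ξ ≤ G (u (n + N)) ξ) ∧ ∫⁻ ξ, G (u (n + N)) ξ ∂ν < ⊤ :=
    fun n => hN _ (Nat.le_add_left _ _)
  have hu' : Tendsto (fun n => u (n + N)) atTop l := hu.comp (tendsto_add_atTop_nat N)
  set a := ∫⁻ ξ, G' ξ ∂ν with ha
  -- Fatou's lemma for `G - φ`, whose pointwise limit is `G'`. Since the integrals of `G` converge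
  -- to `a`, nothing is left for the integrals of `φ`.
  have hfatou : a ≤ liminf (fun n => ∫⁻ ξ, (G (u (n + N)) ξ - φ (u (n + N)) ξ) ∂ν) atTop := by
    refine le_trans ?_ (lintegral_liminf_le' fun n => (hN' n).2.1.sub (hN' n).1)
    refine lintegral_mono fun ξ => ?_
    have : Tendsto (fun n => G (u (n + N)) ξ - φ (u (n + N)) ξ) atTop (𝓝 (G' ξ)) := by
      have := ENNReal.Tendsto.sub ((hG ξ).comp hu') ((hφ ξ).comp hu') (Or.inr ENNReal.zero_ne_top)
      simpa using this
    rw [this.liminf_eq]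
  have hlen : ∀ n, ∫⁻ ξ, φ (u (n + N)) ξ ∂ν ≤ ∫⁻ ξ, G (u (n + N)) ξ ∂ν :=
    fun n => lintegral_mono (hN' n).2.2.1
  have hadd : ∀ n, ∫⁻ ξ, (G (u (n + N)) ξ - φ (u (n + N)) ξ) ∂ν
      = ∫⁻ ξ, G (u (n + N)) ξ ∂ν - ∫⁻ ξ, φ (u (n + N)) ξ ∂ν := fun n =>
    lintegral_sub' (hN' n).1 ((hlen n).trans_lt (hN' n).2.2.2).ne
      (ae_of_all _ (hN' n).2.2.1)
  simp_rw [hadd] at hfatou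
  rw [ENNReal.tendsto_nhds_zero]
  intro ε hε
  rcases eq_or_ne ε ⊤ with rfl | hεt
  · simp
  have hε2 : ε / 2 ≠ 0 := (ENNReal.half_pos hε.ne').ne'
  have h1 : ∀ᶠ n in atTop, ∫⁻ ξ, G (u (n + N)) ξ ∂ν < a + ε / 2 :=
    (hI.comp hu').eventually_lt_const (ENNReal.lt_add_right hfin hε2)
  have h2 : ∀ᶠ n in atTop, a ≤ (∫⁻ ξ, G (u (n + N)) ξ ∂ν - ∫⁻ ξ, φ (u (n + N)) ξ ∂ν) + ε / 2 := by
    rcases le_or_gt a (ε / 2) with h | h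
    · exact Eventually.of_forall fun n => h.trans le_add_self
    · have hlt : a - ε / 2 < a :=
        ENNReal.sub_lt_self hfin (by rintro h0; rw [h0] at h; exact not_lt_bot h) hε2
      filter_upwards [eventually_lt_of_lt_liminf (hlt.trans_le hfatou)] with n hn
      exact tsub_le_iff_right.1 hn.le
  filter_upwards [h1, h2] with n hn1 hn2
  have hφt : ∫⁻ ξ, φ (u (n + N)) ξ ∂ν ≠ ⊤ := ((hlen n).trans_lt (hN' n).2.2.2).ne
  have h3 : a + ∫⁻ ξ, φ (u (n + N)) ξ ∂ν ≤ a + ε := by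
    calc a + ∫⁻ ξ, φ (u (n + N)) ξ ∂ν
        ≤ (∫⁻ ξ, G (u (n + N)) ξ ∂ν - ∫⁻ ξ, φ (u (n + N)) ξ ∂ν) + ε / 2
          + ∫⁻ ξ, φ (u (n + N)) ξ ∂ν := by gcongr
      _ = ∫⁻ ξ, G (u (n + N)) ξ ∂ν + ε / 2 := by
          rw [add_right_comm, tsub_add_cancel_of_le (hlen n)]
      _ ≤ a + ε / 2 + ε / 2 := by gcongr
      _ = a + ε := by rw [add_assoc, ENNReal.add_halves]
  exact (ENNReal.add_le_add_iff_left hfin).1 h3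

end Generic

end StationaryDiff
end

open MeasureTheory ProbabilityTheory Set Filter Topology
open scoped ENNReal

noncomputable section

namespace StationaryDiff

/-! ### Piecewise `C¹` curves and their Finsler length. -/

section Curves

variable {E : Type*} [NormedAddCommGroup E] [NormedSpace ℝ E]

set_option linter.unusedSectionVars false
set_option maxSynthPendingDepth 3

theorem extZero_coe {G : Type*} [Zero G] {X : Set E} (h : X → G) (x : X) :
    extZero h (x : E) = h x :=
  Subtype.val_injective.extend_apply _ _ _

theorem contDiffOn_singleton' {G : Type*} [NormedAddCommGroup G] [NormedSpace ℝ G]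
    {n : WithTop ℕ∞} (c : ℝ → G) (s : ℝ) : ContDiffOn ℝ n c {s} :=
  contDiffOn_const (c := c s) |>.congr fun x hx => by rw [mem_singleton_iff.1 hx]

namespace PiecewiseC1

variable {c c' : ℝ → E} {a b d : ℝ}

theorem le (h : PiecewiseC1 c a b) : a ≤ b := by
  obtain ⟨k, t, ht, rfl, rfl, -⟩ := h
  exact ht (Nat.zero_le k)

theorem of_contDiffOn (hab : a ≤ b) (h : ContDiffOn ℝ 1 c (Icc a b)) : PiecewiseC1 c a b := by
  refine ⟨1, fun i => if i = 0 then a else b, ?_, by simp, by simp, ?_⟩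
  · refine monotone_nat_of_le_succ fun n => ?_
    rcases n with _ | n <;> simp [hab]
  · intro i hi
    obtain rfl : i = 0 := by omega
    simpa using h

theorem congr (h : PiecewiseC1 c a b) (he : EqOn c' c (Icc a b)) : PiecewiseC1 c' a b := by
  obtain ⟨k, t, ht, rfl, rfl, h⟩ := h
  refine ⟨k, t, ht, rfl, rfl, fun i hi => (h i hi).congr fun x hx => he ?_⟩
  exact ⟨(ht (Nat.zero_le i)).trans hx.1, hx.2.trans (ht hi)⟩

theorem trans (h : PiecewiseC1 c a b) (h' : PiecewiseC1 c b d) : PiecewiseC1 c a d := by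
  obtain ⟨k, t, ht, rfl, rfl, h⟩ := h
  obtain ⟨k', t', ht', h0, rfl, h'⟩ := h'
  -- The two partitions share the point `b = t k = t' 0`, so index `k` is read from the second one.
  refine ⟨k + k', fun i => if i < k then t i else t' (i - k), ?_, ?_, by simp, ?_⟩
  · refine monotone_nat_of_le_succ fun n => ?_
    rcases lt_trichotomy (n + 1) k with hn | hn | hn
    · simp only [hn, if_true, show n < k by omega]
      exact ht (Nat.le_succ n)
    · simp only [show n < k by omega, if_true, hn, lt_irrefl, if_false, Nat.sub_self, h0]
      exact ht (by omega)
    · simp only [show ¬ n < k by omega, show ¬ n + 1 < k by omega, if_false]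
      exact ht' (by omega)
  · rcases Nat.eq_zero_or_pos k with rfl | hk
    · simpa using h0
    · simp [hk]
  · intro i hi
    rcases lt_trichotomy (i + 1) k with hn | hn | hn
    · simp only [hn, if_true, show i < k by omega]
      exact h i (by omega)
    · simp only [show i < k by omega, if_true, hn, lt_irrefl, if_false, Nat.sub_self, h0]
      exact hn ▸ h i (by omega)
    · simp only [show ¬ i < k by omega, show ¬ i + 1 < k by omega, if_false]
      have := h' (i - k) (by omega)
      rwa [show i - k + 1 = i + 1 - k by omega] at this

theorem comp_neg (h : PiecewiseC1 c a b) : PiecewiseC1 (fun s => c (-s)) (-b) (-a) := by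
  obtain ⟨k, t, ht, rfl, rfl, h⟩ := h
  refine ⟨k, fun i => -t (k - i), ?_, by simp, by simp, ?_⟩
  · intro i j hij
    exact neg_le_neg (ht (by omega))
  · intro i hi
    refine (h (k - (i + 1)) (by omega)).comp contDiff_neg.contDiffOn fun x hx => ?_
    rw [show k - (i + 1) + 1 = k - i by omega]
    exact ⟨by linarith [hx.2], by linarith [hx.1]⟩

theorem comp_add (h : PiecewiseC1 c a b) (r : ℝ) :
    PiecewiseC1 (fun s => c (s + r)) (a - r) (b - r) := by
  obtain ⟨k, t, ht, rfl, rfl, h⟩ := h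
  refine ⟨k, fun i => t i - r, ?_, by simp, by simp, ?_⟩
  · intro i j hij
    exact sub_le_sub_right (ht hij) _
  · intro i hi
    refine (h i hi).comp (contDiff_id.add contDiff_const).contDiffOn fun x hx => ?_
    exact ⟨by change t i ≤ x + r; linarith [hx.1], by change x + r ≤ t (i + 1); linarith [hx.2]⟩

theorem restrict (h : PiecewiseC1 c a b) {s : ℝ} (hs : s ∈ Icc a b) : PiecewiseC1 c a s := by
  obtain ⟨k, t, ht, rfl, rfl, h⟩ := h
  -- Truncation collapses the pieces beyond `s` to the single point `s`, on which smoothness is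
  -- trivial.
  refine ⟨k, fun i => min (t i) s, ?_, min_eq_left hs.1, min_eq_right hs.2, ?_⟩
  · intro i j hij
    exact min_le_min_right _ (ht hij)
  · intro i hi
    rcases le_total (t i) s with hle | hle
    · refine (h i hi).mono fun x hx => ?_
      simp only [min_eq_left hle] at hx
      exact ⟨hx.1, hx.2.trans (min_le_left _ _)⟩
    · simp only [min_eq_right hle, min_eq_right (hle.trans (ht (Nat.le_succ i))), Icc_self]
      exact contDiffOn_singleton' c s

theorem comp {G : Type*} [NormedAddCommGroup G] [NormedSpace ℝ G] {X : Set E}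
    (h : PiecewiseC1 c a b) (hX : ∀ t, c t ∈ X) {g : E → G} (hg : ContDiffOn ℝ 1 g X) :
    PiecewiseC1 (fun t => g (c t)) a b := by
  obtain ⟨k, t, ht, h0, hk, h⟩ := h
  exact ⟨k, t, ht, h0, hk, fun i hi => hg.comp (h i hi) fun x _ => hX x⟩

/-- All that integration along the curve needs. The derivative of each closed piece is bounded by
compactness, and the breakpoints form the exceptional set `S`. -/
theorem regular (h : PiecewiseC1 c a b) : ContinuousOn c (Icc a b) ∧ ∃ S : Set ℝ, S.Finite ∧
    ∃ M : ℝ, ∀ s ∈ Ioo a b \ S, DifferentiableAt ℝ c s ∧ ‖deriv c s‖ ≤ M := by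
  obtain ⟨k, t, ht, rfl, rfl, h⟩ := h
  suffices H : ∀ j ≤ k, ContinuousOn c (Icc (t 0) (t j)) ∧ ∃ S : Set ℝ, S.Finite ∧
      ∃ M : ℝ, ∀ s ∈ Ioo (t 0) (t j) \ S, DifferentiableAt ℝ c s ∧ ‖deriv c s‖ ≤ M from H k le_rfl
  intro j
  induction j with
  | zero =>
    intro _
    refine ⟨by simp, ∅, finite_empty, 0, fun s hs => ?_⟩
    simp at hs
  | succ j ih =>
    intro hj
    obtain ⟨hc, S, hS, M, hM⟩ := ih (by omega)
    have hp := h j (by omega)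
    have hjj : t j ≤ t (j + 1) := ht (Nat.le_succ j)
    refine ⟨?_, S ∪ {t j}, hS.union (finite_singleton _), ?_⟩
    · rw [← Icc_union_Icc_eq_Icc (ht (Nat.zero_le j)) hjj]
      exact hc.union_of_isClosed hp.continuousOn isClosed_Icc isClosed_Icc
    -- A piece of zero length adds no interior points, and the derivative within a single point is
    -- not unique, so it is treated apart.
    · rcases hjj.eq_or_lt with heq | hlt
      · refine ⟨M, fun s hs => hM s ⟨⟨hs.1.1, heq ▸ hs.1.2⟩, fun h => hs.2 (Or.inl h)⟩⟩
      · have hu : UniqueDiffOn ℝ (Icc (t j) (t (j + 1))) := uniqueDiffOn_Icc hlt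
        obtain ⟨M', hM'⟩ := isCompact_Icc.exists_bound_of_continuousOn
          (hp.continuousOn_derivWithin hu le_rfl)
        refine ⟨max M M', fun s hs => ?_⟩
        rcases lt_trichotomy s (t j) with hsj | hsj | hsj
        · obtain ⟨h1, h2⟩ := hM s ⟨⟨hs.1.1, hsj⟩, fun h => hs.2 (Or.inl h)⟩
          exact ⟨h1, h2.trans (le_max_left _ _)⟩
        · exact absurd (Or.inr hsj) hs.2
        · have hn : Icc (t j) (t (j + 1)) ∈ 𝓝 s := Icc_mem_nhds hsj hs.1.2
          have hs' : s ∈ Icc (t j) (t (j + 1)) := ⟨hsj.le, hs.1.2.le⟩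
          refine ⟨((hp.differentiableOn (by norm_num)) s hs').differentiableAt hn, ?_⟩
          rw [← derivWithin_of_mem_nhds hn]
          exact (hM' s hs').trans (le_max_right _ _)

end PiecewiseC1

variable {X : Set E} {A : X → E ≃L[ℝ] E}

/-- The Finsler speed of a curve. -/
def speed (A : X → E ≃L[ℝ] E) (γ : ℝ → X) (t : ℝ) : ℝ :=
  ‖A (γ t) (deriv (fun s => (γ s : E)) t)‖

theorem curveLength_eq (γ : ℝ → X) (a b : ℝ) : curveLength A γ a b = ∫ t in a..b, speed A γ t := rfl

theorem speed_nonneg (γ : ℝ → X) (t : ℝ) : 0 ≤ speed A γ t := norm_nonneg _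

theorem ae_Ioc_of_finite {a b : ℝ} {S : Set ℝ} (hS : S.Finite) {p : ℝ → Prop}
    (h : ∀ t ∈ Ioo a b \ S, p t) : ∀ᵐ t ∂(volume.restrict (Ioc a b)), p t := by
  have h1 : ∀ᵐ t : ℝ, t ∉ S ∪ {b} := by
    rw [ae_iff]
    simp only [not_not]
    exact ((hS.union (finite_singleton b)).countable).measure_zero _
  rw [ae_restrict_iff' measurableSet_Ioc]
  filter_upwards [h1] with t ht hmem
  refine h t ⟨⟨hmem.1, lt_of_le_of_ne hmem.2 fun hb => ht (Or.inr hb)⟩, fun hs => ht (Or.inl hs)⟩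

theorem curveLength_nonneg {γ : ℝ → X} {a b : ℝ} (hab : a ≤ b) : 0 ≤ curveLength A γ a b :=
  intervalIntegral.integral_nonneg hab fun _ _ => norm_nonneg _

variable [CompleteSpace E]

theorem speed_integrableOn (hA : Continuous (fun x => (A x : E →L[ℝ] E))) {γ : ℝ → X} {a b : ℝ}
    (h : PiecewiseC1 (fun t => (γ t : E)) a b) : IntegrableOn (speed A γ) (Ioc a b) := by
  obtain ⟨hc, S, hS, M, hM⟩ := h.regular
  have hγ : ContinuousOn γ (Icc a b) := continuousOn_iff_continuous_domRestrict.2 <|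
    Continuous.subtype_mk (continuousOn_iff_continuous_domRestrict.1 hc) _
  have hAγ : ContinuousOn (fun t => (A (γ t) : E →L[ℝ] E)) (Icc a b) := hA.comp_continuousOn hγ
  obtain ⟨K, hK⟩ := isCompact_Icc.exists_bound_of_continuousOn hAγ
  have hm : AEStronglyMeasurable (speed A γ) (volume.restrict (Ioc a b)) := by
    have h1 : AEStronglyMeasurable (fun t => (A (γ t) : E →L[ℝ] E)) (volume.restrict (Ioc a b)) :=
      (hAγ.mono Ioc_subset_Icc_self).aestronglyMeasurable measurableSet_Ioc
    exact (isBoundedBilinearMap_apply.continuous.comp_aestronglyMeasurable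
      (h1.prodMk (stronglyMeasurable_deriv (fun s => (γ s : E))).aestronglyMeasurable)).norm
  refine Integrable.mono' (g := fun _ => K * M) (integrable_const _) hm ?_
  refine ae_Ioc_of_finite hS fun t ht => ?_
  rw [Real.norm_of_nonneg (speed_nonneg _ _)]
  refine ((A (γ t) : E →L[ℝ] E).le_opNorm _).trans ?_
  have hK' := hK t (Ioo_subset_Icc_self ht.1)
  exact mul_le_mul hK' (hM t ht).2 (norm_nonneg _) ((norm_nonneg _).trans hK')

theorem speed_intervalIntegrable (hA : Continuous (fun x => (A x : E →L[ℝ] E))) {γ : ℝ → X}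
    {a b : ℝ} (h : PiecewiseC1 (fun t => (γ t : E)) a b) :
    IntervalIntegrable (speed A γ) volume a b :=
  (intervalIntegrable_iff_integrableOn_Ioc_of_le h.le).2 (speed_integrableOn hA h)

/-- In this form the length of a random curve can be integrated over the noise by Tonelli and
Minkowski. -/
theorem ofReal_curveLength (hA : Continuous (fun x => (A x : E →L[ℝ] E))) {γ : ℝ → X} {a b : ℝ}
    (h : PiecewiseC1 (fun t => (γ t : E)) a b) :
    ENNReal.ofReal (curveLength A γ a b)
      = ∫⁻ t in Ioc a b, ‖A (γ t) (deriv (fun s => (γ s : E)) t)‖ₑ := by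
  rw [curveLength_eq, intervalIntegral.integral_of_le h.le,
    ofReal_integral_eq_lintegral_ofReal (speed_integrableOn hA h)
      (ae_of_all _ fun t => speed_nonneg γ t)]
  simp only [speed, ofReal_norm]

end Curves
end StationaryDiff
end

open MeasureTheory ProbabilityTheory Set Filter Topology
open scoped ENNReal

noncomputable section

namespace StationaryDiff

/-! ### The Finsler distance: metric properties, Lipschitz functions, and comparison with the norm.
-/

section Metric

set_option linter.unusedSectionVars false
set_option maxSynthPendingDepth 3

variable {E : Type*} [NormedAddCommGroup E] [NormedSpace ℝ E] {X : Set E} {A : X → E ≃L[ℝ] E}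

/-- Passing to the open interval is essential: `deriv` at an endpoint depends on the curve outside
`[a, b]`. -/
theorem curveLength_congr {γ γ' : ℝ → X} {a b : ℝ} (hab : a ≤ b) (h : EqOn γ γ' (Icc a b)) :
    curveLength A γ a b = curveLength A γ' a b := by
  rw [curveLength_eq, curveLength_eq, intervalIntegral.integral_of_le hab,
    intervalIntegral.integral_of_le hab, integral_Ioc_eq_integral_Ioo,
    integral_Ioc_eq_integral_Ioo]
  refine setIntegral_congr_fun measurableSet_Ioo fun t ht => ?_
  have h1 : (fun s => (γ s : E)) =ᶠ[𝓝 t] fun s => (γ' s : E) := by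
    filter_upwards [Icc_mem_nhds ht.1 ht.2] with s hs
    rw [h hs]
  simp only [speed, h1.deriv_eq, h (Ioo_subset_Icc_self ht)]

theorem bddBelow_lengths (x y : X) :
    BddBelow {l : ℝ | ∃ (γ : ℝ → X) (a b : ℝ), PiecewiseC1 (fun t => (γ t : E)) a b ∧
      γ a = x ∧ γ b = y ∧ l = curveLength A γ a b} := by
  refine ⟨0, ?_⟩
  rintro l ⟨γ, a, b, h, -, -, rfl⟩
  exact curveLength_nonneg h.le

theorem dA_le_curveLength {γ : ℝ → X} {a b : ℝ} (h : PiecewiseC1 (fun t => (γ t : E)) a b) :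
    dA A (γ a) (γ b) ≤ curveLength A γ a b :=
  csInf_le (bddBelow_lengths _ _) ⟨γ, a, b, h, rfl, rfl, rfl⟩

theorem dA_nonneg (x y : X) : 0 ≤ dA A x y := by
  refine Real.sInf_nonneg ?_
  rintro l ⟨γ, a, b, h, -, -, rfl⟩
  exact curveLength_nonneg h.le

/-- The straight segment from `x` to `y`, constant outside `[0, 1]`. -/
def segCurve (hX : Convex ℝ X) (x y : X) (t : ℝ) : X :=
  ⟨(x : E) + (projIcc (0 : ℝ) 1 zero_le_one t : ℝ) • ((y : E) - x),
    hX.add_smul_sub_mem x.2 y.2 (projIcc (0 : ℝ) 1 zero_le_one t).2⟩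

theorem segCurve_coe (hX : Convex ℝ X) (x y : X) {t : ℝ} (ht : t ∈ Icc (0 : ℝ) 1) :
    (segCurve hX x y t : E) = (x : E) + t • ((y : E) - x) := by
  simp only [segCurve, projIcc_of_mem zero_le_one ht]

theorem segCurve_zero (hX : Convex ℝ X) (x y : X) : segCurve hX x y 0 = x := by
  ext; rw [segCurve_coe hX x y (by simp)]; simp

theorem segCurve_one (hX : Convex ℝ X) (x y : X) : segCurve hX x y 1 = y := by
  ext; rw [segCurve_coe hX x y (by simp)]; simp

theorem continuous_segCurve (hX : Convex ℝ X) (x y : X) : Continuous (segCurve hX x y) := by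
  refine Continuous.subtype_mk ?_ _
  have : Continuous (fun t : ℝ => ((projIcc (0 : ℝ) 1 zero_le_one t : Icc (0 : ℝ) 1) : ℝ)) :=
    continuous_subtype_val.comp continuous_projIcc
  fun_prop

theorem hasDerivWithinAt_segCurve (hX : Convex ℝ X) (x y : X) {t : ℝ} (ht : t ∈ Icc (0 : ℝ) 1) :
    HasDerivWithinAt (fun s => (segCurve hX x y s : E)) ((y : E) - x) (Icc 0 1) t := by
  have h : HasDerivAt (fun s : ℝ => (x : E) + s • ((y : E) - x)) ((y : E) - x) t := by
    simpa using ((hasDerivAt_id t).smul_const ((y : E) - x)).const_add (x : E)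
  exact h.hasDerivWithinAt.congr (fun s hs => segCurve_coe hX x y hs) (segCurve_coe hX x y ht)

theorem piecewiseC1_segCurve (hX : Convex ℝ X) (x y : X) :
    PiecewiseC1 (fun t => (segCurve hX x y t : E)) 0 1 := by
  refine PiecewiseC1.of_contDiffOn zero_le_one ?_
  have : ContDiff ℝ 1 (fun s : ℝ => (x : E) + s • ((y : E) - x)) := by fun_prop
  exact this.contDiffOn.congr fun s hs => segCurve_coe hX x y hs

/-- By convexity the segment is a competitor, so the infimum is over a nonempty set. Freezing a
near-optimal curve outside `[a, b]` makes it continuous on the whole line, which the joint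
measurability arguments use; its length is unchanged. -/
theorem exists_curve_of_dA_lt (hX : Convex ℝ X) {x y : X} {r : ℝ} (h : dA A x y < r) :
    ∃ (γ : ℝ → X) (a b : ℝ), Continuous γ ∧ PiecewiseC1 (fun t => (γ t : E)) a b ∧
      γ a = x ∧ γ b = y ∧ curveLength A γ a b < r := by
  have hne : {l : ℝ | ∃ (γ : ℝ → X) (a b : ℝ), PiecewiseC1 (fun t => (γ t : E)) a b ∧
      γ a = x ∧ γ b = y ∧ l = curveLength A γ a b}.Nonempty :=
    ⟨_, segCurve hX x y, 0, 1, piecewiseC1_segCurve hX x y, segCurve_zero hX x y,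
      segCurve_one hX x y, rfl⟩
  obtain ⟨l, ⟨γ, a, b, hγ, ha, hb, rfl⟩, hl⟩ := exists_lt_of_csInf_lt hne h
  have hab := hγ.le
  have he : EqOn (fun t => γ (projIcc a b hab t)) γ (Icc a b) := fun t ht => by
    simp only [projIcc_of_mem hab ht]
  have hcont : ContinuousOn γ (Icc a b) := continuousOn_iff_continuous_domRestrict.2 <|
    Continuous.subtype_mk (continuousOn_iff_continuous_domRestrict.1 hγ.regular.1) _
  refine ⟨fun t => γ (projIcc a b hab t), a, b, ?_, ?_, ?_, ?_, ?_⟩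
  · exact (continuousOn_iff_continuous_domRestrict.1 hcont).comp continuous_projIcc
  · exact hγ.congr fun t ht => congrArg _ (he ht)
  · exact (he (left_mem_Icc.2 hab)).trans ha
  · exact (he (right_mem_Icc.2 hab)).trans hb
  · rwa [curveLength_congr hab he]

theorem dA_self (x : X) : dA A x x = 0 := by
  refine le_antisymm ?_ (dA_nonneg x x)
  have h : PiecewiseC1 (fun _ : ℝ => (x : E)) 0 0 :=
    PiecewiseC1.of_contDiffOn le_rfl contDiffOn_const
  have := dA_le_curveLength (A := A) (γ := fun _ => x) h
  simpa [curveLength] using this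

theorem dA_comm (hX : Convex ℝ X) (x y : X) : dA A x y = dA A y x := by
  suffices H : ∀ x y : X, dA A y x ≤ dA A x y from le_antisymm (H y x) (H x y)
  intro x y
  refine le_of_forall_gt fun r hr => ?_
  obtain ⟨γ, a, b, -, h, rfl, rfl, hl⟩ := exists_curve_of_dA_lt hX hr
  have := dA_le_curveLength (A := A) (γ := fun s => γ (-s)) h.comp_neg
  simp only [neg_neg] at this
  refine this.trans_lt (lt_of_eq_of_lt ?_ hl)
  rw [curveLength_eq, curveLength_eq]
  have e : ∀ t, speed A (fun s => γ (-s)) t = speed A γ (-t) := by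
    intro t
    simp only [speed]
    rw [deriv_comp_neg (f := fun s => (γ s : E)), map_neg, norm_neg]
  simp_rw [e]
  rw [intervalIntegral.integral_comp_neg (fun t => speed A γ t), neg_neg, neg_neg]

variable [CompleteSpace E]

theorem dA_triangle (hA : FinslerConditions X A) (x y z : X) :
    dA A x z ≤ dA A x y + dA A y z := by
  refine le_of_forall_pos_lt_add fun ε hε => ?_
  obtain ⟨γ, a, b, -, h, rfl, hy, hl⟩ := exists_curve_of_dA_lt hA.convex
    (show dA A x y < dA A x y + ε / 2 by linarith)
  obtain ⟨γ', a', b', -, h', rfl, rfl, hl'⟩ := exists_curve_of_dA_lt hA.convex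
    (show dA A y z < dA A y z + ε / 2 by linarith)
  have hab := h.le
  have hab' := h'.le
  -- Time shift that makes the second curve start where the first one ends.
  let r := a' - b
  have hs := h'.comp_add r
  rw [show a' - r = b by simp [r]] at hs
  let g : ℝ → X := fun s => if s ≤ b then γ s else γ' (s + r)
  have e1 : EqOn g γ (Icc a b) := fun s hs => by simp [g, hs.2]
  have e2 : EqOn g (fun s => γ' (s + r)) (Icc b (b' - r)) := fun s hs => by
    rcases hs.1.eq_or_lt with rfl | hlt
    · simp [g, r, hy]
    · simp [g, hlt.not_ge]
  have p1 : PiecewiseC1 (fun t => (g t : E)) a b := h.congr fun t ht => congrArg _ (e1 ht)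
  have p2 : PiecewiseC1 (fun t => (g t : E)) b (b' - r) := hs.congr fun t ht => congrArg _ (e2 ht)
  have hg := dA_le_curveLength (A := A) (p1.trans p2)
  have hend : g (b' - r) = γ' b' := by
    rw [e2 (right_mem_Icc.2 p2.le)]; simp
  rw [e1 (left_mem_Icc.2 hab), hend] at hg
  refine hg.trans_lt ?_
  have hlen : curveLength A g a (b' - r) = curveLength A γ a b + curveLength A γ' a' b' := by
    rw [curveLength_eq g, ← intervalIntegral.integral_add_adjacent_intervals
      (speed_intervalIntegrable hA.continuous p1) (speed_intervalIntegrable hA.continuous p2),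
      ← curveLength_eq, ← curveLength_eq, curveLength_congr hab e1, curveLength_congr p2.le e2]
    congr 1
    rw [curveLength_eq, curveLength_eq]
    have e : ∀ t, speed A (fun s => γ' (s + r)) t = speed A γ' (t + r) := by
      intro t
      simp only [speed]
      rw [deriv_comp_add_const (f := fun s => (γ' s : E))]
    simp_rw [e]
    rw [intervalIntegral.integral_comp_add_right (fun t => speed A γ' t)]
    simp [r]
  linarith

theorem abs_dA_sub_dA_le (hA : FinslerConditions X A) (x y z : X) :
    |dA A x z - dA A y z| ≤ dA A x y := by
  have h1 := dA_triangle hA x y z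
  have h2 := dA_triangle hA y x z
  rw [dA_comm hA.convex y x] at h2
  rw [abs_le]; constructor <;> linarith

/-- Keeps a near-optimal curve inside a `d_A`-ball around its start, so that the weight `‖B‖` can be
bounded along it. -/
theorem dA_left_le_curveLength (hA : FinslerConditions X A) {γ : ℝ → X} {a b s : ℝ}
    (h : PiecewiseC1 (fun t => (γ t : E)) a b) (hs : s ∈ Icc a b) :
    dA A (γ a) (γ s) ≤ curveLength A γ a b := by
  refine (dA_le_curveLength (h.restrict hs)).trans ?_
  refine intervalIntegral.integral_mono_interval le_rfl hs.1 hs.2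
    (ae_of_all _ fun t => speed_nonneg γ t) (speed_intervalIntegrable hA.continuous h)

/-- Functions with bounded derivative are Lipschitz along curves. -/
theorem norm_sub_le_mul_curveLength (hA : FinslerConditions X A)
    {G : Type*} [NormedAddCommGroup G] [NormedSpace ℝ G] [CompleteSpace G]
    {h : X → G} {h' : X → E →L[ℝ] G}
    (hd : ∀ x : X, HasFDerivWithinAt (extZero h) (h' x) X x) {γ : ℝ → X} {a b β : ℝ}
    (hγ : PiecewiseC1 (fun t => (γ t : E)) a b)
    (hb : ∀ t ∈ Icc a b, ∀ u, ‖h' (γ t) u‖ ≤ β * ‖A (γ t) u‖) :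
    ‖h (γ b) - h (γ a)‖ ≤ β * curveLength A γ a b := by
  obtain ⟨hc, S, hS, M, hM⟩ := hγ.regular
  have hab := hγ.le
  have hγc : ContinuousOn γ (Icc a b) := continuousOn_iff_continuous_domRestrict.2 <|
    Continuous.subtype_mk (continuousOn_iff_continuous_domRestrict.1 hc) _
  have hhc : ContinuousOn (fun t => h (γ t)) (Icc a b) := by
    have : ContinuousOn (extZero h) X := fun x hx => (hd ⟨x, hx⟩).continuousWithinAt
    exact (this.comp hc fun t _ => (γ t).2).congr fun t _ => (extZero_coe h _).symm
  have hder : ∀ t ∈ Ioo a b \ S, HasDerivAt (fun t => h (γ t))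
      (h' (γ t) (deriv (fun s => (γ s : E)) t)) t := by
    intro t ht
    have := (hd (γ t)).comp_hasDerivAt t (hM t ht).1.hasDerivAt
      (Eventually.of_forall fun s => (γ s).2)
    refine this.congr_of_eventuallyEq (Eventually.of_forall fun s => ?_)
    exact (extZero_coe h _).symm
  have hbd : ∀ᵐ t ∂(volume.restrict (Ioc a b)),
      ‖deriv (fun t => h (γ t)) t‖ ≤ β * speed A γ t := by
    refine ae_Ioc_of_finite hS fun t ht => ?_
    rw [(hder t ht).deriv]
    exact hb t (Ioo_subset_Icc_self ht.1) _
  have hsp := speed_integrableOn hA.continuous hγ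
  have hint : IntervalIntegrable (deriv (fun t => h (γ t))) volume a b := by
    rw [intervalIntegrable_iff_integrableOn_Ioc_of_le hab]
    exact Integrable.mono' (hsp.const_mul β) (stronglyMeasurable_deriv _).aestronglyMeasurable hbd
  -- Fundamental theorem of calculus with the breakpoints exempted; the derivative of `h ∘ γ` is
  -- integrable because `β` times the speed dominates it.
  rw [← integral_eq_of_hasDerivAt_off_countable_of_le (fun t => h (γ t)) _ hab hS.countable hhc
    (fun t ht => (hder t ht).differentiableAt.hasDerivAt) hint, curveLength_eq,
    ← intervalIntegral.integral_const_mul, intervalIntegral.integral_of_le hab,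
    intervalIntegral.integral_of_le hab]
  exact norm_integral_le_of_norm_le (hsp.const_mul β) hbd

theorem norm_sub_le_mul_dA (hA : FinslerConditions X A)
    {G : Type*} [NormedAddCommGroup G] [NormedSpace ℝ G] [CompleteSpace G]
    {h : X → G} {h' : X → E →L[ℝ] G}
    (hd : ∀ x : X, HasFDerivWithinAt (extZero h) (h' x) X x) {β : ℝ} (hβ : 0 ≤ β)
    (hb : ∀ x : X, ∀ u, ‖h' x u‖ ≤ β * ‖A x u‖) (x y : X) :
    ‖h x - h y‖ ≤ β * dA A x y := by
  rw [dA_comm hA.convex]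
  -- Minimizing curves need not exist, so the bound is shown for every `r` above the distance, and
  -- `r` decreases to it.
  have key : ∀ r, dA A y x < r → ‖h x - h y‖ ≤ β * r := by
    intro r hr
    obtain ⟨γ, a, b, -, hγ, rfl, rfl, hl⟩ := exists_curve_of_dA_lt hA.convex hr
    exact (norm_sub_le_mul_curveLength hA hd hγ fun t _ => hb _).trans
      (mul_le_mul_of_nonneg_left hl.le hβ)
  have ht : Tendsto (fun r => β * r) (𝓝[>] (dA A y x)) (𝓝 (β * dA A y x)) :=
    ((continuous_const.mul continuous_id).tendsto _).mono_left nhdsWithin_le_nhds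
  exact ge_of_tendsto ht (eventually_nhdsWithin_of_forall fun r hr => key r hr)

theorem hasFDerivWithinAt_extZero_coe (x : X) :
    HasFDerivWithinAt (extZero (fun y : X => (y : E))) (ContinuousLinearMap.id ℝ E) X x :=
  (hasFDerivWithinAt_id (x : E) X).congr (fun y hy => extZero_coe (fun y : X => (y : E)) ⟨y, hy⟩)
    (extZero_coe (fun y : X => (y : E)) x)

/-- The inclusion of `X` has the identity as derivative, and boundedness of `A⁻¹` says precisely
that this is bounded in the Finsler norm. Hence norm-Lipschitz functions are `d_A`-Lipschitz, and
`d_A`-balls are norm-bounded. -/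
theorem exists_norm_sub_le_dA (hA : FinslerConditions X A) :
    ∃ C : ℝ, 0 < C ∧ (∀ x : X, ∀ u, ‖u‖ ≤ C * ‖A x u‖) ∧
      ∀ x y : X, ‖(x : E) - y‖ ≤ C * dA A x y := by
  obtain ⟨C, hC⟩ := hA.inv_bounded
  have h1 : ∀ x : X, ∀ u, ‖u‖ ≤ max C 1 * ‖A x u‖ := by
    intro x u
    have := ((A x).symm : E →L[ℝ] E).le_of_opNorm_le ((hC x).trans (le_max_left C 1)) (A x u)
    simpa using this
  refine ⟨max C 1, by positivity, h1, fun x y => ?_⟩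
  exact norm_sub_le_mul_dA hA hasFDerivWithinAt_extZero_coe (by positivity) h1 x y

theorem dA_le_mul_norm (hA : FinslerConditions X A) {x y : X} {C : ℝ}
    (hC : ∀ t ∈ Icc (0 : ℝ) 1, ‖(A (segCurve hA.convex x y t) : E →L[ℝ] E)‖ ≤ C) :
    dA A x y ≤ C * ‖(y : E) - x‖ := by
  have h := dA_le_curveLength (A := A) (piecewiseC1_segCurve hA.convex x y)
  rw [segCurve_zero, segCurve_one] at h
  refine h.trans ?_
  rw [curveLength_eq, intervalIntegral.integral_of_le zero_le_one]
  have hb : ∀ᵐ t ∂(volume.restrict (Ioc (0 : ℝ) 1)),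
      ‖speed A (segCurve hA.convex x y) t‖ ≤ C * ‖(y : E) - x‖ := by
    refine ae_Ioc_of_finite finite_empty fun t ht => ?_
    have ht' := Ioo_subset_Icc_self ht.1
    rw [Real.norm_of_nonneg (speed_nonneg _ _)]
    simp only [speed]
    rw [((hasDerivWithinAt_segCurve hA.convex x y ht').hasDerivAt
      (Icc_mem_nhds ht.1.1 ht.1.2)).deriv]
    exact (A (segCurve hA.convex x y t) : E →L[ℝ] E).le_of_opNorm_le (hC t ht') _
  have := norm_integral_le_of_norm_le (integrable_const (C * ‖(y : E) - x‖)) hb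
  refine (le_abs_self _).trans (this.trans (le_of_eq ?_))
  simp

/-- `A` is bounded near `x` by continuity, and a small ball contains the segment from `x` to each of
its points in `X`; the length of the segment is then at most a multiple of the norm distance. -/
theorem tendsto_dA_nhds (hA : FinslerConditions X A) (x : X) :
    Tendsto (fun y => dA A x y) (𝓝 x) (𝓝 0) := by
  have hn : ∀ᶠ y in 𝓝 x, ‖(A y : E →L[ℝ] E)‖ < ‖(A x : E →L[ℝ] E)‖ + 1 :=
    (hA.continuous.norm.tendsto x).eventually_lt_const (lt_add_one _)
  obtain ⟨δ, hδ, hball⟩ := Metric.eventually_nhds_iff.1 hn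
  set C := ‖(A x : E →L[ℝ] E)‖ + 1
  have hb : ∀ᶠ y in 𝓝 x, dA A x y ≤ C * ‖(y : E) - x‖ := by
    filter_upwards [Metric.ball_mem_nhds x hδ] with y hy
    refine dA_le_mul_norm hA fun t ht => (hball ?_).le
    rw [Subtype.dist_eq, segCurve_coe _ _ _ ht, dist_eq_norm, add_sub_cancel_left, norm_smul,
      Real.norm_of_nonneg ht.1]
    rw [Metric.mem_ball, Subtype.dist_eq, dist_eq_norm] at hy
    nlinarith [ht.1, ht.2, norm_nonneg ((y : E) - x)]
  have h0 : Tendsto (fun y : X => C * ‖(y : E) - x‖) (𝓝 x) (𝓝 0) := by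
    have : Continuous (fun y : X => C * ‖(y : E) - x‖) := by fun_prop
    simpa using this.tendsto x
  exact squeeze_zero' (Eventually.of_forall fun y => dA_nonneg x y) hb h0

theorem continuous_dA (hA : FinslerConditions X A) :
    Continuous (fun p : X × X => dA A p.1 p.2) := by
  rw [continuous_iff_continuousAt]
  rintro ⟨x, y⟩
  rw [ContinuousAt, tendsto_iff_dist_tendsto_zero]
  have h1 : Tendsto (fun p : X × X => dA A x p.1 + dA A y p.2) (𝓝 (x, y)) (𝓝 (0 + 0)) := by
    rw [nhds_prod_eq]
    exact ((tendsto_dA_nhds hA x).comp tendsto_fst).add ((tendsto_dA_nhds hA y).comp tendsto_snd)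
  rw [add_zero] at h1
  refine squeeze_zero (fun _ => dist_nonneg) (fun p => ?_) h1
  rw [Real.dist_eq]
  have a1 := abs_dA_sub_dA_le hA x p.1 p.2
  have a2 := abs_dA_sub_dA_le hA y p.2 x
  rw [dA_comm hA.convex y x, dA_comm hA.convex p.2 x] at a2
  rw [abs_le] at *
  constructor <;> linarith [a1.1, a1.2, a2.1, a2.2]

/-- The length of the image of a curve bounds the distance of the images. -/
theorem ofReal_dA_map_le (hA : FinslerConditions X A) {g : X → X}
    (hg : ContDiffOn ℝ 1 (extZero (fun x => (g x : E))) X) {γ : ℝ → X} {a b : ℝ}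
    (hγ : PiecewiseC1 (fun t => (γ t : E)) a b) :
    ENNReal.ofReal (dA A (g (γ a)) (g (γ b))) ≤ ∫⁻ t in Ioc a b,
      ‖A (g (γ t)) (dX (fun x => (g x : E)) (γ t) (deriv (fun s => (γ s : E)) t))‖ₑ := by
  have hgp : PiecewiseC1 (fun t => (g (γ t) : E)) a b :=
    (hγ.comp (fun t => (γ t).2) hg).congr fun t _ => (extZero_coe (fun x => (g x : E)) _).symm
  obtain ⟨hc, S, hS, M, hM⟩ := hγ.regular
  refine (ENNReal.ofReal_le_ofReal (dA_le_curveLength (γ := fun t => g (γ t)) hgp)).trans ?_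
  rw [ofReal_curveLength hA.continuous hgp]
  refine lintegral_mono_ae (ae_Ioc_of_finite hS fun t ht => le_of_eq ?_)
  have hd : HasFDerivWithinAt (extZero (fun x => (g x : E))) (dX (fun x => (g x : E)) (γ t)) X
      (γ t) := ((hg.differentiableOn (by norm_num)) _ (γ t).2).hasFDerivWithinAt
  have hd' : HasDerivAt (fun s => (g (γ s) : E))
      (dX (fun x => (g x : E)) (γ t) (deriv (fun s => (γ s : E)) t)) t := by
    have := hd.comp_hasDerivAt t (hM t ht).1.hasDerivAt (Eventually.of_forall fun s => (γ s).2)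
    refine this.congr_of_eventuallyEq (Eventually.of_forall fun s => ?_)
    exact (extZero_coe (fun x => (g x : E)) _).symm
  rw [hd'.deriv]

theorem ofReal_dA_le_of_contDiffOn (hA : FinslerConditions X A) {c : ℝ → X} {c' : ℝ → E}
    (hc : ContDiffOn ℝ 1 (fun t => (c t : E)) (Icc 0 1))
    (hd : ∀ t ∈ Ioo (0 : ℝ) 1, HasDerivAt (fun t => (c t : E)) (c' t) t) :
    ENNReal.ofReal (dA A (c 0) (c 1)) ≤ ∫⁻ t in Ioc (0 : ℝ) 1, ‖A (c t) (c' t)‖ₑ := by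
  have hp := PiecewiseC1.of_contDiffOn zero_le_one hc
  refine (ENNReal.ofReal_le_ofReal (dA_le_curveLength hp)).trans ?_
  rw [ofReal_curveLength hA.continuous hp]
  refine lintegral_mono_ae (ae_Ioc_of_finite finite_empty fun t ht => le_of_eq ?_)
  rw [(hd t ht.1).deriv]

end Metric
end StationaryDiff
end

open MeasureTheory ProbabilityTheory Set Filter Topology
open scoped ENNReal

noncomputable section

namespace StationaryDiff

/-! ### Partial derivatives of the system as restrictions of its total derivatives; measurability in
the noise. -/

section SystemDerivatives

set_option linter.unusedSectionVars false
set_option maxSynthPendingDepth 3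

variable {E F Ξ : Type*} [NormedAddCommGroup E] [NormedSpace ℝ E]
  [NormedAddCommGroup F] [NormedSpace ℝ F] {X : Set E} {A : X → E ≃L[ℝ] E}

theorem FinslerConditions.uniqueDiffOn (hA : FinslerConditions X A) : UniqueDiffOn ℝ X :=
  uniqueDiffOn_convex hA.convex hA.interior

theorem dX_eq (hA : FinslerConditions X A) {G : Type*} [NormedAddCommGroup G] [NormedSpace ℝ G]
    {h : X → G} {h' : E →L[ℝ] G} {x : X} (hd : HasFDerivWithinAt (extZero h) h' X x) :
    dX h x = h' :=
  hd.fderivWithin (hA.uniqueDiffOn _ x.2)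

theorem continuousOn_extZero {G : Type*} [TopologicalSpace G] [Zero G] {h : X → G} :
    ContinuousOn (extZero h) X ↔ Continuous h := by
  rw [continuousOn_iff_continuous_domRestrict]
  have : X.domRestrict (extZero h) = h := by
    funext x; exact extZero_coe h x
  rw [this]

/-- The map `(x, θ) ↦ f(x, ξ, θ)` extended by zero. -/
def sysMap (f : X → Ξ → F → X) (ξ : Ξ) (p : E × F) : E :=
  extZero (fun x : X => (f x ξ p.2 : E)) p.1

variable [MeasurableSpace Ξ] {ν : Measure Ξ} {Θ : Set F} {f : X → Ξ → F → X} [MeasurableSpace E]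

theorem sysMap_coe (x : X) (ξ : Ξ) (θ : F) : sysMap f ξ ((x : E), θ) = f x ξ θ :=
  extZero_coe (fun x : X => (f x ξ θ : E)) x

theorem uniqueDiffOn_prod (hA : FinslerConditions X A) (hf : SystemConditions ν Θ f A) :
    UniqueDiffOn ℝ (X ×ˢ Θ) :=
  hA.uniqueDiffOn.prod hf.isOpen.uniqueDiffOn

/-- The total derivative of the system. -/
def sysD (Θ : Set F) (f : X → Ξ → F → X) (ξ : Ξ) : E × F → E × F →L[ℝ] E :=
  fderivWithin ℝ (sysMap f ξ) (X ×ˢ Θ)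

/-- The total second derivative of the system. -/
def sysD2 (Θ : Set F) (f : X → Ξ → F → X) (ξ : Ξ) : E × F → E × F →L[ℝ] E × F →L[ℝ] E :=
  fderivWithin ℝ (sysD Θ f ξ) (X ×ˢ Θ)

section

variable (hA : FinslerConditions X A) (hf : SystemConditions ν Θ f A)
include hA hf

theorem hasFDerivWithinAt_sysMap (ξ : Ξ) {p : E × F} (hp : p ∈ X ×ˢ Θ) :
    HasFDerivWithinAt (sysMap f ξ) (sysD Θ f ξ p) (X ×ˢ Θ) p :=
  ((hf.contDiff ξ).differentiableOn (by norm_num) p hp).hasFDerivWithinAt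

theorem contDiffOn_sysD (ξ : Ξ) : ContDiffOn ℝ 1 (sysD Θ f ξ) (X ×ˢ Θ) :=
  (hf.contDiff ξ).fderivWithin (uniqueDiffOn_prod hA hf) (by norm_num)

theorem hasFDerivWithinAt_sysD (ξ : Ξ) {p : E × F} (hp : p ∈ X ×ˢ Θ) :
    HasFDerivWithinAt (sysD Θ f ξ) (sysD2 Θ f ξ p) (X ×ˢ Θ) p :=
  ((contDiffOn_sysD hA hf ξ).differentiableOn (by norm_num) p hp).hasFDerivWithinAt

theorem continuousOn_sysD2 (ξ : Ξ) : ContinuousOn (sysD2 Θ f ξ) (X ×ˢ Θ) :=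
  (contDiffOn_sysD hA hf ξ).continuousOn_fderivWithin (uniqueDiffOn_prod hA hf) le_rfl

/-- Symmetry extends to boundary points of `X` because a convex set with nonempty interior lies in
the closure of its interior. -/
theorem sysD2_symm (ξ : Ξ) {p : E × F} (hp : p ∈ X ×ˢ Θ) (u v : E × F) :
    sysD2 Θ f ξ p u v = sysD2 Θ f ξ p v u := by
  have hcl : p ∈ closure (interior (X ×ˢ Θ)) := by
    rw [interior_prod_eq, closure_prod_eq, hf.isOpen.interior_eq,
      hA.convex.closure_interior_eq_closure_of_nonempty_interior hA.interior]
    exact ⟨subset_closure hp.1, subset_closure hp.2⟩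
  have := ((hf.contDiff ξ) p hp).isSymmSndFDerivWithinAt (by simp)
    (uniqueDiffOn_prod hA hf) hcl hp
  exact this u v

theorem hasFDerivWithinAt_left {G : Type*} [NormedAddCommGroup G] [NormedSpace ℝ G]
    {g : E × F → G} {g' : E × F →L[ℝ] G} {x : X} {θ : F} (hθ : θ ∈ Θ)
    (h : HasFDerivWithinAt g g' (X ×ˢ Θ) (x, θ)) :
    HasFDerivWithinAt (fun y : E => g (y, θ)) (g'.comp (ContinuousLinearMap.inl ℝ E F)) X x := by
  refine HasFDerivWithinAt.comp (x : E) h (f := fun y : E => (y, θ))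
    (hasFDerivAt_prodMk_left (x : E) θ).hasFDerivWithinAt ?_
  exact fun y hy => ⟨hy, hθ⟩

theorem hasFDerivAt_right {G : Type*} [NormedAddCommGroup G] [NormedSpace ℝ G]
    {g : E × F → G} {g' : E × F →L[ℝ] G} {x : X} {θ : F} (hθ : θ ∈ Θ)
    (h : HasFDerivWithinAt g g' (X ×ˢ Θ) (x, θ)) :
    HasFDerivAt (fun η : F => g (x, η)) (g'.comp (ContinuousLinearMap.inr ℝ E F)) θ := by
  have : HasFDerivWithinAt (fun η : F => g (x, η)) (g'.comp (ContinuousLinearMap.inr ℝ E F)) Θ θ :=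
    HasFDerivWithinAt.comp θ h (f := fun η : F => ((x : E), η))
      (hasFDerivAt_prodMk_right (x : E) θ).hasFDerivWithinAt (fun η hη => ⟨x.2, hη⟩)
  exact this.hasFDerivAt (hf.isOpen.mem_nhds hθ)

variable {θ : F} (hθ : θ ∈ Θ)
include hθ

theorem hasFDerivWithinAt_f_aux (x : X) (ξ : Ξ) :
    HasFDerivWithinAt (extZero (fun y : X => (f y ξ θ : E)))
      ((sysD Θ f ξ (x, θ)).comp (ContinuousLinearMap.inl ℝ E F)) X x :=
  hasFDerivWithinAt_left hA hf hθ (hasFDerivWithinAt_sysMap hA hf ξ ⟨x.2, hθ⟩)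

theorem fX_eq (x : X) (ξ : Ξ) :
    fX f x ξ θ = (sysD Θ f ξ (x, θ)).comp (ContinuousLinearMap.inl ℝ E F) :=
  dX_eq hA (hasFDerivWithinAt_f_aux hA hf hθ x ξ)

theorem hasFDerivWithinAt_f (x : X) (ξ : Ξ) :
    HasFDerivWithinAt (extZero (fun y : X => (f y ξ θ : E))) (fX f x ξ θ) X x := by
  rw [fX_eq hA hf hθ]; exact hasFDerivWithinAt_f_aux hA hf hθ x ξ

theorem hasFDerivAt_f_aux (x : X) (ξ : Ξ) : HasFDerivAt (fun η => (f x ξ η : E))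
    ((sysD Θ f ξ (x, θ)).comp (ContinuousLinearMap.inr ℝ E F)) θ := by
  have := hasFDerivAt_right hA hf hθ (hasFDerivWithinAt_sysMap hA hf ξ (p := (x, θ)) ⟨x.2, hθ⟩)
  simpa only [sysMap_coe] using this

theorem fΘ_eq (x : X) (ξ : Ξ) :
    fΘ f x ξ θ = (sysD Θ f ξ (x, θ)).comp (ContinuousLinearMap.inr ℝ E F) :=
  (hasFDerivAt_f_aux hA hf hθ x ξ).fderiv

theorem hasFDerivAt_f (x : X) (ξ : Ξ) :
    HasFDerivAt (fun η => (f x ξ η : E)) (fΘ f x ξ θ) θ := by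
  rw [fΘ_eq hA hf hθ]; exact hasFDerivAt_f_aux hA hf hθ x ξ

theorem hasFDerivWithinAt_fX_aux (x : X) (ξ : Ξ) :
    HasFDerivWithinAt (extZero (fun y : X => fX f y ξ θ))
      (((ContinuousLinearMap.compL ℝ E (E × F) E).flip (ContinuousLinearMap.inl ℝ E F)).comp
        ((sysD2 Θ f ξ (x, θ)).comp (ContinuousLinearMap.inl ℝ E F))) X x := by
  have h := hasFDerivWithinAt_left hA hf hθ (hasFDerivWithinAt_sysD hA hf ξ (p := (x, θ)) ⟨x.2, hθ⟩)
  have h2 := ((ContinuousLinearMap.compL ℝ E (E × F) E).flip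
    (ContinuousLinearMap.inl ℝ E F)).hasFDerivAt.comp_hasFDerivWithinAt (x : E) h
  refine HasFDerivWithinAt.congr' h2 (fun y hy => ?_) x.2
  rw [show y = ((⟨y, hy⟩ : X) : E) from rfl, extZero_coe, fX_eq hA hf hθ]
  rfl

theorem hasFDerivWithinAt_fΘ_aux (x : X) (ξ : Ξ) :
    HasFDerivWithinAt (extZero (fun y : X => fΘ f y ξ θ))
      (((ContinuousLinearMap.compL ℝ F (E × F) E).flip (ContinuousLinearMap.inr ℝ E F)).comp
        ((sysD2 Θ f ξ (x, θ)).comp (ContinuousLinearMap.inl ℝ E F))) X x := by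
  have h := hasFDerivWithinAt_left hA hf hθ (hasFDerivWithinAt_sysD hA hf ξ (p := (x, θ)) ⟨x.2, hθ⟩)
  have h2 := ((ContinuousLinearMap.compL ℝ F (E × F) E).flip
    (ContinuousLinearMap.inr ℝ E F)).hasFDerivAt.comp_hasFDerivWithinAt (x : E) h
  refine HasFDerivWithinAt.congr' h2 (fun y hy => ?_) x.2
  rw [show y = ((⟨y, hy⟩ : X) : E) from rfl, extZero_coe, fΘ_eq hA hf hθ]
  rfl

theorem hasFDerivAt_fX_aux (x : X) (ξ : Ξ) :
    HasFDerivAt (fun η => fX f x ξ η)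
      (((ContinuousLinearMap.compL ℝ E (E × F) E).flip (ContinuousLinearMap.inl ℝ E F)).comp
        ((sysD2 Θ f ξ (x, θ)).comp (ContinuousLinearMap.inr ℝ E F))) θ := by
  have h := hasFDerivAt_right hA hf hθ (hasFDerivWithinAt_sysD hA hf ξ (p := (x, θ)) ⟨x.2, hθ⟩)
  have h2 := ((ContinuousLinearMap.compL ℝ E (E × F) E).flip
    (ContinuousLinearMap.inl ℝ E F)).hasFDerivAt.comp θ h
  refine h2.congr_of_eventuallyEq ?_
  filter_upwards [hf.isOpen.mem_nhds hθ] with η hη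
  rw [fX_eq hA hf hη]
  rfl

theorem hasFDerivAt_fΘ_aux (x : X) (ξ : Ξ) :
    HasFDerivAt (fun η => fΘ f x ξ η)
      (((ContinuousLinearMap.compL ℝ F (E × F) E).flip (ContinuousLinearMap.inr ℝ E F)).comp
        ((sysD2 Θ f ξ (x, θ)).comp (ContinuousLinearMap.inr ℝ E F))) θ := by
  have h := hasFDerivAt_right hA hf hθ (hasFDerivWithinAt_sysD hA hf ξ (p := (x, θ)) ⟨x.2, hθ⟩)
  have h2 := ((ContinuousLinearMap.compL ℝ F (E × F) E).flip
    (ContinuousLinearMap.inr ℝ E F)).hasFDerivAt.comp θ h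
  refine h2.congr_of_eventuallyEq ?_
  filter_upwards [hf.isOpen.mem_nhds hθ] with η hη
  rw [fΘ_eq hA hf hη]
  rfl

theorem fXX_eq (x : X) (ξ : Ξ) : fXX f x ξ θ =
    ((ContinuousLinearMap.compL ℝ E (E × F) E).flip (ContinuousLinearMap.inl ℝ E F)).comp
        ((sysD2 Θ f ξ (x, θ)).comp (ContinuousLinearMap.inl ℝ E F)) :=
  dX_eq hA (hasFDerivWithinAt_fX_aux hA hf hθ x ξ)

theorem fXΘ_eq (x : X) (ξ : Ξ) : fXΘ f x ξ θ =
    ((ContinuousLinearMap.compL ℝ F (E × F) E).flip (ContinuousLinearMap.inr ℝ E F)).comp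
        ((sysD2 Θ f ξ (x, θ)).comp (ContinuousLinearMap.inl ℝ E F)) :=
  dX_eq hA (hasFDerivWithinAt_fΘ_aux hA hf hθ x ξ)

theorem fΘΘ_eq (x : X) (ξ : Ξ) : fΘΘ f x ξ θ =
    ((ContinuousLinearMap.compL ℝ F (E × F) E).flip (ContinuousLinearMap.inr ℝ E F)).comp
        ((sysD2 Θ f ξ (x, θ)).comp (ContinuousLinearMap.inr ℝ E F)) :=
  (hasFDerivAt_fΘ_aux hA hf hθ x ξ).fderiv

theorem hasFDerivWithinAt_fX (x : X) (ξ : Ξ) :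
    HasFDerivWithinAt (extZero (fun y : X => fX f y ξ θ)) (fXX f x ξ θ) X x := by
  rw [fXX_eq hA hf hθ]; exact hasFDerivWithinAt_fX_aux hA hf hθ x ξ

theorem hasFDerivWithinAt_fΘ (x : X) (ξ : Ξ) :
    HasFDerivWithinAt (extZero (fun y : X => fΘ f y ξ θ)) (fXΘ f x ξ θ) X x := by
  rw [fXΘ_eq hA hf hθ]; exact hasFDerivWithinAt_fΘ_aux hA hf hθ x ξ

theorem hasFDerivAt_fΘ (x : X) (ξ : Ξ) :
    HasFDerivAt (fun η => fΘ f x ξ η) (fΘΘ f x ξ θ) θ := by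
  rw [fΘΘ_eq hA hf hθ]; exact hasFDerivAt_fΘ_aux hA hf hθ x ξ

/-- Exchanging the order of differentiation matters because `L_{X,Θ}` bounds the mixed derivative
taken in the order of `fXΘ`, while parameter estimates differentiate `∂f/∂x` in `θ`. -/
theorem hasFDerivAt_fX (x : X) (ξ : Ξ) :
    HasFDerivAt (fun η => fX f x ξ η) (fXΘ f x ξ θ).flip θ := by
  have e : (fXΘ f x ξ θ).flip =
      ((ContinuousLinearMap.compL ℝ E (E × F) E).flip (ContinuousLinearMap.inl ℝ E F)).comp
        ((sysD2 Θ f ξ (x, θ)).comp (ContinuousLinearMap.inr ℝ E F)) := by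
    rw [fXΘ_eq hA hf hθ]
    ext v u
    exact sysD2_symm hA hf ξ ⟨x.2, hθ⟩ _ _
  rw [e]
  exact hasFDerivAt_fX_aux hA hf hθ x ξ

theorem continuous_f_left (ξ : Ξ) : Continuous (fun x : X => f x ξ θ) := by
  rw [Topology.IsInducing.subtypeVal.continuous_iff]
  change Continuous (fun x : X => (f x ξ θ : E))
  rw [← continuousOn_extZero]
  exact fun x hx => (hasFDerivWithinAt_f hA hf hθ ⟨x, hx⟩ ξ).continuousWithinAt

theorem continuous_fX_left (ξ : Ξ) : Continuous (fun x : X => fX f x ξ θ) := by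
  rw [← continuousOn_extZero]
  exact fun x hx => (hasFDerivWithinAt_fX hA hf hθ ⟨x, hx⟩ ξ).continuousWithinAt

theorem continuous_sysD2_left (ξ : Ξ) : Continuous (fun x : X => sysD2 Θ f ξ (x, θ)) :=
  (continuousOn_sysD2 hA hf ξ).comp_continuous (by fun_prop) fun x => ⟨x.2, hθ⟩

theorem continuous_fXX_left (ξ : Ξ) : Continuous (fun x : X => fXX f x ξ θ) := by
  simp only [fXX_eq hA hf hθ]
  exact continuous_const.clm_comp ((continuous_sysD2_left hA hf hθ ξ).clm_comp continuous_const)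

theorem contDiffOn_f_left (ξ : Ξ) : ContDiffOn ℝ 2 (extZero (fun y : X => (f y ξ θ : E))) X :=
  (hf.contDiff ξ).comp (f := fun y : E => (y, θ)) (by fun_prop) fun _ hy => ⟨hy, hθ⟩

omit hθ

theorem continuousOn_sysD2_right (x : X) (ξ : Ξ) :
    ContinuousOn (fun η => sysD2 Θ f ξ (x, η)) Θ :=
  (continuousOn_sysD2 hA hf ξ).comp (by fun_prop) fun _ hη => ⟨x.2, hη⟩

theorem continuousOn_f_right (x : X) (ξ : Ξ) : ContinuousOn (fun η => f x ξ η) Θ := by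
  rw [Topology.IsInducing.subtypeVal.continuousOn_iff]
  exact fun η hη => (hasFDerivAt_f hA hf hη x ξ).continuousAt.continuousWithinAt

theorem continuousOn_fΘ_right (x : X) (ξ : Ξ) : ContinuousOn (fun η => fΘ f x ξ η) Θ :=
  fun _ hη => (hasFDerivAt_fΘ hA hf hη x ξ).continuousAt.continuousWithinAt

theorem continuousOn_fΘΘ_right (x : X) (ξ : Ξ) : ContinuousOn (fun η => fΘΘ f x ξ η) Θ := by
  refine ContinuousOn.congr ?_ fun η hη => fΘΘ_eq hA hf hη x ξ
  exact continuousOn_const.clm_comp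
    ((continuousOn_sysD2_right hA hf x ξ).clm_comp continuousOn_const)

theorem continuousOn_fXΘ_right (x : X) (ξ : Ξ) : ContinuousOn (fun η => fXΘ f x ξ η) Θ := by
  refine ContinuousOn.congr ?_ fun η hη => fXΘ_eq hA hf hη x ξ
  exact continuousOn_const.clm_comp
    ((continuousOn_sysD2_right hA hf x ξ).clm_comp continuousOn_const)

include hθ

variable [FiniteDimensional ℝ E] [BorelSpace E]

theorem stronglyMeasurable_f (x : X) : StronglyMeasurable (fun ξ => (f x ξ θ : E)) := by
  have := FiniteDimensional.proper_real E
  exact (measurable_subtype_coe.comp (hf.measurable x θ hθ)).stronglyMeasurable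

/-- Only `f` is assumed measurable in the noise. Each derivative inherits measurability from
difference quotients, one order at a time. -/
theorem stronglyMeasurable_fX (x : X) : StronglyMeasurable (fun ξ => fX f x ξ θ) := by
  refine stronglyMeasurable_of_hasFDerivWithinAt x.2 (hA.uniqueDiffOn x x.2)
    (v := fun y ξ => extZero (fun y : X => (f y ξ θ : E)) y) (fun y hy => ?_)
    fun ξ => hasFDerivWithinAt_f hA hf hθ x ξ
  simp only [show ∀ ξ, extZero (fun y : X => (f y ξ θ : E)) y = f ⟨y, hy⟩ ξ θ from
    fun ξ => extZero_coe (fun y : X => (f y ξ θ : E)) ⟨y, hy⟩]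
  exact stronglyMeasurable_f hA hf hθ _

theorem stronglyMeasurable_fXX (x : X) : StronglyMeasurable (fun ξ => fXX f x ξ θ) := by
  refine stronglyMeasurable_of_hasFDerivWithinAt x.2 (hA.uniqueDiffOn x x.2)
    (v := fun y ξ => extZero (fun y : X => fX f y ξ θ) y) (fun y hy => ?_)
    fun ξ => hasFDerivWithinAt_fX hA hf hθ x ξ
  simp only [show ∀ ξ, extZero (fun y : X => fX f y ξ θ) y = fX f ⟨y, hy⟩ ξ θ from
    fun ξ => extZero_coe (fun y : X => fX f y ξ θ) ⟨y, hy⟩]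
  exact stronglyMeasurable_fX hA hf hθ _

variable [FiniteDimensional ℝ F]

theorem stronglyMeasurable_fΘ (x : X) : StronglyMeasurable (fun ξ => fΘ f x ξ θ) :=
  stronglyMeasurable_of_hasFDerivWithinAt hθ (hf.isOpen.uniqueDiffOn θ hθ)
    (v := fun η ξ => (f x ξ η : E)) (fun _ hη => stronglyMeasurable_f hA hf hη x)
    fun ξ => (hasFDerivAt_f hA hf hθ x ξ).hasFDerivWithinAt

theorem stronglyMeasurable_fΘΘ (x : X) : StronglyMeasurable (fun ξ => fΘΘ f x ξ θ) :=
  stronglyMeasurable_of_hasFDerivWithinAt hθ (hf.isOpen.uniqueDiffOn θ hθ)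
    (v := fun η ξ => fΘ f x ξ η) (fun _ hη => stronglyMeasurable_fΘ hA hf hη x)
    fun ξ => (hasFDerivAt_fΘ hA hf hθ x ξ).hasFDerivWithinAt

theorem stronglyMeasurable_fXΘ (x : X) : StronglyMeasurable (fun ξ => fXΘ f x ξ θ) := by
  refine stronglyMeasurable_of_hasFDerivWithinAt x.2 (hA.uniqueDiffOn x x.2)
    (v := fun y ξ => extZero (fun y : X => fΘ f y ξ θ) y) (fun y hy => ?_)
    fun ξ => hasFDerivWithinAt_fΘ hA hf hθ x ξ
  simp only [show ∀ ξ, extZero (fun y : X => fΘ f y ξ θ) y = fΘ f ⟨y, hy⟩ ξ θ from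
    fun ξ => extZero_coe (fun y : X => fΘ f y ξ θ) ⟨y, hy⟩]
  exact stronglyMeasurable_fΘ hA hf hθ _

end

end SystemDerivatives
end StationaryDiff
end

open MeasureTheory ProbabilityTheory Set Filter Topology
open scoped ENNReal

noncomputable section

namespace StationaryDiff

/-! ### Cost functions: directional form of the norm, vector space structure, integrability. -/

section Costs

set_option linter.unusedSectionVars false
set_option maxSynthPendingDepth 3

variable {E : Type*} [NormedAddCommGroup E] [NormedSpace ℝ E] {X : Set E} {A : X → E ≃L[ℝ] E}

/-- A `C²` function whose first and second derivatives are bounded by `n₁` and `n₂`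
in the Finsler norms. -/
structure CostBound (A : X → E ≃L[ℝ] E) (e : X → ℝ) (n₁ n₂ : ℝ) : Prop where
  contDiff : ContDiffOn ℝ 2 (extZero e) X
  nonneg₁ : 0 ≤ n₁
  nonneg₂ : 0 ≤ n₂
  bound₁ : ∀ x u, |dX e x u| ≤ n₁ * ‖A x u‖
  bound₂ : ∀ x u v, |dX (dX e) x u v| ≤ n₂ * ‖A x u‖ * ‖A x v‖

/-- The substitution `u = T⁻¹ w` trades operator norms for estimates on single vectors, which is how
all later bounds on derivatives are stated. -/
theorem norm_comp_symm_le_iff {G : Type*} [NormedAddCommGroup G] [NormedSpace ℝ G]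
    {L : E →L[ℝ] G} {T : E ≃L[ℝ] E} {n : ℝ} (hn : 0 ≤ n) :
    ‖L.comp (T.symm : E →L[ℝ] E)‖ ≤ n ↔ ∀ u, ‖L u‖ ≤ n * ‖T u‖ := by
  constructor
  · intro h u
    simpa using (L.comp (T.symm : E →L[ℝ] E)).le_of_opNorm_le h (T u)
  · intro h
    refine ContinuousLinearMap.opNorm_le_bound _ hn fun u => ?_
    simpa using h (T.symm u)

theorem norm_bilinearComp_symm_le_iff {F₁ F₂ G : Type*} [NormedAddCommGroup F₁] [NormedSpace ℝ F₁]
    [NormedAddCommGroup F₂] [NormedSpace ℝ F₂] [NormedAddCommGroup G] [NormedSpace ℝ G]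
    {Q : F₁ →L[ℝ] F₂ →L[ℝ] G} {S : F₁ ≃L[ℝ] F₁} {T : F₂ ≃L[ℝ] F₂} {n : ℝ} (hn : 0 ≤ n) :
    ‖Q.bilinearComp (S.symm : F₁ →L[ℝ] F₁) (T.symm : F₂ →L[ℝ] F₂)‖ ≤ n ↔
      ∀ u v, ‖Q u v‖ ≤ n * ‖S u‖ * ‖T v‖ := by
  constructor
  · intro h u v
    simpa using (Q.bilinearComp (S.symm : F₁ →L[ℝ] F₁) (T.symm : F₂ →L[ℝ] F₂)).le_of_opNorm₂_le_of_le
      h (le_refl ‖S u‖) (le_refl ‖T v‖)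
  · intro h
    refine ContinuousLinearMap.opNorm_le_bound₂ _ hn fun u v => ?_
    simpa using h (S.symm u) (T.symm v)

theorem enorm_le_ofReal_iff {G : Type*} [SeminormedAddCommGroup G] {g : G} {n : ℝ} (hn : 0 ≤ n) :
    ‖g‖ₑ ≤ ENNReal.ofReal n ↔ ‖g‖ ≤ n := by
  rw [← ofReal_norm, ENNReal.ofReal_le_ofReal_iff hn]

theorem enorm_bilinearComp_symm_le_iff {F₁ F₂ G : Type*} [NormedAddCommGroup F₁]
    [NormedSpace ℝ F₁] [NormedAddCommGroup F₂] [NormedSpace ℝ F₂] [NormedAddCommGroup G]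
    [NormedSpace ℝ G] {Q : F₁ →L[ℝ] F₂ →L[ℝ] G} {S : F₁ ≃L[ℝ] F₁} {T : F₂ ≃L[ℝ] F₂} {n : ℝ}
    (hn : 0 ≤ n) :
    ‖Q.bilinearComp (S.symm : F₁ →L[ℝ] F₁) (T.symm : F₂ →L[ℝ] F₂)‖ₑ ≤ ENNReal.ofReal n ↔
      ∀ u v, ‖Q u v‖ ≤ n * ‖S u‖ * ‖T v‖ := by
  rw [enorm_le_ofReal_iff hn, norm_bilinearComp_symm_le_iff hn]

theorem enorm_add_bilinearComp_le {F₁ F₂ G : Type*} [NormedAddCommGroup F₁]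
    [NormedSpace ℝ F₁] [NormedAddCommGroup F₂] [NormedSpace ℝ F₂] [NormedAddCommGroup G]
    [NormedSpace ℝ G] (Q Q' : F₁ →L[ℝ] F₂ →L[ℝ] G) (S : F₁ →L[ℝ] F₁) (T : F₂ →L[ℝ] F₂) :
    ‖(Q + Q').bilinearComp S T‖ₑ ≤ ‖Q.bilinearComp S T‖ₑ + ‖Q'.bilinearComp S T‖ₑ :=
  enorm_add_le (Q.bilinearComp S T) (Q'.bilinearComp S T)

theorem enorm_smul_bilinearComp {F₁ F₂ G : Type*} [NormedAddCommGroup F₁]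
    [NormedSpace ℝ F₁] [NormedAddCommGroup F₂] [NormedSpace ℝ F₂] [NormedAddCommGroup G]
    [NormedSpace ℝ G] (c : ℝ) (Q : F₁ →L[ℝ] F₂ →L[ℝ] G) (S : F₁ →L[ℝ] F₁) (T : F₂ →L[ℝ] F₂) :
    ‖(c • Q).bilinearComp S T‖ₑ = ‖c‖ₑ * ‖Q.bilinearComp S T‖ₑ :=
  enorm_smul c (Q.bilinearComp S T)

variable {x₀ : X}

theorem CostBound.of_E2norm_le {e : X → ℝ} (he : ContDiffOn ℝ 2 (extZero e) X) {N : ℝ} (hN : 0 ≤ N)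
    (h : E2norm A x₀ e ≤ ENNReal.ofReal N) : CostBound A e N N := by
  refine ⟨he, hN, hN, fun x => ?_, fun x => ?_⟩
  · refine (norm_comp_symm_le_iff (L := dX e x) hN).1 ((enorm_le_ofReal_iff hN).1 ?_)
    refine le_trans (le_iSup (fun x : X => ‖(dX e x).comp ((A x).symm : E →L[ℝ] E)‖ₑ) x) ?_
    exact le_trans (le_add_self.trans le_self_add) h
  · refine (enorm_bilinearComp_symm_le_iff (Q := dX (dX e) x) hN).1 ?_
    refine le_trans (le_iSup (fun x : X => ‖(dX (dX e) x).bilinearComp ((A x).symm : E →L[ℝ] E)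
      ((A x).symm : E →L[ℝ] E)‖ₑ) x) ?_
    exact le_trans le_add_self h

theorem abs_le_of_E2norm_le {e : X → ℝ} {N : ℝ} (hN : 0 ≤ N)
    (h : E2norm A x₀ e ≤ ENNReal.ofReal N) (x : X) : |e x| ≤ N * (1 + dA A x x₀) := by
  have hd : 0 < 1 + dA A x x₀ := by have := dA_nonneg (A := A) x x₀; linarith
  have h1 : ‖e x‖ₑ / ENNReal.ofReal (1 + dA A x x₀) ≤ ENNReal.ofReal N :=
    le_trans (le_iSup (fun x : X => ‖e x‖ₑ / ENNReal.ofReal (1 + dA A x x₀)) x)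
      (le_trans (le_self_add.trans le_self_add) h)
  rw [ENNReal.div_le_iff (by simpa using hd) ENNReal.ofReal_ne_top,
    ← ENNReal.ofReal_mul hN] at h1
  exact (enorm_le_ofReal_iff (by positivity)).1 h1

theorem CostBound.E2norm_le {e : X → ℝ} {n₀ n₁ n₂ : ℝ} (h : CostBound A e n₁ n₂) (hn : 0 ≤ n₀)
    (h0 : ∀ x, |e x| ≤ n₀ * (1 + dA A x x₀)) :
    E2norm A x₀ e ≤ ENNReal.ofReal (n₀ + n₁ + n₂) := by
  rw [ENNReal.ofReal_add (add_nonneg hn h.nonneg₁) h.nonneg₂, ENNReal.ofReal_add hn h.nonneg₁]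
  refine add_le_add (add_le_add (iSup_le fun x => ?_) (iSup_le fun x => ?_)) (iSup_le fun x => ?_)
  · have hd : 0 < 1 + dA A x x₀ := by have := dA_nonneg (A := A) x x₀; linarith
    rw [ENNReal.div_le_iff (by simpa using hd) ENNReal.ofReal_ne_top, ← ENNReal.ofReal_mul hn]
    exact (enorm_le_ofReal_iff (by positivity)).2 (h0 x)
  · exact (enorm_le_ofReal_iff h.nonneg₁).2 ((norm_comp_symm_le_iff h.nonneg₁).2 (h.bound₁ x))
  · exact (enorm_bilinearComp_symm_le_iff h.nonneg₂).2 (h.bound₂ x)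

theorem CostBound.mem_E2 {e : X → ℝ} {n₀ n₁ n₂ : ℝ} (h : CostBound A e n₁ n₂) (hn : 0 ≤ n₀)
    (h0 : ∀ x, |e x| ≤ n₀ * (1 + dA A x x₀)) : e ∈ E2 A x₀ :=
  ⟨h.contDiff, (h.E2norm_le hn h0).trans_lt ENNReal.ofReal_lt_top⟩

theorem exists_bound_of_mem_E2 {e : X → ℝ} (h : e ∈ E2 A x₀) :
    ∃ N : ℝ, 0 ≤ N ∧ CostBound A e N N ∧ ∀ x, |e x| ≤ N * (1 + dA A x x₀) := by
  have hN : E2norm A x₀ e ≤ ENNReal.ofReal (E2norm A x₀ e).toReal := by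
    rw [ENNReal.ofReal_toReal h.2.ne]
  exact ⟨_, ENNReal.toReal_nonneg, .of_E2norm_le h.1 ENNReal.toReal_nonneg hN,
    abs_le_of_E2norm_le ENNReal.toReal_nonneg hN⟩

variable (hA : FinslerConditions X A)
include hA

theorem hasFDerivWithinAt_dX {G : Type*} [NormedAddCommGroup G] [NormedSpace ℝ G] {e : X → G}
    (he : ContDiffOn ℝ 2 (extZero e) X) (x : X) : HasFDerivWithinAt (extZero e) (dX e x) X x :=
  (he.differentiableOn (by norm_num) x x.2).hasFDerivWithinAt

theorem contDiffOn_extZero_dX {G : Type*} [NormedAddCommGroup G] [NormedSpace ℝ G] {e : X → G}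
    (he : ContDiffOn ℝ 2 (extZero e) X) : ContDiffOn ℝ 1 (extZero (dX e)) X :=
  (he.fderivWithin hA.uniqueDiffOn (m := 1) (by norm_num)).congr
    fun x hx => extZero_coe (dX e) ⟨x, hx⟩

theorem hasFDerivWithinAt_dX_dX {G : Type*} [NormedAddCommGroup G] [NormedSpace ℝ G] {e : X → G}
    (he : ContDiffOn ℝ 2 (extZero e) X) (x : X) :
    HasFDerivWithinAt (extZero (dX e)) (dX (dX e) x) X x :=
  ((contDiffOn_extZero_dX hA he).differentiableOn (by norm_num) x x.2).hasFDerivWithinAt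

theorem continuous_of_contDiffOn {G : Type*} [NormedAddCommGroup G] [NormedSpace ℝ G] {e : X → G}
    (he : ContDiffOn ℝ 2 (extZero e) X) : Continuous e :=
  continuousOn_extZero.1 he.continuousOn

theorem continuous_dX {G : Type*} [NormedAddCommGroup G] [NormedSpace ℝ G] {e : X → G}
    (he : ContDiffOn ℝ 2 (extZero e) X) : Continuous (dX e) :=
  continuousOn_extZero.1 (contDiffOn_extZero_dX hA he).continuousOn

theorem continuous_dX_dX {G : Type*} [NormedAddCommGroup G] [NormedSpace ℝ G] {e : X → G}
    (he : ContDiffOn ℝ 2 (extZero e) X) : Continuous (dX (dX e)) := by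
  have := (contDiffOn_extZero_dX hA he).continuousOn_fderivWithin hA.uniqueDiffOn le_rfl
  exact continuousOn_iff_continuous_domRestrict.1 this

/-- A function with continuous second derivative on `X` is `C²`. -/
theorem contDiffOn_two_of_hasFDerivWithinAt {e : X → ℝ} {e₁ : X → E →L[ℝ] ℝ}
    {e₂ : X → E →L[ℝ] E →L[ℝ] ℝ} (h₁ : ∀ x : X, HasFDerivWithinAt (extZero e) (e₁ x) X x)
    (h₂ : ∀ x : X, HasFDerivWithinAt (extZero e₁) (e₂ x) X x) (hc : Continuous e₂) :
    ContDiffOn ℝ 2 (extZero e) X := by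
  have e1 : ∀ x : X, fderivWithin ℝ (extZero e) X x = extZero e₁ x := fun x => by
    rw [extZero_coe]; exact (h₁ x).fderivWithin (hA.uniqueDiffOn x x.2)
  have e2 : ∀ x : X, fderivWithin ℝ (extZero e₁) X x = e₂ x := fun x =>
    (h₂ x).fderivWithin (hA.uniqueDiffOn x x.2)
  have c1 : ContDiffOn ℝ 1 (extZero e₁) X := by
    rw [show (1 : WithTop ℕ∞) = 0 + 1 by norm_num,
      contDiffOn_succ_iff_fderivWithin hA.uniqueDiffOn]
    refine ⟨fun x hx => (h₂ ⟨x, hx⟩).differentiableWithinAt, by simp, ?_⟩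
    rw [contDiffOn_zero, continuousOn_iff_continuous_domRestrict]
    rw [show X.domRestrict (fderivWithin ℝ (extZero e₁) X) = e₂ from funext e2]
    exact hc
  rw [show (2 : WithTop ℕ∞) = 1 + 1 by norm_num, contDiffOn_succ_iff_fderivWithin hA.uniqueDiffOn]
  exact ⟨fun x hx => (h₁ ⟨x, hx⟩).differentiableWithinAt, by simp,
    c1.congr fun x hx => e1 ⟨x, hx⟩⟩

omit hA in
theorem extZero_add_apply {G : Type*} [AddZeroClass G] {e g : X → G} {y : E} (hy : y ∈ X) :
    extZero (e + g) y = extZero e y + extZero g y := by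
  obtain ⟨y, rfl⟩ : ∃ z : X, (z : E) = y := ⟨⟨y, hy⟩, rfl⟩
  rw [extZero_coe, extZero_coe, extZero_coe, Pi.add_apply]

omit hA in
theorem extZero_smul_apply {G : Type*} [NormedAddCommGroup G] [NormedSpace ℝ G] {e : X → G} {c : ℝ}
    {y : E} (hy : y ∈ X) : extZero (c • e) y = c • extZero e y := by
  obtain ⟨y, rfl⟩ : ∃ z : X, (z : E) = y := ⟨⟨y, hy⟩, rfl⟩
  rw [extZero_coe, extZero_coe, Pi.smul_apply]

theorem dX_add {G : Type*} [NormedAddCommGroup G] [NormedSpace ℝ G] {e g : X → G}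
    (he : DifferentiableOn ℝ (extZero e) X) (hg : DifferentiableOn ℝ (extZero g) X) :
    dX (e + g) = dX e + dX g := by
  funext x
  refine dX_eq hA ?_
  refine ((he x x.2).hasFDerivWithinAt.add (hg x x.2).hasFDerivWithinAt).congr'
    (fun y hy => ?_) x.2
  exact extZero_add_apply hy

theorem dX_smul {G : Type*} [NormedAddCommGroup G] [NormedSpace ℝ G] {e : X → G} (c : ℝ)
    (he : DifferentiableOn ℝ (extZero e) X) : dX (c • e) = c • dX e := by
  funext x
  refine dX_eq hA ?_
  refine ((he x x.2).hasFDerivWithinAt.const_smul c).congr' (fun y hy => ?_) x.2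
  exact extZero_smul_apply hy

omit hA in
theorem contDiffOn_extZero_add {G : Type*} [NormedAddCommGroup G] [NormedSpace ℝ G] {e g : X → G}
    {n : WithTop ℕ∞} (he : ContDiffOn ℝ n (extZero e) X) (hg : ContDiffOn ℝ n (extZero g) X) :
    ContDiffOn ℝ n (extZero (e + g)) X := by
  refine (he.add hg).congr fun y hy => ?_
  exact extZero_add_apply hy

omit hA in
theorem contDiffOn_extZero_smul {G : Type*} [NormedAddCommGroup G] [NormedSpace ℝ G] {e : X → G}
    {n : WithTop ℕ∞} (c : ℝ) (he : ContDiffOn ℝ n (extZero e) X) :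
    ContDiffOn ℝ n (extZero (c • e)) X := by
  refine (he.const_smul c).congr fun y hy => ?_
  exact extZero_smul_apply hy

omit hA in
theorem contDiffOn_extZero_const {G : Type*} [NormedAddCommGroup G] [NormedSpace ℝ G]
    {n : WithTop ℕ∞} (c : G) : ContDiffOn ℝ n (extZero (fun _ : X => c)) X :=
  contDiffOn_const.congr fun y hy => extZero_coe (fun _ : X => c) ⟨y, hy⟩

theorem dX_const {G : Type*} [NormedAddCommGroup G] [NormedSpace ℝ G] (c : G) (x : X) :
    dX (fun _ : X => c) x = 0 :=
  dX_eq hA ((hasFDerivWithinAt_const c (x : E) X).congr'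
    (fun y hy => extZero_coe (fun _ : X => c) ⟨y, hy⟩) x.2)

theorem CostBound.const (c : ℝ) : CostBound A (fun _ : X => c) 0 0 := by
  have h : dX (fun _ : X => c) = fun _ => 0 := funext fun x => dX_const hA c x
  refine ⟨contDiffOn_extZero_const c, le_rfl, le_rfl, fun x u => ?_, fun x u v => ?_⟩
  · simp [h]
  · rw [h, dX_const hA]; simp

theorem CostBound.add {e g : X → ℝ} {n₁ n₂ m₁ m₂ : ℝ} (he : CostBound A e n₁ n₂)
    (hg : CostBound A g m₁ m₂) : CostBound A (e + g) (n₁ + m₁) (n₂ + m₂) := by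
  have h1 := dX_add hA (he.contDiff.differentiableOn (by norm_num))
    (hg.contDiff.differentiableOn (by norm_num))
  have h2 := dX_add hA ((contDiffOn_extZero_dX hA he.contDiff).differentiableOn (by norm_num))
    ((contDiffOn_extZero_dX hA hg.contDiff).differentiableOn (by norm_num))
  refine ⟨contDiffOn_extZero_add he.contDiff hg.contDiff, add_nonneg he.nonneg₁ hg.nonneg₁,
    add_nonneg he.nonneg₂ hg.nonneg₂, fun x u => ?_, fun x u v => ?_⟩
  · rw [h1, add_mul]
    exact (abs_add_le _ _).trans (add_le_add (he.bound₁ x u) (hg.bound₁ x u))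
  · rw [h1, h2, add_mul, add_mul]
    exact (abs_add_le _ _).trans (add_le_add (he.bound₂ x u v) (hg.bound₂ x u v))

theorem E2norm_add_le {e g : X → ℝ} (he : ContDiffOn ℝ 2 (extZero e) X)
    (hg : ContDiffOn ℝ 2 (extZero g) X) :
    E2norm A x₀ (e + g) ≤ E2norm A x₀ e + E2norm A x₀ g := by
  have h1 := dX_add hA (he.differentiableOn (by norm_num)) (hg.differentiableOn (by norm_num))
  have h2 := dX_add hA ((contDiffOn_extZero_dX hA he).differentiableOn (by norm_num))
    ((contDiffOn_extZero_dX hA hg).differentiableOn (by norm_num))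
  have key : ∀ a b c a' b' c' : ℝ≥0∞, (a + a') + (b + b') + (c + c') = a + b + c + (a' + b' + c') :=
    fun a b c a' b' c' => by ring
  rw [E2norm, E2norm, E2norm, ← key, h1, h2]
  refine add_le_add (add_le_add (iSup_le fun x => ?_) (iSup_le fun x => ?_)) (iSup_le fun x => ?_)
  · refine le_trans ?_ (add_le_add
      (le_iSup (fun x : X => ‖e x‖ₑ / ENNReal.ofReal (1 + dA A x x₀)) x)
      (le_iSup (fun x : X => ‖g x‖ₑ / ENNReal.ofReal (1 + dA A x x₀)) x))
    rw [← ENNReal.add_div]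
    exact ENNReal.div_le_div_right (enorm_add_le (e x) (g x)) _
  · refine le_trans ?_ (add_le_add
      (le_iSup (fun x : X => ‖(dX e x).comp ((A x).symm : E →L[ℝ] E)‖ₑ) x)
      (le_iSup (fun x : X => ‖(dX g x).comp ((A x).symm : E →L[ℝ] E)‖ₑ) x))
    rw [Pi.add_apply, ContinuousLinearMap.add_comp]
    exact enorm_add_le ((dX e x).comp ((A x).symm : E →L[ℝ] E)) _
  · refine le_trans ?_ (add_le_add
      (le_iSup (fun x : X => ‖(dX (dX e) x).bilinearComp ((A x).symm : E →L[ℝ] E)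
        ((A x).symm : E →L[ℝ] E)‖ₑ) x)
      (le_iSup (fun x : X => ‖(dX (dX g) x).bilinearComp ((A x).symm : E →L[ℝ] E)
        ((A x).symm : E →L[ℝ] E)‖ₑ) x))
    exact enorm_add_bilinearComp_le _ _ _ _

theorem E2norm_smul {e : X → ℝ} (c : ℝ) (he : ContDiffOn ℝ 2 (extZero e) X) :
    E2norm A x₀ (c • e) = ‖c‖ₑ * E2norm A x₀ e := by
  have h1 := dX_smul hA c (he.differentiableOn (by norm_num))
  have h2 := dX_smul hA c ((contDiffOn_extZero_dX hA he).differentiableOn (by norm_num))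
  rw [E2norm, E2norm, h1, h2, mul_add, mul_add, ENNReal.mul_iSup, ENNReal.mul_iSup,
    ENNReal.mul_iSup]
  congr 1
  · congr 1
    · refine iSup_congr fun x => ?_
      rw [Pi.smul_apply, enorm_smul, mul_div_assoc]
    · refine iSup_congr fun x => ?_
      rw [Pi.smul_apply, ContinuousLinearMap.smul_comp, enorm_smul]
  · refine iSup_congr fun x => ?_
    exact enorm_smul_bilinearComp _ _ _ _

omit hA in
theorem eq_zero_of_E2norm_eq_zero {e : X → ℝ} (h : E2norm A x₀ e = 0) : e = 0 := by
  funext x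
  have := abs_le_of_E2norm_le (A := A) (x₀ := x₀) (e := e) le_rfl (by simp [h]) x
  rw [zero_mul] at this
  exact abs_nonpos_iff.1 this

variable [MeasurableSpace E] [BorelSpace E] [CompleteSpace E]

theorem CostBound.lipschitz {e : X → ℝ} {n₁ n₂ : ℝ} (h : CostBound A e n₁ n₂) (x y : X) :
    |e x - e y| ≤ n₁ * dA A x y :=
  norm_sub_le_mul_dA hA (hasFDerivWithinAt_dX hA h.contDiff) h.nonneg₁ h.bound₁ x y

theorem measurable_dA_left (y : X) : Measurable (fun x => dA A x y) :=
  ((continuous_dA hA).comp (continuous_id.prodMk continuous_const)).measurable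

theorem integrable_dA_sq {μ : Measure X} (hμ : μ ∈ P2A A x₀) :
    Integrable (fun x => dA A x x₀ ^ 2) μ := by
  refine ⟨((measurable_dA_left hA x₀).pow_const 2).aestronglyMeasurable, ?_⟩
  rw [hasFiniteIntegral_iff_ofReal (ae_of_all _ fun x => sq_nonneg _)]
  exact hμ.2

theorem integrable_dA {μ : Measure X} (hμ : μ ∈ P2A A x₀) :
    Integrable (fun x => dA A x x₀) μ := by
  have := hμ.1
  refine Integrable.mono' ((integrable_const (1 : ℝ)).add (integrable_dA_sq hA hμ))
    (measurable_dA_left hA x₀).aestronglyMeasurable (ae_of_all _ fun x => ?_)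
  rw [Real.norm_of_nonneg (dA_nonneg _ _)]
  simp only [Pi.add_apply]
  nlinarith [sq_nonneg (dA A x x₀ - 1)]

theorem integrable_of_abs_le {μ : Measure X} (hμ : μ ∈ P2A A x₀) {e : X → ℝ} (hc : Continuous e)
    {N : ℝ} (hN : ∀ x, |e x| ≤ N * (1 + dA A x x₀)) : Integrable e μ := by
  have := hμ.1
  exact Integrable.mono' (((integrable_const (1 : ℝ)).add (integrable_dA hA hμ)).const_mul N)
    hc.measurable.aestronglyMeasurable (ae_of_all _ hN)

theorem stateSpaceConditions [FiniteDimensional ℝ E] :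
    StateSpaceConditions (E2 A x₀) (E2norm A x₀) (P2A A x₀) where
  polish := by
    have := FiniteDimensional.proper_real E
    exact hA.closed.polishSpace
  borel := inferInstance
  const_mem c := (CostBound.const hA c).mem_E2 (abs_nonneg c) fun x => by
    have := dA_nonneg (A := A) x x₀
    nlinarith [abs_nonneg c]
  add_mem e he g hg := ⟨contDiffOn_extZero_add he.1 hg.1,
    (E2norm_add_le hA he.1 hg.1).trans_lt (ENNReal.add_lt_top.2 ⟨he.2, hg.2⟩)⟩
  smul_mem c e he := ⟨contDiffOn_extZero_smul c he.1, by
    rw [E2norm_smul hA c he.1]; exact ENNReal.mul_lt_top enorm_lt_top he.2⟩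
  norm_lt_top e he := he.2
  norm_add_le e he g hg := E2norm_add_le hA he.1 hg.1
  norm_smul c e he := E2norm_smul hA c he.1
  norm_eq_zero e _ h := eq_zero_of_E2norm_eq_zero h
  prob μ hμ := hμ.1
  integrable μ hμ e he := by
    obtain ⟨N, -, -, hN⟩ := exists_bound_of_mem_E2 he
    exact integrable_of_abs_le hA hμ (continuous_of_contDiffOn hA he.1) hN
  bounded μ hμ := by
    have := hμ.1
    -- In the unit ball of the norm `|e| ≤ 1 + d_A(·, x₀)`, so one plus the first moment of `μ`
    -- bounds the functional.
    refine lt_of_le_of_lt (b := ENNReal.ofReal (∫ x, (1 + dA A x x₀) ∂μ)) ?_ ENNReal.ofReal_lt_top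
    refine iSup₂_le fun e he => iSup_le fun h1 => ?_
    rw [← ENNReal.ofReal_one] at h1
    have hb := abs_le_of_E2norm_le zero_le_one h1
    rw [enorm_le_ofReal_iff (integral_nonneg fun x => by
      have := dA_nonneg (A := A) x x₀; positivity)]
    refine norm_integral_le_of_norm_le ((integrable_const (1 : ℝ)).add (integrable_dA hA hμ))
      (ae_of_all _ fun x => ?_)
    simpa using hb x

end Costs
end StationaryDiff
end

open MeasureTheory ProbabilityTheory Set Filter Topology
open scoped ENNReal

noncomputable section

namespace StationaryDiff

/-! ### Mean-square Lipschitz bounds for the system in the state and in the parameter. -/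

section SystemBounds

set_option linter.unusedSectionVars false
set_option maxSynthPendingDepth 3

variable {E F Ξ : Type*} [NormedAddCommGroup E] [NormedSpace ℝ E]
  [NormedAddCommGroup F] [NormedSpace ℝ F] {X : Set E} {A : X → E ≃L[ℝ] E} {B : X → F ≃L[ℝ] F}
  [MeasurableSpace Ξ] {ν : Measure Ξ} {Θ : Set F} {f : X → Ξ → F → X}

/-- Directional form of the bounds on the functions `L`. -/
structure SysBounds (ν : Measure Ξ) (Θ : Set F) (f : X → Ξ → F → X)
    (A : X → E ≃L[ℝ] E) (B : X → F ≃L[ℝ] F) (K L : ℝ) : Prop where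
  K_nonneg : 0 ≤ K
  L_nonneg : 0 ≤ L
  sqX : ∀ x, ∀ θ ∈ Θ, ∀ u, ∫⁻ ξ, ‖A (f x ξ θ) (fX f x ξ θ u)‖ₑ ^ 2 ∂ν
    ≤ ENNReal.ofReal (K * ‖A x u‖) ^ 2
  sqΘ : ∀ x, ∀ θ ∈ Θ, ∀ v, ∫⁻ ξ, ‖A (f x ξ θ) (fΘ f x ξ θ v)‖ₑ ^ 2 ∂ν
    ≤ ENNReal.ofReal (L * ‖B x v‖) ^ 2
  XX : ∀ x, ∀ θ ∈ Θ, ∀ u v, ∫⁻ ξ, ‖A (f x ξ θ) (fXX f x ξ θ u v)‖ₑ ∂ν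
    ≤ ENNReal.ofReal (L * ‖A x u‖ * ‖A x v‖)
  ΘΘ : ∀ x, ∀ θ ∈ Θ, ∀ u v, ∫⁻ ξ, ‖A (f x ξ θ) (fΘΘ f x ξ θ u v)‖ₑ ∂ν
    ≤ ENNReal.ofReal (L * ‖B x u‖ * ‖B x v‖)
  XΘ : ∀ x, ∀ θ ∈ Θ, ∀ u v, ∫⁻ ξ, ‖A (f x ξ θ) (fXΘ f x ξ θ u v)‖ₑ ∂ν
    ≤ ENNReal.ofReal (L * ‖A x u‖ * ‖B x v‖)

theorem enorm_apply_le_comp_symm {G₁ G₂ : Type*} [NormedAddCommGroup G₁] [NormedSpace ℝ G₁]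
    [NormedAddCommGroup G₂] [NormedSpace ℝ G₂] (T : G₂ →L[ℝ] G₂) (L : G₁ →L[ℝ] G₂)
    (S : G₁ ≃L[ℝ] G₁) (u : G₁) :
    ‖T (L u)‖ₑ ≤ ‖(T.comp L).comp (S.symm : G₁ →L[ℝ] G₁)‖ₑ * ‖S u‖ₑ := by
  simpa using ((T.comp L).comp (S.symm : G₁ →L[ℝ] G₁)).le_opENorm (S u)

theorem enorm_apply_le_bilinearComp_symm {G₁ G₂ G₃ : Type*} [NormedAddCommGroup G₁]
    [NormedSpace ℝ G₁] [NormedAddCommGroup G₂] [NormedSpace ℝ G₂] [NormedAddCommGroup G₃]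
    [NormedSpace ℝ G₃] (T : G₃ →L[ℝ] G₃) (Q : G₁ →L[ℝ] G₂ →L[ℝ] G₃) (S : G₁ ≃L[ℝ] G₁)
    (R : G₂ ≃L[ℝ] G₂) (u : G₁) (v : G₂) :
    ‖T (Q u v)‖ₑ ≤ ‖(postBilin T Q).bilinearComp (S.symm : G₁ →L[ℝ] G₁)
      (R.symm : G₂ →L[ℝ] G₂)‖ₑ * (‖S u‖ₑ * ‖R v‖ₑ) := by
  have h := ((postBilin T Q).bilinearComp (S.symm : G₁ →L[ℝ] G₁)
      (R.symm : G₂ →L[ℝ] G₂)).le_opNorm₂ (S u) (R v)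
  rw [← ofReal_norm, ← ofReal_norm, ← ofReal_norm, ← ofReal_norm, ← ENNReal.ofReal_mul (by positivity),
    ← ENNReal.ofReal_mul (by positivity)]
  refine ENNReal.ofReal_le_ofReal ?_
  rw [← mul_assoc]
  simpa [postBilin] using h

theorem le_sq_of_rpow_half_le {a b : ℝ≥0∞} (h : a ^ (1 / 2 : ℝ) ≤ b) : a ≤ b ^ 2 := by
  have := pow_le_pow_left' h 2
  rwa [← ENNReal.rpow_natCast, ← ENNReal.rpow_mul, show (1 / 2 : ℝ) * ((2 : ℕ) : ℝ) = 1 by norm_num,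
    ENNReal.rpow_one] at this

theorem lintegral_sq_apply_le {G₁ G₂ : Type*} [NormedAddCommGroup G₁] [NormedSpace ℝ G₁]
    [NormedAddCommGroup G₂] [NormedSpace ℝ G₂] {T : Ξ → G₂ →L[ℝ] G₂} {Q : Ξ → G₁ →L[ℝ] G₂}
    {S : G₁ ≃L[ℝ] G₁} {K : ℝ} (hK : 0 ≤ K)
    (h : (∫⁻ ξ, ‖((T ξ).comp (Q ξ)).comp (S.symm : G₁ →L[ℝ] G₁)‖ₑ ^ 2 ∂ν) ^ (1 / 2 : ℝ)
      ≤ ENNReal.ofReal K) (u : G₁) :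
    ∫⁻ ξ, ‖T ξ (Q ξ u)‖ₑ ^ 2 ∂ν ≤ ENNReal.ofReal (K * ‖S u‖) ^ 2 := by
  calc ∫⁻ ξ, ‖T ξ (Q ξ u)‖ₑ ^ 2 ∂ν
      ≤ ∫⁻ ξ, ‖((T ξ).comp (Q ξ)).comp (S.symm : G₁ →L[ℝ] G₁)‖ₑ ^ 2 * ‖S u‖ₑ ^ 2 ∂ν := by
        refine lintegral_mono fun ξ => ?_
        rw [← mul_pow]; exact pow_le_pow_left' (enorm_apply_le_comp_symm _ _ S u) 2
    _ = (∫⁻ ξ, ‖((T ξ).comp (Q ξ)).comp (S.symm : G₁ →L[ℝ] G₁)‖ₑ ^ 2 ∂ν) * ‖S u‖ₑ ^ 2 :=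
        lintegral_mul_const' _ _ (by simp)
    _ ≤ ENNReal.ofReal K ^ 2 * ‖S u‖ₑ ^ 2 := by gcongr; exact le_sq_of_rpow_half_le h
    _ = _ := by rw [← mul_pow, ENNReal.ofReal_mul hK, ofReal_norm]

theorem lintegral_bilin_apply_le {G₁ G₂ G₃ : Type*} [NormedAddCommGroup G₁] [NormedSpace ℝ G₁]
    [NormedAddCommGroup G₂] [NormedSpace ℝ G₂] [NormedAddCommGroup G₃] [NormedSpace ℝ G₃]
    {T : Ξ → G₃ →L[ℝ] G₃} {Q : Ξ → G₁ →L[ℝ] G₂ →L[ℝ] G₃} {S : G₁ ≃L[ℝ] G₁} {R : G₂ ≃L[ℝ] G₂}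
    {K : ℝ} (hK : 0 ≤ K)
    (h : ∫⁻ ξ, ‖(postBilin (T ξ) (Q ξ)).bilinearComp (S.symm : G₁ →L[ℝ] G₁)
      (R.symm : G₂ →L[ℝ] G₂)‖ₑ ∂ν ≤ ENNReal.ofReal K) (u : G₁) (v : G₂) :
    ∫⁻ ξ, ‖T ξ (Q ξ u v)‖ₑ ∂ν ≤ ENNReal.ofReal (K * ‖S u‖ * ‖R v‖) := by
  calc ∫⁻ ξ, ‖T ξ (Q ξ u v)‖ₑ ∂ν
      ≤ ∫⁻ ξ, ‖(postBilin (T ξ) (Q ξ)).bilinearComp (S.symm : G₁ →L[ℝ] G₁)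
        (R.symm : G₂ →L[ℝ] G₂)‖ₑ * (‖S u‖ₑ * ‖R v‖ₑ) ∂ν :=
        lintegral_mono fun ξ => enorm_apply_le_bilinearComp_symm _ _ S R u v
    _ = (∫⁻ ξ, ‖(postBilin (T ξ) (Q ξ)).bilinearComp (S.symm : G₁ →L[ℝ] G₁)
        (R.symm : G₂ →L[ℝ] G₂)‖ₑ ∂ν) * (‖S u‖ₑ * ‖R v‖ₑ) :=
        lintegral_mul_const' _ _ (by finiteness)
    _ ≤ ENNReal.ofReal K * (‖S u‖ₑ * ‖R v‖ₑ) := by gcongr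
    _ = _ := by
      rw [mul_assoc, ENNReal.ofReal_mul hK, ENNReal.ofReal_mul (norm_nonneg _), ofReal_norm,
        ofReal_norm]

/-- One constant serves for the four functions other than `L_X`. The maximum includes `0` because
the assumed bounds may be negative reals. -/
theorem exists_sysBounds {K_X : ℝ} (hL : BoundConditions ν Θ f A B K_X) :
    ∃ L : ℝ, SysBounds ν Θ f A B K_X L := by
  obtain ⟨K1, h1⟩ := hL.bound_LΘ
  obtain ⟨K2, h2⟩ := hL.bound_LXX
  obtain ⟨K3, h3⟩ := hL.bound_LΘΘ
  obtain ⟨K4, h4⟩ := hL.bound_LXΘ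
  set L := max 0 (max (max K1 K2) (max K3 K4)) with hLdef
  have l0 : 0 ≤ L := le_max_left _ _
  have l1 : K1 ≤ L := ((le_max_left _ _).trans (le_max_left _ _)).trans (le_max_right _ _)
  have l2 : K2 ≤ L := ((le_max_right _ _).trans (le_max_left _ _)).trans (le_max_right _ _)
  have l3 : K3 ≤ L := ((le_max_left _ _).trans (le_max_right _ _)).trans (le_max_right _ _)
  have l4 : K4 ≤ L := ((le_max_right _ _).trans (le_max_right _ _)).trans (le_max_right _ _)
  exact ⟨L, hL.nonneg, l0, fun x θ hθ u => lintegral_sq_apply_le hL.nonneg (hL.bound_LX x θ hθ) u,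
    fun x θ hθ v =>
      lintegral_sq_apply_le l0 ((h1 x θ hθ).trans (ENNReal.ofReal_le_ofReal l1)) v,
    fun x θ hθ u v =>
      lintegral_bilin_apply_le l0 ((h2 x θ hθ).trans (ENNReal.ofReal_le_ofReal l2)) u v,
    fun x θ hθ u v =>
      lintegral_bilin_apply_le l0 ((h3 x θ hθ).trans (ENNReal.ofReal_le_ofReal l3)) u v,
    fun x θ hθ u v =>
      lintegral_bilin_apply_le l0 ((h4 x θ hθ).trans (ENNReal.ofReal_le_ofReal l4)) u v⟩

variable [MeasurableSpace E] [BorelSpace E] [FiniteDimensional ℝ E] [SFinite ν]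

section

variable (hA : FinslerConditions X A) (hf : SystemConditions ν Θ f A)
include hA hf

theorem stronglyMeasurable_A_f {θ : F} (hθ : θ ∈ Θ) (x : X) :
    StronglyMeasurable (fun ξ => (A (f x ξ θ) : E →L[ℝ] E)) := by
  have := FiniteDimensional.proper_real E
  exact (hA.continuous.stronglyMeasurable).comp_measurable (hf.measurable x θ hθ)

/-- The system contracts `d_A` by the factor `K` in mean square. -/
theorem lintegral_dA_f_left_le {K L : ℝ} (hS : SysBounds ν Θ f A B K L) {θ : F} (hθ : θ ∈ Θ)
    (x y : X) : ∫⁻ ξ, ENNReal.ofReal (dA A (f x ξ θ) (f y ξ θ)) ^ 2 ∂ν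
      ≤ ENNReal.ofReal (K * dA A x y) ^ 2 := by
  have := FiniteDimensional.complete ℝ E
  have := FiniteDimensional.proper_real E
  have key : ∀ r, dA A x y < r → ∫⁻ ξ, ENNReal.ofReal (dA A (f x ξ θ) (f y ξ θ)) ^ 2 ∂ν
      ≤ ENNReal.ofReal (K * r) ^ 2 := by
    intro r hr
    obtain ⟨γ, a, b, hγc, hγ, rfl, rfl, hl⟩ := exists_curve_of_dA_lt hA.convex hr
    let h : ℝ → Ξ → ℝ≥0∞ := fun t ξ =>
      ‖A (f (γ t) ξ θ) (fX f (γ t) ξ θ (deriv (fun s => (γ s : E)) t))‖ₑ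
    have hm : Measurable (Function.uncurry h) := by
      have m1 : StronglyMeasurable (Function.uncurry
          (fun t ξ => (A (f (γ t) ξ θ) : E →L[ℝ] E))) :=
        stronglyMeasurable_uncurry_of_continuous_of_stronglyMeasurable
          (fun ξ => hA.continuous.comp ((continuous_f_left hA hf hθ ξ).comp hγc))
          (fun t => stronglyMeasurable_A_f hA hf hθ _)
      have m2 : StronglyMeasurable (Function.uncurry (fun t ξ => fX f (γ t) ξ θ)) :=
        stronglyMeasurable_uncurry_of_continuous_of_stronglyMeasurable
          (fun ξ => (continuous_fX_left hA hf hθ ξ).comp hγc)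
          (fun t => stronglyMeasurable_fX hA hf hθ _)
      have m3 : StronglyMeasurable (fun p : ℝ × Ξ => deriv (fun s => (γ s : E)) p.1) :=
        (stronglyMeasurable_deriv _).comp_measurable measurable_fst
      have m4 := isBoundedBilinearMap_apply.continuous.comp_stronglyMeasurable (m2.prodMk m3)
      have m5 := isBoundedBilinearMap_apply.continuous.comp_stronglyMeasurable (m1.prodMk m4)
      exact m5.enorm
    have hw : AEMeasurable (fun t => ENNReal.ofReal (K * speed A γ t))
        (volume.restrict (Ioc a b)) :=
      ((speed_integrableOn hA.continuous hγ).aestronglyMeasurable.aemeasurable.const_mul K).ennreal_ofReal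
    calc ∫⁻ ξ, ENNReal.ofReal (dA A (f (γ a) ξ θ) (f (γ b) ξ θ)) ^ 2 ∂ν
        ≤ ∫⁻ ξ, (∫⁻ t in Ioc a b, h t ξ) ^ 2 ∂ν := by
          refine lintegral_mono fun ξ => pow_le_pow_left' ?_ 2
          exact ofReal_dA_map_le hA (g := fun x => f x ξ θ)
            ((contDiffOn_f_left hA hf hθ ξ).of_le (by norm_num)) hγ
      -- Minkowski: the `L²(ν)` norm of the random length is at most the integral over `t` of the
      -- `L²(ν)` norm of the random speed, and `L_X ≤ K` bounds that norm by `K` times the speed of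
      -- `γ`.
      _ ≤ (∫⁻ t in Ioc a b, ENNReal.ofReal (K * speed A γ t)) ^ 2 :=
          lintegral_lintegral_sq_le hm hw (ae_of_all _ fun t => hS.sqX _ θ hθ _)
      _ = ENNReal.ofReal (K * curveLength A γ a b) ^ 2 := by
          rw [curveLength_eq, intervalIntegral.integral_of_le hγ.le, ← integral_const_mul,
            ofReal_integral_eq_lintegral_ofReal
              ((speed_integrableOn hA.continuous hγ).const_mul K)
              (ae_of_all _ fun t => mul_nonneg hS.K_nonneg (speed_nonneg γ t))]
      _ ≤ ENNReal.ofReal (K * r) ^ 2 := by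
          gcongr; exact hS.K_nonneg
  have ht : Tendsto (fun r => ENNReal.ofReal (K * r) ^ 2) (𝓝[>] (dA A x y))
      (𝓝 (ENNReal.ofReal (K * dA A x y) ^ 2)) := by
    have : Continuous (fun r : ℝ => ENNReal.ofReal (K * r) ^ 2) :=
      (ENNReal.continuous_pow 2).comp (ENNReal.continuous_ofReal.comp (by fun_prop))
    exact (this.tendsto _).mono_left nhdsWithin_le_nhds
  exact ge_of_tendsto ht (eventually_nhdsWithin_of_forall fun r hr => key r hr)

variable {U : Set F} (hU : Convex ℝ U) (hUΘ : U ⊆ Θ)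

theorem hasDerivWithinAt_f_seg (hUΘ : U ⊆ Θ) (x : X) (ξ : Ξ) (θ θ' : U) {t : ℝ}
    (ht : t ∈ Icc (0 : ℝ) 1) :
    HasDerivWithinAt (fun s => (f x ξ (segCurve hU θ θ' s) : E))
      (fΘ f x ξ (segCurve hU θ θ' t) ((θ' : F) - θ)) (Icc 0 1) t :=
  HasFDerivAt.comp_hasDerivWithinAt (l := fun η : F => (f x ξ η : E)) t
    (hasFDerivAt_f hA hf (hUΘ (segCurve hU θ θ' t).2) x ξ) (hasDerivWithinAt_segCurve hU θ θ' ht)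

/-- The competitor is the image of a parameter segment under `f(x, ξ, ·)`, with Minkowski as in the
state variable. `Θ` is merely open, so the segment is kept in a convex subset `U`; balls are used
later. -/
theorem lintegral_dA_f_right_le {K L : ℝ} (hS : SysBounds ν Θ f A B K L) [FiniteDimensional ℝ F]
    (hU : Convex ℝ U) (hUΘ : U ⊆ Θ) (x : X) (θ θ' : U) :
    ∫⁻ ξ, ENNReal.ofReal (dA A (f x ξ θ) (f x ξ θ')) ^ 2 ∂ν
      ≤ ENNReal.ofReal (L * ‖B x ((θ' : F) - θ)‖) ^ 2 := by
  have := FiniteDimensional.complete ℝ E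
  have := FiniteDimensional.proper_real E
  let σ := segCurve hU θ θ'
  have hσ : ∀ t, (σ t : F) ∈ Θ := fun t => hUΘ (σ t).2
  have hσc : Continuous (fun t => (σ t : F)) := continuous_subtype_val.comp (continuous_segCurve hU θ θ')
  let h : ℝ → Ξ → ℝ≥0∞ := fun t ξ => ‖A (f x ξ (σ t)) (fΘ f x ξ (σ t) ((θ' : F) - θ))‖ₑ
  have hm : Measurable (Function.uncurry h) := by
    have m1 : StronglyMeasurable (Function.uncurry (fun t ξ => (A (f x ξ (σ t)) : E →L[ℝ] E))) :=
      stronglyMeasurable_uncurry_of_continuous_of_stronglyMeasurable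
        (fun ξ => hA.continuous.comp
          ((continuousOn_f_right hA hf x ξ).comp_continuous hσc hσ))
        (fun t => stronglyMeasurable_A_f hA hf (hσ t) _)
    have m2 : StronglyMeasurable (Function.uncurry (fun t ξ => fΘ f x ξ (σ t))) :=
      stronglyMeasurable_uncurry_of_continuous_of_stronglyMeasurable
        (fun ξ => (continuousOn_fΘ_right hA hf x ξ).comp_continuous hσc hσ)
        (fun t => stronglyMeasurable_fΘ hA hf (hσ t) _)
    have m3 : StronglyMeasurable (fun _ : ℝ × Ξ => (θ' : F) - θ) := stronglyMeasurable_const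
    have m4 := isBoundedBilinearMap_apply.continuous.comp_stronglyMeasurable (m2.prodMk m3)
    have m5 := isBoundedBilinearMap_apply.continuous.comp_stronglyMeasurable (m1.prodMk m4)
    exact m5.enorm
  calc ∫⁻ ξ, ENNReal.ofReal (dA A (f x ξ θ) (f x ξ θ')) ^ 2 ∂ν
      ≤ ∫⁻ ξ, (∫⁻ t in Ioc (0 : ℝ) 1, h t ξ) ^ 2 ∂ν := by
        refine lintegral_mono fun ξ => pow_le_pow_left' ?_ 2
        have hd : ∀ t ∈ Icc (0 : ℝ) 1, HasDerivWithinAt (fun s => (f x ξ (σ s) : E))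
            (fΘ f x ξ (σ t) ((θ' : F) - θ)) (Icc 0 1) t := fun t ht =>
          hasDerivWithinAt_f_seg hA hf hU hUΘ x ξ θ θ' ht
        have hcd : ContDiffOn ℝ 1 (fun s => (f x ξ (σ s) : E)) (Icc 0 1) := by
          rw [show (1 : WithTop ℕ∞) = 0 + 1 by norm_num,
            contDiffOn_succ_iff_derivWithin (uniqueDiffOn_Icc zero_lt_one)]
          refine ⟨fun t ht => (hd t ht).differentiableWithinAt, by simp, ?_⟩
          rw [contDiffOn_zero]
          have hc : Continuous (fun t => fΘ f x ξ (σ t) ((θ' : F) - θ)) :=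
            ((continuousOn_fΘ_right hA hf x ξ).comp_continuous hσc hσ).clm_apply continuous_const
          exact hc.continuousOn.congr fun t ht =>
            (hd t ht).derivWithin (uniqueDiffOn_Icc zero_lt_one t ht)
        have := ofReal_dA_le_of_contDiffOn hA (c := fun s => f x ξ (σ s)) hcd
          (c' := fun t => fΘ f x ξ (σ t) ((θ' : F) - θ))
          (fun t ht => (hd t (Ioo_subset_Icc_self ht)).hasDerivAt (Icc_mem_nhds ht.1 ht.2))
        simpa only [σ, segCurve_zero, segCurve_one] using this
    _ ≤ (∫⁻ _ in Ioc (0 : ℝ) 1, ENNReal.ofReal (L * ‖B x ((θ' : F) - θ)‖)) ^ 2 :=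
        lintegral_lintegral_sq_le hm aemeasurable_const
          (ae_of_all _ fun t => hS.sqΘ _ _ (hσ t) _)
    _ = _ := by simp

end

end SystemBounds
end StationaryDiff
end

open MeasureTheory ProbabilityTheory Set Filter Topology
open scoped ENNReal

noncomputable section

namespace StationaryDiff

/-! ### Differentiation under the integral sign on a convex set. -/

section DifferentiationUnderIntegral

set_option linter.unusedSectionVars false
set_option maxSynthPendingDepth 3

variable {E Ξ : Type*} [NormedAddCommGroup E] [NormedSpace ℝ E] {X : Set E} {A : X → E ≃L[ℝ] E}
  [MeasurableSpace Ξ] {ν : Measure Ξ} [SFinite ν]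
  {G : Type*} [NormedAddCommGroup G] [NormedSpace ℝ G]

theorem hasDerivWithinAt_comp_curve {h : X → G} {h' : E →L[ℝ] G} {g : ℝ → X} {g' : E} {s : Set ℝ}
    {t : ℝ} (hd : HasFDerivWithinAt (extZero h) h' X (g t))
    (hg : HasDerivWithinAt (fun t => (g t : E)) g' s t) :
    HasDerivWithinAt (fun t => h (g t)) (h' g') s t := by
  have := hd.comp_hasDerivWithinAt t hg (fun r _ => (g r).2)
  have e : (extZero h ∘ fun t => (g t : E)) = fun t => h (g t) := funext fun r => extZero_coe h _
  rwa [e] at this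

theorem hasFDerivWithinAt_comp_map {h : X → G} {h' : E →L[ℝ] G} {g : X → X} {g' : E →L[ℝ] E}
    {x : X} (hd : HasFDerivWithinAt (extZero h) h' X (g x))
    (hg : HasFDerivWithinAt (extZero (fun y => (g y : E))) g' X x) :
    HasFDerivWithinAt (extZero (fun y => h (g y))) (h'.comp g') X x := by
  have h1 : HasFDerivWithinAt (extZero h) h' X (extZero (fun y => (g y : E)) x) := by
    rw [extZero_coe]; exact hd
  refine (h1.comp (x : E) hg fun y hy => ?_).congr' (fun y hy => ?_) x.2
  · rw [show y = ((⟨y, hy⟩ : X) : E) from rfl, extZero_coe]; exact (g _).2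
  · obtain ⟨y, rfl⟩ : ∃ z : X, (z : E) = y := ⟨⟨y, hy⟩, rfl⟩
    rw [Function.comp_apply, extZero_coe, extZero_coe, extZero_coe]

/-- No single dominating function is available: `D x` varies with `x`. Continuity of its integral
takes the place of a fixed majorant, and this is the role of the assumed continuity of the functions
`L`. -/
theorem tendsto_lintegral_enorm_sub {T : Type*} [TopologicalSpace T] [FirstCountableTopology T]
    {u : T → Ξ → G} (hc : ∀ ξ, Continuous (fun x => u x ξ)) (hm : ∀ x, StronglyMeasurable (u x))
    {D : T → Ξ → ℝ≥0∞} (hD : ∀ x ξ, ‖u x ξ‖ₑ ≤ D x ξ) (hDc : ∀ ξ, Continuous (fun x => D x ξ))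
    (hDm : ∀ x, AEMeasurable (D x) ν) (hDI : Continuous (fun x => ∫⁻ ξ, D x ξ ∂ν))
    (hfin : ∀ x, ∫⁻ ξ, D x ξ ∂ν ≠ ⊤) (x : T) :
    Tendsto (fun y => ∫⁻ ξ, ‖u y ξ - u x ξ‖ₑ ∂ν) (𝓝 x) (𝓝 0) := by
  refine tendsto_lintegral_zero_of_dominated (G := fun y ξ => D y ξ + D x ξ)
    (G' := fun ξ => D x ξ + D x ξ)
    (Eventually.of_forall fun y => ((hm y).sub (hm x)).enorm.aemeasurable)
    (Eventually.of_forall fun y => (hDm y).add (hDm x))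
    (Eventually.of_forall fun y ξ => ?_) (fun ξ => ?_) (fun ξ => ?_) ?_ ?_
  · exact enorm_sub_le.trans (add_le_add (hD y ξ) (hD x ξ))
  · have : Continuous (fun y => ‖u y ξ - u x ξ‖ₑ) := ((hc ξ).sub continuous_const).enorm
    simpa using this.tendsto x
  · exact ((hDc ξ).tendsto x).add_const _
  · rw [lintegral_add_left' (hDm x)]
    exact ENNReal.add_ne_top.2 ⟨hfin x, hfin x⟩
  · simp_rw [lintegral_add_left' (hDm _)]
    exact (hDI.tendsto x).add_const _

/-- Differentiation under the integral sign for functions on a convex set, when the derivative is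
continuous in `L¹`. -/
theorem hasFDerivWithinAt_integral [CompleteSpace G] (hX : Convex ℝ X)
    {u : X → Ξ → G} {u' : X → Ξ → E →L[ℝ] G}
    (hu : ∀ ξ, ∀ x : X, HasFDerivWithinAt (extZero (fun y => u y ξ)) (u' x ξ) X x)
    (hc : ∀ ξ, Continuous (fun x => u' x ξ)) (hm : ∀ x, StronglyMeasurable (u' x))
    (hi : ∀ x, Integrable (u x) ν) (hi' : ∀ x, Integrable (u' x) ν)
    (hL : ∀ x, Tendsto (fun y => ∫⁻ ξ, ‖u' y ξ - u' x ξ‖ₑ ∂ν) (𝓝 x) (𝓝 0)) (x : X) :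
    HasFDerivWithinAt (extZero (fun y => ∫ ξ, u y ξ ∂ν)) (∫ ξ, u' x ξ ∂ν) X x := by
  refine .of_isLittleO (Asymptotics.isLittleO_iff.2 fun ε hε => ?_)
  have hev := (ENNReal.tendsto_nhds_zero.1 (hL x)) (ENNReal.ofReal ε) (by simpa using hε)
  obtain ⟨δ, hδ, hball⟩ := Metric.eventually_nhds_iff.1 hev
  filter_upwards [self_mem_nhdsWithin, nhdsWithin_le_nhds (Metric.ball_mem_nhds (x : E) hδ)]
    with y hy hyδ
  obtain ⟨y, rfl⟩ : ∃ z : X, (z : E) = y := ⟨⟨y, hy⟩, rfl⟩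
  have hseg : ∀ t ∈ Icc (0 : ℝ) 1, dist (segCurve hX x y t) x < δ := by
    intro t ht
    rw [Subtype.dist_eq, segCurve_coe _ _ _ ht, dist_eq_norm, add_sub_cancel_left, norm_smul,
      Real.norm_of_nonneg ht.1]
    rw [Metric.mem_ball, dist_eq_norm] at hyδ
    nlinarith [ht.1, ht.2, norm_nonneg ((y : E) - x)]
  -- Mean value inequality for `u` along the segment minus its linear part at `x`. The derivative of
  -- the difference has `L¹` norm at most `ε ‖y - x‖`, because the segment stays within `δ` of `x`.
  have hmv := lintegral_enorm_sub_le_of_hasDerivWithinAt (ν := ν)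
    (c := fun t ξ => u (segCurve hX x y t) ξ - t • u' x ξ ((y : E) - x))
    (c' := fun t ξ => (u' (segCurve hX x y t) ξ - u' x ξ) ((y : E) - x))
    (M := ENNReal.ofReal ε * ‖(y : E) - x‖ₑ) (fun ξ t ht => ?_) (fun ξ => ?_) (fun t ht => ?_)
    (fun t ht => ?_)
  · rw [extZero_coe, extZero_coe, ContinuousLinearMap.integral_apply (hi' x),
      ← integral_sub (hi y) (hi x), ← integral_sub (f := fun ξ => u y ξ - u x ξ)
        ((hi y).sub (hi x)) ((hi' x).apply_continuousLinearMap _)]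
    rw [← enorm_le_ofReal_iff (by positivity), ENNReal.ofReal_mul hε.le, ofReal_norm]
    refine (enorm_integral_le_lintegral_enorm _).trans ((le_of_eq ?_).trans hmv)
    refine lintegral_congr fun ξ => ?_
    simp only [segCurve_one, segCurve_zero, one_smul, zero_smul, sub_zero]
    congr 1
    abel
  · have h1 := hasDerivWithinAt_comp_curve (hu ξ (segCurve hX x y t))
      (hasDerivWithinAt_segCurve hX x y ht)
    have h2 := ((hasDerivAt_id t).smul_const (u' x ξ ((y : E) - x))).hasDerivWithinAt (s := Icc 0 1)
    rw [one_smul] at h2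
    exact h1.sub h2
  · exact ((((hc ξ).comp (continuous_segCurve hX x y)).sub continuous_const).clm_apply
      continuous_const).continuousOn
  · exact (ContinuousLinearMap.apply ℝ G ((y : E) - x)).continuous.comp_stronglyMeasurable
      ((hm _).sub (hm x))
  · calc ∫⁻ ξ, ‖(u' (segCurve hX x y t) ξ - u' x ξ) ((y : E) - x)‖ₑ ∂ν
        ≤ ∫⁻ ξ, ‖u' (segCurve hX x y t) ξ - u' x ξ‖ₑ * ‖(y : E) - x‖ₑ ∂ν :=
          lintegral_mono fun ξ => ContinuousLinearMap.le_opENorm _ _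
      _ = (∫⁻ ξ, ‖u' (segCurve hX x y t) ξ - u' x ξ‖ₑ ∂ν) * ‖(y : E) - x‖ₑ :=
          lintegral_mul_const' _ _ (by simp)
      _ ≤ _ := by gcongr; exact hball (hseg t ht)

theorem continuous_integral_of_tendsto {T : Type*} [TopologicalSpace T] [CompleteSpace G]
    {u : T → Ξ → G} (hi : ∀ x, Integrable (u x) ν)
    (hL : ∀ x, Tendsto (fun y => ∫⁻ ξ, ‖u y ξ - u x ξ‖ₑ ∂ν) (𝓝 x) (𝓝 0)) :
    Continuous (fun x => ∫ ξ, u x ξ ∂ν) :=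
  continuous_iff_continuousAt.2 fun x =>
    tendsto_integral_of_L1 _ (hi x).aestronglyMeasurable (Eventually.of_forall hi) (hL x)

end DifferentiationUnderIntegral
end StationaryDiff
end

open MeasureTheory ProbabilityTheory Set Filter Topology
open scoped ENNReal

noncomputable section

namespace StationaryDiff

/-! ### The transition operator on costs: it preserves `C²` functions and contracts first
derivatives. -/

section TransitionOnCosts

set_option linter.unusedSectionVars false
set_option maxSynthPendingDepth 3

variable {E F Ξ : Type*} [NormedAddCommGroup E] [NormedSpace ℝ E]
  [NormedAddCommGroup F] [NormedSpace ℝ F] {X : Set E} {A : X → E ≃L[ℝ] E} {B : X → F ≃L[ℝ] F}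
  [MeasurableSpace Ξ] {ν : Measure Ξ} [SFinite ν] {Θ : Set F} {f : X → Ξ → F → X}

/-- The action of the transition kernel on functions. -/
def meanOp (ν : Measure Ξ) (f : X → Ξ → F → X) (θ : F) (e : X → ℝ) (x : X) : ℝ :=
  ∫ ξ, e (f x ξ θ) ∂ν

/-- The derivative of `x ↦ e (f x ξ θ)`. -/
def chainX (f : X → Ξ → F → X) (θ : F) (e : X → ℝ) (x : X) (ξ : Ξ) : E →L[ℝ] ℝ :=
  (dX e (f x ξ θ)).comp (fX f x ξ θ)

/-- The second derivative of `x ↦ e (f x ξ θ)`. -/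
def chainXX (f : X → Ξ → F → X) (θ : F) (e : X → ℝ) (x : X) (ξ : Ξ) : E →L[ℝ] E →L[ℝ] ℝ :=
  (ContinuousLinearMap.compL ℝ E E ℝ (dX e (f x ξ θ))).comp (fXX f x ξ θ) +
    ((ContinuousLinearMap.compL ℝ E E ℝ).flip (fX f x ξ θ)).comp
      ((dX (dX e) (f x ξ θ)).comp (fX f x ξ θ))

theorem chainXX_apply (θ : F) (e : X → ℝ) (x : X) (ξ : Ξ) (u v : E) :
    chainXX f θ e x ξ u v = dX e (f x ξ θ) (fXX f x ξ θ u v) +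
      dX (dX e) (f x ξ θ) (fX f x ξ θ u) (fX f x ξ θ v) := rfl

/-- The normalized derivative whose mean square is `L_X²`. -/
def normX (f : X → Ξ → F → X) (A : X → E ≃L[ℝ] E) (θ : F) (x : X) (ξ : Ξ) : E →L[ℝ] E :=
  ((A (f x ξ θ) : E →L[ℝ] E).comp (fX f x ξ θ)).comp ((A x).symm : E →L[ℝ] E)

/-- The normalized second derivative whose mean norm is `L_{X²}`. -/
def normXX (f : X → Ξ → F → X) (A : X → E ≃L[ℝ] E) (θ : F) (x : X) (ξ : Ξ) :
    E →L[ℝ] E →L[ℝ] E :=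
  (postBilin (A (f x ξ θ) : E →L[ℝ] E) (fXX f x ξ θ)).bilinearComp
    ((A x).symm : E →L[ℝ] E) ((A x).symm : E →L[ℝ] E)

theorem norm_A_fX_le (θ : F) (x : X) (ξ : Ξ) (u : E) :
    ‖A (f x ξ θ) (fX f x ξ θ u)‖ ≤ ‖normX f A θ x ξ‖ * (‖(A x : E →L[ℝ] E)‖ * ‖u‖) := by
  have h := (normX f A θ x ξ).le_of_opNorm_le_of_le le_rfl ((A x : E →L[ℝ] E).le_opNorm u)
  simpa [normX] using h

theorem norm_A_fXX_le (θ : F) (x : X) (ξ : Ξ) (u v : E) :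
    ‖A (f x ξ θ) (fXX f x ξ θ u v)‖ ≤ ‖normXX f A θ x ξ‖ *
      (‖(A x : E →L[ℝ] E)‖ * ‖u‖) * (‖(A x : E →L[ℝ] E)‖ * ‖v‖) := by
  have h := (normXX f A θ x ξ).le_of_opNorm₂_le_of_le le_rfl
    ((A x : E →L[ℝ] E).le_opNorm u) ((A x : E →L[ℝ] E).le_opNorm v)
  simpa [normXX, postBilin] using h

/-- The norm of `normX` is replaced by one plus its square, so that the integral of the majorant is
an expression in `L_X²`, whose continuity in `x` is known. -/
theorem enorm_chainX_le {e : X → ℝ} {n₁ n₂ : ℝ} (he : CostBound A e n₁ n₂) (θ : F) (x : X) (ξ : Ξ) :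
    ‖chainX f θ e x ξ‖ₑ ≤
      ENNReal.ofReal n₁ * (1 + ‖normX f A θ x ξ‖ₑ ^ 2) * ‖(A x : E →L[ℝ] E)‖ₑ := by
  have h : ‖chainX f θ e x ξ‖ ≤ n₁ * (1 + ‖normX f A θ x ξ‖ ^ 2) * ‖(A x : E →L[ℝ] E)‖ := by
    have hn := he.nonneg₁
    refine ContinuousLinearMap.opNorm_le_bound _ (by positivity) fun u => ?_
    refine (he.bound₁ _ _).trans ?_
    have h1 := norm_A_fX_le (A := A) (f := f) θ x ξ u
    have h2 : ‖normX f A θ x ξ‖ ≤ 1 + ‖normX f A θ x ξ‖ ^ 2 := by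
      nlinarith [sq_nonneg (‖normX f A θ x ξ‖ - 1)]
    calc n₁ * ‖A (f x ξ θ) (fX f x ξ θ u)‖
        ≤ n₁ * ((1 + ‖normX f A θ x ξ‖ ^ 2) * (‖(A x : E →L[ℝ] E)‖ * ‖u‖)) := by
          refine mul_le_mul_of_nonneg_left (h1.trans ?_) hn
          gcongr
      _ = _ := by ring
  have hn := he.nonneg₁
  have := ENNReal.ofReal_le_ofReal h
  rwa [ofReal_norm, ENNReal.ofReal_mul (by positivity), ENNReal.ofReal_mul hn,
    ENNReal.ofReal_add zero_le_one (by positivity), ENNReal.ofReal_pow (norm_nonneg _), ofReal_norm,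
    ofReal_norm, ENNReal.ofReal_one] at this

theorem enorm_chainXX_le {e : X → ℝ} {n₁ n₂ : ℝ} (he : CostBound A e n₁ n₂) (θ : F) (x : X)
    (ξ : Ξ) : ‖chainXX f θ e x ξ‖ₑ ≤ (ENNReal.ofReal n₁ * ‖normXX f A θ x ξ‖ₑ +
      ENNReal.ofReal n₂ * ‖normX f A θ x ξ‖ₑ ^ 2) * ‖(A x : E →L[ℝ] E)‖ₑ ^ 2 := by
  have hn1 := he.nonneg₁
  have hn2 := he.nonneg₂
  have h : ‖chainXX f θ e x ξ‖ ≤ (n₁ * ‖normXX f A θ x ξ‖ + n₂ * ‖normX f A θ x ξ‖ ^ 2) *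
      ‖(A x : E →L[ℝ] E)‖ ^ 2 := by
    refine ContinuousLinearMap.opNorm_le_bound₂ _ (by positivity) fun u v => ?_
    rw [chainXX_apply]
    have h1 := (he.bound₁ (f x ξ θ) (fXX f x ξ θ u v)).trans
      (mul_le_mul_of_nonneg_left (norm_A_fXX_le (A := A) (f := f) θ x ξ u v) hn1)
    have h2 := he.bound₂ (f x ξ θ) (fX f x ξ θ u) (fX f x ξ θ v)
    have h3 : n₂ * ‖A (f x ξ θ) (fX f x ξ θ u)‖ * ‖A (f x ξ θ) (fX f x ξ θ v)‖ ≤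
        n₂ * (‖normX f A θ x ξ‖ * (‖(A x : E →L[ℝ] E)‖ * ‖u‖)) *
          (‖normX f A θ x ξ‖ * (‖(A x : E →L[ℝ] E)‖ * ‖v‖)) := by
      gcongr
      · exact norm_A_fX_le θ x ξ u
      · exact norm_A_fX_le θ x ξ v
    refine (abs_add_le _ _).trans ((add_le_add h1 (h2.trans h3)).trans (le_of_eq ?_))
    ring
  have := ENNReal.ofReal_le_ofReal h
  rwa [ofReal_norm, ENNReal.ofReal_mul (by positivity),
    ENNReal.ofReal_add (by positivity) (by positivity), ENNReal.ofReal_mul hn1,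
    ENNReal.ofReal_mul hn2, ENNReal.ofReal_pow (norm_nonneg _), ENNReal.ofReal_pow (norm_nonneg _),
    ofReal_norm, ofReal_norm, ofReal_norm] at this

theorem stronglyMeasurable_clm_apply_const {V G : Type*} [NormedAddCommGroup V] [NormedSpace ℝ V]
    [NormedAddCommGroup G] [NormedSpace ℝ G] {l : Ξ → V →L[ℝ] G} (hl : StronglyMeasurable l)
    (u : V) : StronglyMeasurable (fun ξ => l ξ u) :=
  (ContinuousLinearMap.apply ℝ G u).continuous.comp_stronglyMeasurable hl

theorem continuous_ennreal_mul {T : Type*} [TopologicalSpace T] {g h : T → ℝ≥0∞}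
    (hg : Continuous g) (hh : Continuous h) (hgt : ∀ x, g x ≠ ⊤) (hht : ∀ x, h x ≠ ⊤) :
    Continuous (fun x => g x * h x) :=
  continuous_iff_continuousAt.2 fun x =>
    ENNReal.Tendsto.mul (hg.tendsto x) (Or.inr (hht x)) (hh.tendsto x) (Or.inr (hgt x))

theorem lintegral_le_of_sq_le [IsProbabilityMeasure ν] {g : Ξ → ℝ≥0∞} (hg : AEMeasurable g ν)
    {a : ℝ≥0∞} (ha : ∫⁻ ξ, g ξ ^ 2 ∂ν ≤ a ^ 2) : ∫⁻ ξ, g ξ ∂ν ≤ a := by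
  have := lintegral_mul_le_of_sq_le (h := fun _ => 1) (b := 1) hg aemeasurable_const ha (by simp)
  simpa using this

variable [MeasurableSpace E] [BorelSpace E] [FiniteDimensional ℝ E]

theorem continuous_postBilin_bilinearComp {T : Type*} [TopologicalSpace T] {a : T → E →L[ℝ] E}
    {Q : T → E →L[ℝ] E →L[ℝ] E} {b : T → E →L[ℝ] E} (ha : Continuous a) (hQ : Continuous Q)
    (hb : Continuous b) : Continuous (fun t => (postBilin (a t) (Q t)).bilinearComp (b t) (b t)) := by
  have h1 : Continuous (fun t => postBilin (a t) (Q t)) :=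
    ((ContinuousLinearMap.compL ℝ E E E).continuous.comp ha).clm_comp hQ
  have hflip : Continuous (fun R : E →L[ℝ] E →L[ℝ] E => R.flip) :=
    (ContinuousLinearMap.flipₗᵢ ℝ E E E).continuous
  exact hflip.comp ((hflip.comp (h1.clm_comp hb)).clm_comp hb)

theorem continuous_A_symm (hA : FinslerConditions X A) :
    Continuous (fun x => ((A x).symm : E →L[ℝ] E)) := by
  have := FiniteDimensional.complete ℝ E
  refine continuous_iff_continuousAt.2 fun x => ?_
  have h := (contDiffAt_map_inverse (n := 0) (A x)).continuousAt
  have h2 : ContinuousAt (fun y => ContinuousLinearMap.inverse (A y : E →L[ℝ] E)) x :=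
    ContinuousAt.comp (f := fun y => (A y : E →L[ℝ] E)) h hA.continuous.continuousAt
  simpa using h2

section

variable (hA : FinslerConditions X A) (hf : SystemConditions ν Θ f A) {θ : F} (hθ : θ ∈ Θ)
include hA hf hθ

theorem continuous_A_f (ξ : Ξ) : Continuous (fun x => (A (f x ξ θ) : E →L[ℝ] E)) :=
  hA.continuous.comp (continuous_f_left hA hf hθ ξ)

theorem continuous_normX (ξ : Ξ) : Continuous (fun x => normX f A θ x ξ) :=
  ((continuous_A_f hA hf hθ ξ).clm_comp (continuous_fX_left hA hf hθ ξ)).clm_comp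
    (continuous_A_symm hA)

theorem continuous_normXX (ξ : Ξ) : Continuous (fun x => normXX f A θ x ξ) :=
  continuous_postBilin_bilinearComp (continuous_A_f hA hf hθ ξ)
    (continuous_fXX_left hA hf hθ ξ) (continuous_A_symm hA)

theorem stronglyMeasurable_normX (x : X) : StronglyMeasurable (normX f A θ x) := by
  have h : Continuous (fun p : (E →L[ℝ] E) × (E →L[ℝ] E) =>
      (p.1.comp p.2).comp ((A x).symm : E →L[ℝ] E)) :=
    (continuous_fst.clm_comp continuous_snd).clm_comp continuous_const
  exact h.comp_stronglyMeasurable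
    ((stronglyMeasurable_A_f hA hf hθ x).prodMk (stronglyMeasurable_fX hA hf hθ x))

theorem stronglyMeasurable_normXX (x : X) : StronglyMeasurable (normXX f A θ x) := by
  refine stronglyMeasurable_clm_of_apply fun u => stronglyMeasurable_clm_of_apply fun v => ?_
  have h1 : StronglyMeasurable (fun ξ => fXX f x ξ θ ((A x).symm u)) :=
    stronglyMeasurable_clm_apply_const (stronglyMeasurable_fXX hA hf hθ x) _
  have h2 : StronglyMeasurable (fun ξ => fXX f x ξ θ ((A x).symm u) ((A x).symm v)) :=
    stronglyMeasurable_clm_apply_const h1 _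
  exact isBoundedBilinearMap_apply.continuous.comp_stronglyMeasurable
    ((stronglyMeasurable_A_f hA hf hθ x).prodMk h2)

theorem stronglyMeasurable_comp_f {G : Type*} [TopologicalSpace G] [TopologicalSpace.PseudoMetrizableSpace G]
    {h : X → G} (hh : Continuous h) (x : X) : StronglyMeasurable (fun ξ => h (f x ξ θ)) := by
  have := FiniteDimensional.proper_real E
  exact hh.stronglyMeasurable.comp_measurable (hf.measurable x θ hθ)

theorem stronglyMeasurable_A_fX (x : X) (u : E) :
    StronglyMeasurable (fun ξ => A (f x ξ θ) (fX f x ξ θ u)) :=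
  isBoundedBilinearMap_apply.continuous.comp_stronglyMeasurable
    ((stronglyMeasurable_A_f hA hf hθ x).prodMk (isBoundedBilinearMap_apply.continuous.comp_stronglyMeasurable
      ((stronglyMeasurable_fX hA hf hθ x).prodMk (stronglyMeasurable_const (b := u)))))

variable {e : X → ℝ}

theorem hasFDerivWithinAt_chain (he : ContDiffOn ℝ 2 (extZero e) X) (ξ : Ξ) (x : X) :
    HasFDerivWithinAt (extZero (fun y => e (f y ξ θ))) (chainX f θ e x ξ) X x :=
  hasFDerivWithinAt_comp_map (hasFDerivWithinAt_dX hA he _) (hasFDerivWithinAt_f hA hf hθ x ξ)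

theorem hasFDerivWithinAt_chainX (he : ContDiffOn ℝ 2 (extZero e) X) (ξ : Ξ) (x : X) :
    HasFDerivWithinAt (extZero (fun y => chainX f θ e y ξ)) (chainXX f θ e x ξ) X x := by
  have h1 := hasFDerivWithinAt_comp_map (h := dX e) (hasFDerivWithinAt_dX_dX hA he (f x ξ θ))
    (hasFDerivWithinAt_f hA hf hθ x ξ)
  have h2 := hasFDerivWithinAt_fX hA hf hθ x ξ
  have h3 := h1.clm_comp h2
  rw [extZero_coe, extZero_coe] at h3
  refine HasFDerivWithinAt.congr' h3 (fun y hy => ?_) x.2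
  obtain ⟨y, rfl⟩ : ∃ z : X, (z : E) = y := ⟨⟨y, hy⟩, rfl⟩
  rw [extZero_coe, extZero_coe, extZero_coe, chainX]

theorem continuous_chainX (he : ContDiffOn ℝ 2 (extZero e) X) (ξ : Ξ) :
    Continuous (fun x => chainX f θ e x ξ) :=
  ((continuous_dX hA he).comp (continuous_f_left hA hf hθ ξ)).clm_comp
    (continuous_fX_left hA hf hθ ξ)

theorem continuous_chainXX (he : ContDiffOn ℝ 2 (extZero e) X) (ξ : Ξ) :
    Continuous (fun x => chainXX f θ e x ξ) := by
  have c1 := (continuous_dX hA he).comp (continuous_f_left hA hf hθ ξ)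
  have c2 := (continuous_dX_dX hA he).comp (continuous_f_left hA hf hθ ξ)
  have c3 := continuous_fX_left hA hf hθ ξ
  have c4 := continuous_fXX_left hA hf hθ ξ
  exact (((ContinuousLinearMap.compL ℝ E E ℝ).continuous.comp c1).clm_comp c4).add
    (((ContinuousLinearMap.compL ℝ E E ℝ).flip.continuous.comp c3).clm_comp (c2.clm_comp c3))

theorem stronglyMeasurable_chainX (he : ContDiffOn ℝ 2 (extZero e) X) (x : X) :
    StronglyMeasurable (chainX f θ e x) := by
  have h : Continuous (fun p : (E →L[ℝ] ℝ) × (E →L[ℝ] E) => p.1.comp p.2) :=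
    continuous_fst.clm_comp continuous_snd
  exact h.comp_stronglyMeasurable
    ((stronglyMeasurable_comp_f hA hf hθ (continuous_dX hA he) x).prodMk
      (stronglyMeasurable_fX hA hf hθ x))

theorem stronglyMeasurable_chainXX (he : ContDiffOn ℝ 2 (extZero e) X) (x : X) :
    StronglyMeasurable (chainXX f θ e x) :=
  stronglyMeasurable_of_hasFDerivWithinAt x.2 (hA.uniqueDiffOn x x.2)
    (v := fun y ξ => extZero (fun y => chainX f θ e y ξ) y) (fun y hy => by
      obtain ⟨y, rfl⟩ : ∃ z : X, (z : E) = y := ⟨⟨y, hy⟩, rfl⟩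
      simp only [extZero_coe]
      exact stronglyMeasurable_chainX hA hf hθ he y)
    fun ξ => hasFDerivWithinAt_chainX hA hf hθ he ξ x

variable [IsProbabilityMeasure ν] {n₁ n₂ : ℝ}

theorem integrable_dA_f (x : X) : Integrable (fun ξ => dA A x (f x ξ θ)) ν := by
  have := FiniteDimensional.complete ℝ E
  refine Integrable.mono' ((integrable_const (1 : ℝ)).add (hf.integrable x θ hθ))
    ((stronglyMeasurable_comp_f hA hf hθ ((continuous_dA hA).comp
      (continuous_const.prodMk continuous_id)) x).aestronglyMeasurable)
    (ae_of_all _ fun ξ => ?_)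
  rw [Real.norm_of_nonneg (dA_nonneg _ _)]
  simp only [Pi.add_apply]
  nlinarith [sq_nonneg (dA A x (f x ξ θ) - 1)]

theorem integrable_comp_f (he : CostBound A e n₁ n₂) (x : X) :
    Integrable (fun ξ => e (f x ξ θ)) ν := by
  have := FiniteDimensional.complete ℝ E
  refine Integrable.mono' ((integrable_const |e x|).add ((integrable_dA_f hA hf hθ x).const_mul n₁))
    (stronglyMeasurable_comp_f hA hf hθ
      (continuous_of_contDiffOn hA he.contDiff) x).aestronglyMeasurable
    (ae_of_all _ fun ξ => ?_)
  have h1 := he.lipschitz hA (f x ξ θ) x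
  rw [dA_comm hA.convex] at h1
  have h2 := abs_add_le (e (f x ξ θ) - e x) (e x)
  rw [sub_add_cancel] at h2
  simp only [Pi.add_apply, Real.norm_eq_abs]
  linarith

variable {K : ℝ} (hL : BoundConditions ν Θ f A B K)
include hL

theorem continuous_lintegral_normX :
    Continuous (fun x => ∫⁻ ξ, ‖normX f A θ x ξ‖ₑ ^ 2 ∂ν) ∧
      ∀ x, ∫⁻ ξ, ‖normX f A θ x ξ‖ₑ ^ 2 ∂ν ≠ ⊤ := by
  have e : ∀ x, ∫⁻ ξ, ‖normX f A θ x ξ‖ₑ ^ 2 ∂ν = LX ν f A x θ ^ 2 := by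
    intro x
    rw [LX, ← ENNReal.rpow_natCast, ← ENNReal.rpow_mul, show (1 / 2 : ℝ) * ((2 : ℕ) : ℝ) = 1 by norm_num,
      ENNReal.rpow_one]
    rfl
  simp_rw [e]
  constructor
  · refine (ENNReal.continuous_pow 2).comp ?_
    exact hL.cont_LX.comp_continuous (f := fun x : X => (x, θ)) (by fun_prop)
      fun x => ⟨mem_univ _, hθ⟩
  · exact fun x => ENNReal.pow_ne_top ((hL.bound_LX x θ hθ).trans_lt ENNReal.ofReal_lt_top).ne

theorem continuous_lintegral_normXX :
    Continuous (fun x => ∫⁻ ξ, ‖normXX f A θ x ξ‖ₑ ∂ν) ∧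
      ∀ x, ∫⁻ ξ, ‖normXX f A θ x ξ‖ₑ ∂ν ≠ ⊤ := by
  constructor
  · exact hL.cont_LXX.comp_continuous (f := fun x : X => (x, θ)) (by fun_prop)
      fun x => ⟨mem_univ _, hθ⟩
  · obtain ⟨K', hK'⟩ := hL.bound_LXX
    exact fun x => ((hK' x θ hθ).trans_lt ENNReal.ofReal_lt_top).ne

/-- Dominated convergence with a moving majorant, whose integral is continuous because `L_X` and `A`
are. -/
theorem chainX_L1 (he : CostBound A e n₁ n₂) :
    (∀ x, Integrable (chainX f θ e x) ν) ∧
    ∀ x, Tendsto (fun y => ∫⁻ ξ, ‖chainX f θ e y ξ - chainX f θ e x ξ‖ₑ ∂ν) (𝓝 x) (𝓝 0) := by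
  obtain ⟨hc, ht⟩ := continuous_lintegral_normX hA hf hθ hL
  let D : X → Ξ → ℝ≥0∞ := fun x ξ =>
    ENNReal.ofReal n₁ * (1 + ‖normX f A θ x ξ‖ₑ ^ 2) * ‖(A x : E →L[ℝ] E)‖ₑ
  have hDle : ∀ x ξ, ‖chainX f θ e x ξ‖ₑ ≤ D x ξ := fun x ξ => enorm_chainX_le he θ x ξ
  have hDm : ∀ x, AEMeasurable (D x) ν := fun x =>
    ((((stronglyMeasurable_normX hA hf hθ x).enorm.pow_const 2).const_add 1).const_mul _
      |>.mul_const _).aemeasurable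
  have hint : ∀ x, ∫⁻ ξ, D x ξ ∂ν =
      ENNReal.ofReal n₁ * (1 + ∫⁻ ξ, ‖normX f A θ x ξ‖ₑ ^ 2 ∂ν) * ‖(A x : E →L[ℝ] E)‖ₑ := by
    intro x
    rw [lintegral_mul_const' _ _ (by simp), lintegral_const_mul' _ _ (by simp),
      lintegral_add_left measurable_const]
    simp
  have hfin : ∀ x, ∫⁻ ξ, D x ξ ∂ν ≠ ⊤ := fun x => by
    rw [hint]
    exact ENNReal.mul_ne_top (ENNReal.mul_ne_top (by simp) (ENNReal.add_ne_top.2 ⟨by simp, ht x⟩))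
      (by simp)
  constructor
  · intro x
    refine ⟨(stronglyMeasurable_chainX hA hf hθ he.contDiff x).aestronglyMeasurable, ?_⟩
    exact (lintegral_mono (hDle x)).trans_lt (lt_top_iff_ne_top.2 (hfin x))
  · refine tendsto_lintegral_enorm_sub (fun ξ => continuous_chainX hA hf hθ he.contDiff ξ)
      (fun x => stronglyMeasurable_chainX hA hf hθ he.contDiff x) hDle (fun ξ => ?_) hDm ?_ hfin
    · refine continuous_ennreal_mul ((ENNReal.continuous_const_mul (by simp)).comp
        (continuous_const.add ((ENNReal.continuous_pow 2).comp
          (continuous_normX hA hf hθ ξ).enorm))) hA.continuous.enorm (fun x => ?_) (by simp)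
      exact ENNReal.mul_ne_top (by simp) (ENNReal.add_ne_top.2 ⟨by simp, by simp⟩)
    · simp_rw [hint]
      refine continuous_ennreal_mul ((ENNReal.continuous_const_mul (by simp)).comp
        (continuous_const.add hc)) hA.continuous.enorm (fun x => ?_) (by simp)
      exact ENNReal.mul_ne_top (by simp) (ENNReal.add_ne_top.2 ⟨by simp, ht x⟩)

/-- The same argument one order higher: `L_{X²}` controls the term with `∂²f/∂x²`, and `L_X²` the
term quadratic in `∂f/∂x`. -/
theorem chainXX_L1 (he : CostBound A e n₁ n₂) :
    (∀ x, Integrable (chainXX f θ e x) ν) ∧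
    ∀ x, Tendsto (fun y => ∫⁻ ξ, ‖chainXX f θ e y ξ - chainXX f θ e x ξ‖ₑ ∂ν) (𝓝 x) (𝓝 0) := by
  obtain ⟨hc, ht⟩ := continuous_lintegral_normX hA hf hθ hL
  obtain ⟨hc', ht'⟩ := continuous_lintegral_normXX hA hf hθ hL
  let D : X → Ξ → ℝ≥0∞ := fun x ξ => (ENNReal.ofReal n₁ * ‖normXX f A θ x ξ‖ₑ +
      ENNReal.ofReal n₂ * ‖normX f A θ x ξ‖ₑ ^ 2) * ‖(A x : E →L[ℝ] E)‖ₑ ^ 2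
  have hDle : ∀ x ξ, ‖chainXX f θ e x ξ‖ₑ ≤ D x ξ := fun x ξ => enorm_chainXX_le he θ x ξ
  have hDm1 : ∀ x, Measurable (fun ξ => ENNReal.ofReal n₁ * ‖normXX f A θ x ξ‖ₑ) := fun x =>
    (stronglyMeasurable_normXX hA hf hθ x).enorm.const_mul _
  have hDm2 : ∀ x, Measurable (fun ξ => ENNReal.ofReal n₂ * ‖normX f A θ x ξ‖ₑ ^ 2) := fun x =>
    ((stronglyMeasurable_normX hA hf hθ x).enorm.pow_const 2).const_mul _
  have hDm : ∀ x, AEMeasurable (D x) ν := fun x =>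
    (((hDm1 x).add (hDm2 x)).mul_const _).aemeasurable
  have hint : ∀ x, ∫⁻ ξ, D x ξ ∂ν = (ENNReal.ofReal n₁ * ∫⁻ ξ, ‖normXX f A θ x ξ‖ₑ ∂ν +
      ENNReal.ofReal n₂ * ∫⁻ ξ, ‖normX f A θ x ξ‖ₑ ^ 2 ∂ν) * ‖(A x : E →L[ℝ] E)‖ₑ ^ 2 := by
    intro x
    rw [lintegral_mul_const' _ _ (by simp), lintegral_add_left (hDm1 x),
      lintegral_const_mul' _ _ (by simp), lintegral_const_mul' _ _ (by simp)]
  have hfin1 : ∀ x, ENNReal.ofReal n₁ * ∫⁻ ξ, ‖normXX f A θ x ξ‖ₑ ∂ν +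
      ENNReal.ofReal n₂ * ∫⁻ ξ, ‖normX f A θ x ξ‖ₑ ^ 2 ∂ν ≠ ⊤ := fun x =>
    ENNReal.add_ne_top.2 ⟨ENNReal.mul_ne_top (by simp) (ht' x), ENNReal.mul_ne_top (by simp) (ht x)⟩
  have hfin : ∀ x, ∫⁻ ξ, D x ξ ∂ν ≠ ⊤ := fun x => by
    rw [hint]
    exact ENNReal.mul_ne_top (hfin1 x) (by simp)
  have hA2 : Continuous (fun x => ‖(A x : E →L[ℝ] E)‖ₑ ^ 2) :=
    (ENNReal.continuous_pow 2).comp hA.continuous.enorm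
  constructor
  · intro x
    refine ⟨(stronglyMeasurable_chainXX hA hf hθ he.contDiff x).aestronglyMeasurable, ?_⟩
    exact (lintegral_mono (hDle x)).trans_lt (lt_top_iff_ne_top.2 (hfin x))
  · refine tendsto_lintegral_enorm_sub (fun ξ => continuous_chainXX hA hf hθ he.contDiff ξ)
      (fun x => stronglyMeasurable_chainXX hA hf hθ he.contDiff x) hDle (fun ξ => ?_) hDm ?_ hfin
    · refine continuous_ennreal_mul (((ENNReal.continuous_const_mul (by simp)).comp
        (continuous_normXX hA hf hθ ξ).enorm).add ((ENNReal.continuous_const_mul (by simp)).comp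
        ((ENNReal.continuous_pow 2).comp (continuous_normX hA hf hθ ξ).enorm))) hA2
        (fun x => ?_) (by simp)
      exact ENNReal.add_ne_top.2 ⟨ENNReal.mul_ne_top (by simp) (by simp),
        ENNReal.mul_ne_top (by simp) (by simp)⟩
    · simp_rw [hint]
      exact continuous_ennreal_mul (((ENNReal.continuous_const_mul (by simp)).comp hc').add
        ((ENNReal.continuous_const_mul (by simp)).comp hc)) hA2 hfin1 (by simp)

theorem hasFDerivWithinAt_meanOp (he : CostBound A e n₁ n₂) (x : X) :
    HasFDerivWithinAt (extZero (meanOp ν f θ e)) (∫ ξ, chainX f θ e x ξ ∂ν) X x :=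
  hasFDerivWithinAt_integral hA.convex (u := fun x ξ => e (f x ξ θ))
    (fun ξ x => hasFDerivWithinAt_chain hA hf hθ he.contDiff ξ x)
    (fun ξ => continuous_chainX hA hf hθ he.contDiff ξ)
    (fun x => stronglyMeasurable_chainX hA hf hθ he.contDiff x)
    (fun x => integrable_comp_f hA hf hθ he x) (chainX_L1 hA hf hθ hL he).1
    (chainX_L1 hA hf hθ hL he).2 x

theorem dX_meanOp (he : CostBound A e n₁ n₂) :
    dX (meanOp ν f θ e) = fun x => ∫ ξ, chainX f θ e x ξ ∂ν :=
  funext fun x => dX_eq hA (hasFDerivWithinAt_meanOp hA hf hθ hL he x)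

theorem hasFDerivWithinAt_integral_chainX (he : CostBound A e n₁ n₂) (x : X) :
    HasFDerivWithinAt (extZero (fun x => ∫ ξ, chainX f θ e x ξ ∂ν))
      (∫ ξ, chainXX f θ e x ξ ∂ν) X x := by
  have := FiniteDimensional.complete ℝ E
  exact hasFDerivWithinAt_integral hA.convex (u := fun x ξ => chainX f θ e x ξ)
    (fun ξ x => hasFDerivWithinAt_chainX hA hf hθ he.contDiff ξ x)
    (fun ξ => continuous_chainXX hA hf hθ he.contDiff ξ)
    (fun x => stronglyMeasurable_chainXX hA hf hθ he.contDiff x)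
    (chainX_L1 hA hf hθ hL he).1 (chainXX_L1 hA hf hθ hL he).1
    (chainXX_L1 hA hf hθ hL he).2 x

theorem dX_dX_meanOp (he : CostBound A e n₁ n₂) :
    dX (dX (meanOp ν f θ e)) = fun x => ∫ ξ, chainXX f θ e x ξ ∂ν := by
  rw [dX_meanOp hA hf hθ hL he]
  exact funext fun x => dX_eq hA (hasFDerivWithinAt_integral_chainX hA hf hθ hL he x)

theorem contDiffOn_meanOp (he : CostBound A e n₁ n₂) :
    ContDiffOn ℝ 2 (extZero (meanOp ν f θ e)) X :=
  contDiffOn_two_of_hasFDerivWithinAt hA (hasFDerivWithinAt_meanOp hA hf hθ hL he)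
    (hasFDerivWithinAt_integral_chainX hA hf hθ hL he)
    (continuous_integral_of_tendsto (chainXX_L1 hA hf hθ hL he).1 (chainXX_L1 hA hf hθ hL he).2)

/-- The transition kernel contracts the first derivative of a cost. -/
theorem CostBound.meanOp {L : ℝ} (hS : SysBounds ν Θ f A B K L) (he : CostBound A e n₁ n₂) :
    CostBound A (meanOp ν f θ e) (K * n₁) (K ^ 2 * n₂ + L * n₁) := by
  have hn1 := he.nonneg₁
  have hn2 := he.nonneg₂
  have hK := hS.K_nonneg
  have hL0 := hS.L_nonneg
  have ofr : ∀ y w, ‖dX e y w‖ₑ ≤ ENNReal.ofReal n₁ * ‖A y w‖ₑ := fun y w => by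
    rw [← ofReal_norm, ← ofReal_norm, ← ENNReal.ofReal_mul hn1]
    exact ENNReal.ofReal_le_ofReal (he.bound₁ y w)
  have ofr2 : ∀ y w w', ‖dX (dX e) y w w'‖ₑ ≤ ENNReal.ofReal n₂ * (‖A y w‖ₑ * ‖A y w'‖ₑ) :=
    fun y w w' => by
    rw [← ofReal_norm, ← ofReal_norm, ← ofReal_norm, ← ENNReal.ofReal_mul (norm_nonneg _),
      ← ENNReal.ofReal_mul hn2, ← mul_assoc]
    exact ENNReal.ofReal_le_ofReal (he.bound₂ y w w')
  refine ⟨contDiffOn_meanOp hA hf hθ hL he, by positivity, by positivity, fun x u => ?_,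
    fun x u v => ?_⟩
  · rw [dX_meanOp hA hf hθ hL he, ContinuousLinearMap.integral_apply ((chainX_L1 hA hf hθ hL he).1 x),
      ← Real.norm_eq_abs, ← enorm_le_ofReal_iff (by positivity)]
    refine (enorm_integral_le_lintegral_enorm _).trans ?_
    calc ∫⁻ ξ, ‖chainX f θ e x ξ u‖ₑ ∂ν
        ≤ ∫⁻ ξ, ENNReal.ofReal n₁ * ‖A (f x ξ θ) (fX f x ξ θ u)‖ₑ ∂ν :=
          lintegral_mono fun ξ => ofr _ _
      _ = ENNReal.ofReal n₁ * ∫⁻ ξ, ‖A (f x ξ θ) (fX f x ξ θ u)‖ₑ ∂ν :=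
          lintegral_const_mul' _ _ (by simp)
      _ ≤ ENNReal.ofReal n₁ * ENNReal.ofReal (K * ‖A x u‖) := by
          gcongr
          exact lintegral_le_of_sq_le (stronglyMeasurable_A_fX hA hf hθ x u).enorm.aemeasurable
            (hS.sqX x θ hθ u)
      _ = _ := by
          rw [← ENNReal.ofReal_mul hn1]; congr 1; ring
  · rw [dX_dX_meanOp hA hf hθ hL he, ContinuousLinearMap.integral_apply ((chainXX_L1 hA hf hθ hL he).1 x),
      ContinuousLinearMap.integral_apply
        (((chainXX_L1 hA hf hθ hL he).1 x).apply_continuousLinearMap u),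
      ← Real.norm_eq_abs, ← enorm_le_ofReal_iff (by positivity)]
    refine (enorm_integral_le_lintegral_enorm _).trans ?_
    have m1 := (stronglyMeasurable_A_fX hA hf hθ x u).enorm.aemeasurable (μ := ν)
    have m2 := (stronglyMeasurable_A_fX hA hf hθ x v).enorm.aemeasurable (μ := ν)
    calc ∫⁻ ξ, ‖chainXX f θ e x ξ u v‖ₑ ∂ν
        ≤ ∫⁻ ξ, (ENNReal.ofReal n₁ * ‖A (f x ξ θ) (fXX f x ξ θ u v)‖ₑ + ENNReal.ofReal n₂ *
          (‖A (f x ξ θ) (fX f x ξ θ u)‖ₑ * ‖A (f x ξ θ) (fX f x ξ θ v)‖ₑ)) ∂ν :=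
          lintegral_mono fun ξ => (enorm_add_le _ _).trans (add_le_add (ofr _ _) (ofr2 _ _ _))
      _ = ENNReal.ofReal n₁ * ∫⁻ ξ, ‖A (f x ξ θ) (fXX f x ξ θ u v)‖ₑ ∂ν + ENNReal.ofReal n₂ *
          ∫⁻ ξ, ‖A (f x ξ θ) (fX f x ξ θ u)‖ₑ * ‖A (f x ξ θ) (fX f x ξ θ v)‖ₑ ∂ν := by
          rw [lintegral_add_right' _ (show AEMeasurable (fun ξ => ENNReal.ofReal n₂ *
            (‖A (f x ξ θ) (fX f x ξ θ u)‖ₑ * ‖A (f x ξ θ) (fX f x ξ θ v)‖ₑ)) ν from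
            (m1.mul m2).const_mul _), lintegral_const_mul' _ _ (by simp),
            lintegral_const_mul' _ _ (by simp)]
      -- The second derivative of the cost meets two factors `∂f/∂x`, so Cauchy–Schwarz is applied.
      -- This is why `L_X` must be a mean-square quantity, and it produces the factor `K²`.
      _ ≤ ENNReal.ofReal n₁ * ENNReal.ofReal (L * ‖A x u‖ * ‖A x v‖) + ENNReal.ofReal n₂ *
          (ENNReal.ofReal (K * ‖A x u‖) * ENNReal.ofReal (K * ‖A x v‖)) := by
          gcongr
          · exact hS.XX x θ hθ u v
          · exact lintegral_mul_le_of_sq_le m1 m2 (hS.sqX x θ hθ u) (hS.sqX x θ hθ v)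
      _ = _ := by
          rw [← ENNReal.ofReal_mul (p := K * ‖A x u‖) (by positivity), ← ENNReal.ofReal_mul hn1,
            ← ENNReal.ofReal_mul hn2, ← ENNReal.ofReal_add (by positivity) (by positivity)]
          congr 1; ring

end

end TransitionOnCosts
end StationaryDiff
end

open MeasureTheory ProbabilityTheory Set Filter Topology
open scoped ENNReal

noncomputable section

namespace StationaryDiff

/-! ### Expansion of the transition operator in the parameter. -/

section ParameterDerivative

set_option linter.unusedSectionVars false
set_option maxSynthPendingDepth 3

variable {E F Ξ : Type*} [NormedAddCommGroup E] [NormedSpace ℝ E]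
  [NormedAddCommGroup F] [NormedSpace ℝ F] {X : Set E} {A : X → E ≃L[ℝ] E} {B : X → F ≃L[ℝ] F}
  [MeasurableSpace Ξ] {ν : Measure Ξ} [IsProbabilityMeasure ν] {Θ : Set F} {f : X → Ξ → F → X}

/-- The derivative of `θ ↦ e (f x ξ θ)`. -/
def chainΘ (f : X → Ξ → F → X) (θ : F) (e : X → ℝ) (x : X) (ξ : Ξ) : F →L[ℝ] ℝ :=
  (dX e (f x ξ θ)).comp (fΘ f x ξ θ)

/-- The derivative of `θ ↦ meanOp ν f θ e x`. -/
def meanDeriv (ν : Measure Ξ) (f : X → Ξ → F → X) (θ : F) (e : X → ℝ) (x : X) : F →L[ℝ] ℝ :=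
  ∫ ξ, chainΘ f θ e x ξ ∂ν

theorem CostBound.enorm₁ {e : X → ℝ} {n₁ n₂ : ℝ} (he : CostBound A e n₁ n₂) (y : X) (w : E) :
    ‖dX e y w‖ₑ ≤ ENNReal.ofReal n₁ * ‖A y w‖ₑ := by
  rw [← ofReal_norm, ← ofReal_norm, ← ENNReal.ofReal_mul he.nonneg₁]
  exact ENNReal.ofReal_le_ofReal (he.bound₁ y w)

theorem CostBound.enorm₂ {e : X → ℝ} {n₁ n₂ : ℝ} (he : CostBound A e n₁ n₂) (y : X) (w w' : E) :
    ‖dX (dX e) y w w'‖ₑ ≤ ENNReal.ofReal n₂ * (‖A y w‖ₑ * ‖A y w'‖ₑ) := by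
  rw [← ofReal_norm, ← ofReal_norm, ← ofReal_norm, ← ENNReal.ofReal_mul (norm_nonneg _),
    ← ENNReal.ofReal_mul he.nonneg₂, ← mul_assoc]
  exact ENNReal.ofReal_le_ofReal (he.bound₂ y w w')

variable [MeasurableSpace E] [BorelSpace E] [FiniteDimensional ℝ E] [FiniteDimensional ℝ F]
  (hA : FinslerConditions X A) (hf : SystemConditions ν Θ f A)
  {K L : ℝ} (hS : SysBounds ν Θ f A B K L) {e : X → ℝ} {n₁ n₂ : ℝ} (he : CostBound A e n₁ n₂)
include hA hf

theorem stronglyMeasurable_A_apply {θ : F} (hθ : θ ∈ Θ) (x : X) {w : Ξ → E}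
    (hw : StronglyMeasurable w) : StronglyMeasurable (fun ξ => A (f x ξ θ) (w ξ)) :=
  isBoundedBilinearMap_apply.continuous.comp_stronglyMeasurable
    ((stronglyMeasurable_A_f hA hf hθ x).prodMk hw)

theorem stronglyMeasurable_dX_apply {θ : F} (hθ : θ ∈ Θ) (x : X) {w : Ξ → E}
    (hw : StronglyMeasurable w) (he : CostBound A e n₁ n₂) :
    StronglyMeasurable (fun ξ => dX e (f x ξ θ) (w ξ)) :=
  isBoundedBilinearMap_apply.continuous.comp_stronglyMeasurable
    ((stronglyMeasurable_comp_f hA hf hθ (continuous_dX hA he.contDiff) x).prodMk hw)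

theorem stronglyMeasurable_dX_dX_apply {θ : F} (hθ : θ ∈ Θ) (x : X) {w w' : Ξ → E}
    (hw : StronglyMeasurable w) (hw' : StronglyMeasurable w') (he : CostBound A e n₁ n₂) :
    StronglyMeasurable (fun ξ => dX (dX e) (f x ξ θ) (w ξ) (w' ξ)) := by
  have h1 : StronglyMeasurable (fun ξ => dX (dX e) (f x ξ θ) (w ξ)) :=
    isBoundedBilinearMap_apply.continuous.comp_stronglyMeasurable
      ((stronglyMeasurable_comp_f hA hf hθ (continuous_dX_dX hA he.contDiff) x).prodMk hw)
  exact isBoundedBilinearMap_apply.continuous.comp_stronglyMeasurable (h1.prodMk hw')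

variable {U : Set F} (hU : Convex ℝ U) (hUΘ : U ⊆ Θ)
include hS he hU hUΘ

/-- Mean-value estimate for `η ↦ De(f x ξ η) w(η, ξ)`. -/
theorem lintegral_dX_param_sub_le (x : X) {w : F → Ξ → E} {w' : F → Ξ → F →L[ℝ] E}
    (hd : ∀ η ∈ U, ∀ ξ, HasFDerivAt (fun η => w η ξ) (w' η ξ) η)
    (hc : ∀ ξ, ContinuousOn (fun η => w' η ξ) U)
    (hm : ∀ η ∈ U, StronglyMeasurable (w η)) (hm' : ∀ η ∈ U, StronglyMeasurable (w' η))
    {a b : ℝ} (ha : 0 ≤ a) (hb : 0 ≤ b) (θ θ' : U)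
    (hwa : ∀ η ∈ U, ∫⁻ ξ, ‖A (f x ξ η) (w η ξ)‖ₑ ^ 2 ∂ν ≤ ENNReal.ofReal a ^ 2)
    (hwb : ∀ η ∈ U, ∫⁻ ξ, ‖A (f x ξ η) (w' η ξ ((θ' : F) - θ))‖ₑ ∂ν ≤ ENNReal.ofReal b) :
    ∫⁻ ξ, ‖dX e (f x ξ θ') (w θ' ξ) - dX e (f x ξ θ) (w θ ξ)‖ₑ ∂ν ≤
      ENNReal.ofReal (n₂ * (L * ‖B x ((θ' : F) - θ)‖ * a) + n₁ * b) := by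
  have hn1 := he.nonneg₁
  have hn2 := he.nonneg₂
  have hL0 := hS.L_nonneg
  let σ := segCurve hU θ θ'
  have hσ : ∀ t, (σ t : F) ∈ Θ := fun t => hUΘ (σ t).2
  have hσc : Continuous (fun t => (σ t : F)) :=
    continuous_subtype_val.comp (continuous_segCurve hU θ θ')
  let Δ : F := θ' - θ
  have cf : ∀ ξ, Continuous (fun t => f x ξ (σ t)) := fun ξ =>
    (continuousOn_f_right hA hf x ξ).comp_continuous hσc hσ
  have cΘ : ∀ ξ, Continuous (fun t => fΘ f x ξ (σ t) Δ) := fun ξ =>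
    ((continuousOn_fΘ_right hA hf x ξ).comp_continuous hσc hσ).clm_apply continuous_const
  have cw : ∀ ξ, Continuous (fun t => w (σ t) ξ) := fun ξ =>
    ContinuousOn.comp_continuous (f := fun t => (σ t : F)) (s := U) (g := fun η => w η ξ)
      (fun η hη => (hd η hη ξ).continuousAt.continuousWithinAt) hσc fun t => (σ t).2
  have cw' : ∀ ξ, Continuous (fun t => w' (σ t) ξ Δ) := fun ξ =>
    ((hc ξ).comp_continuous hσc fun t => (σ t).2).clm_apply continuous_const
  -- Product rule along the segment: `D²e` applied to `(∂f/∂θ) Δ` and `w`, plus `De` applied to `w'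
  -- Δ`. Cauchy–Schwarz bounds the first term by `n₂ (L ‖B x Δ‖) a`, and the second is at most `n₁
  -- b`.
  have key := lintegral_enorm_sub_le_of_hasDerivWithinAt (ν := ν)
    (c := fun t ξ => dX e (f x ξ (σ t)) (w (σ t) ξ))
    (c' := fun t ξ => dX (dX e) (f x ξ (σ t)) (fΘ f x ξ (σ t) Δ) (w (σ t) ξ) +
      dX e (f x ξ (σ t)) (w' (σ t) ξ Δ))
    (M := ENNReal.ofReal (n₂ * (L * ‖B x Δ‖ * a) + n₁ * b)) ?_ ?_ ?_ ?_
  · simpa only [σ, segCurve_one, segCurve_zero] using key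
  · intro ξ t ht
    have h1 := hasDerivWithinAt_comp_curve (h := dX e)
      (hasFDerivWithinAt_dX_dX hA he.contDiff (f x ξ (σ t)))
      (hasDerivWithinAt_f_seg hA hf hU hUΘ x ξ θ θ' ht)
    have h2 : HasDerivWithinAt (fun s => w (σ s) ξ) (w' (σ t) ξ Δ) (Icc 0 1) t :=
      HasFDerivAt.comp_hasDerivWithinAt (l := fun η : F => w η ξ) t
        (hd (σ t) (σ t).2 ξ) (hasDerivWithinAt_segCurve hU θ θ' ht)
    exact h1.clm_apply h2
  · intro ξ
    have c1 := (continuous_dX hA he.contDiff).comp (cf ξ)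
    have c2 := (continuous_dX_dX hA he.contDiff).comp (cf ξ)
    exact (((c2.clm_apply (cΘ ξ)).clm_apply (cw ξ)).add (c1.clm_apply (cw' ξ))).continuousOn
  · intro t _
    exact (stronglyMeasurable_dX_dX_apply hA hf (hσ t) x
      (stronglyMeasurable_clm_apply_const (stronglyMeasurable_fΘ hA hf (hσ t) x) Δ)
      (hm _ (σ t).2) he).add (stronglyMeasurable_dX_apply hA hf (hσ t) x
        (stronglyMeasurable_clm_apply_const (hm' _ (σ t).2) Δ) he)
  · intro t _
    have m1 := (stronglyMeasurable_A_apply hA hf (hσ t) x (stronglyMeasurable_clm_apply_const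
      (stronglyMeasurable_fΘ hA hf (hσ t) x) Δ)).enorm.aemeasurable (μ := ν)
    have m2 := (stronglyMeasurable_A_apply hA hf (hσ t) x (hm _ (σ t).2)).enorm.aemeasurable (μ := ν)
    calc _ ≤ ∫⁻ ξ, (ENNReal.ofReal n₂ *
          (‖A (f x ξ (σ t)) (fΘ f x ξ (σ t) Δ)‖ₑ * ‖A (f x ξ (σ t)) (w (σ t) ξ)‖ₑ) +
          ENNReal.ofReal n₁ * ‖A (f x ξ (σ t)) (w' (σ t) ξ Δ)‖ₑ) ∂ν :=
          lintegral_mono fun ξ => (enorm_add_le _ _).trans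
            (add_le_add (he.enorm₂ _ _ _) (he.enorm₁ _ _))
      _ = ENNReal.ofReal n₂ *
          ∫⁻ ξ, ‖A (f x ξ (σ t)) (fΘ f x ξ (σ t) Δ)‖ₑ * ‖A (f x ξ (σ t)) (w (σ t) ξ)‖ₑ ∂ν +
          ENNReal.ofReal n₁ * ∫⁻ ξ, ‖A (f x ξ (σ t)) (w' (σ t) ξ Δ)‖ₑ ∂ν := by
          rw [lintegral_add_left' (show AEMeasurable (fun ξ => ENNReal.ofReal n₂ *
            (‖A (f x ξ (σ t)) (fΘ f x ξ (σ t) Δ)‖ₑ * ‖A (f x ξ (σ t)) (w (σ t) ξ)‖ₑ)) ν from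
            (m1.mul m2).const_mul _), lintegral_const_mul' _ _ (by simp),
            lintegral_const_mul' _ _ (by simp)]
      _ ≤ ENNReal.ofReal n₂ * (ENNReal.ofReal (L * ‖B x Δ‖) * ENNReal.ofReal a) +
          ENNReal.ofReal n₁ * ENNReal.ofReal b := by
          gcongr
          · exact lintegral_mul_le_of_sq_le m1 m2 (hS.sqΘ x _ (hσ t) Δ) (hwa _ (σ t).2)
          · exact hwb _ (σ t).2
      _ = _ := by
          rw [← ENNReal.ofReal_mul (by positivity), ← ENNReal.ofReal_mul hn1,
            ← ENNReal.ofReal_mul hn2, ← ENNReal.ofReal_add (by positivity) (by positivity)]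

/-- The mean value estimate with `w = (∂f/∂θ) v`. It makes the remainder of the expansion in `θ`
quadratic. -/
theorem lintegral_chainΘ_sub_le (x : X) (θ θ' : U) (v : F) :
    ∫⁻ ξ, ‖chainΘ f θ' e x ξ v - chainΘ f θ e x ξ v‖ₑ ∂ν ≤
      ENNReal.ofReal ((n₂ * L ^ 2 + n₁ * L) * ‖B x ((θ' : F) - θ)‖ * ‖B x v‖) := by
  have hL0 := hS.L_nonneg
  refine (lintegral_dX_param_sub_le hA hf hS he hU hUΘ x (w := fun η ξ => fΘ f x ξ η v)
    -- The flip puts the direction of differentiation last, since `v` is held fixed.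
    (w' := fun η ξ => (fΘΘ f x ξ η).flip v) (a := L * ‖B x v‖)
    (b := L * ‖B x ((θ' : F) - θ)‖ * ‖B x v‖) (fun η hη ξ => ?_) (fun ξ => ?_) (fun η hη => ?_)
    (fun η hη => ?_) (by positivity) (by positivity) θ θ' (fun η hη => ?_) (fun η hη => ?_)).trans
    (le_of_eq ?_)
  · exact ((ContinuousLinearMap.apply ℝ E v).hasFDerivAt.comp η (hasFDerivAt_fΘ hA hf (hUΘ hη) x ξ))
  · exact ((ContinuousLinearMap.flipₗᵢ ℝ F F E).continuous.comp_continuousOn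
      ((continuousOn_fΘΘ_right hA hf x ξ).mono hUΘ)).clm_apply continuousOn_const
  · exact stronglyMeasurable_clm_apply_const (stronglyMeasurable_fΘ hA hf (hUΘ hη) x) v
  · exact stronglyMeasurable_clm_apply_const
      ((ContinuousLinearMap.flipₗᵢ ℝ F F E).continuous.comp_stronglyMeasurable
        (stronglyMeasurable_fΘΘ hA hf (hUΘ hη) x)) v
  · exact hS.sqΘ x η (hUΘ hη) v
  · exact hS.ΘΘ x η (hUΘ hη) _ v
  · congr 1; ring

/-- The mean value estimate with `w = (∂f/∂x) u`. It bounds the `x`-derivative of the change of the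
transition operator, as the cross remainder requires. -/
theorem lintegral_chainX_sub_le (x : X) (θ θ' : U) (u : E) :
    ∫⁻ ξ, ‖chainX f θ' e x ξ u - chainX f θ e x ξ u‖ₑ ∂ν ≤
      ENNReal.ofReal ((n₂ * L * K + n₁ * L) * ‖B x ((θ' : F) - θ)‖ * ‖A x u‖) := by
  have hL0 := hS.L_nonneg
  have hK0 := hS.K_nonneg
  refine (lintegral_dX_param_sub_le hA hf hS he hU hUΘ x (w := fun η ξ => fX f x ξ η u)
    (w' := fun η ξ => fXΘ f x ξ η u) (a := K * ‖A x u‖)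
    (b := L * ‖A x u‖ * ‖B x ((θ' : F) - θ)‖) (fun η hη ξ => ?_) (fun ξ => ?_) (fun η hη => ?_)
    (fun η hη => ?_) (by positivity) (by positivity) θ θ' (fun η hη => ?_) (fun η hη => ?_)).trans
    (le_of_eq ?_)
  · exact ((ContinuousLinearMap.apply ℝ E u).hasFDerivAt.comp η (hasFDerivAt_fX hA hf (hUΘ hη) x ξ))
  · exact ((continuousOn_fXΘ_right hA hf x ξ).mono hUΘ).clm_apply continuousOn_const
  · exact stronglyMeasurable_clm_apply_const (stronglyMeasurable_fX hA hf (hUΘ hη) x) u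
  · exact stronglyMeasurable_clm_apply_const (stronglyMeasurable_fXΘ hA hf (hUΘ hη) x) u
  · exact hS.sqX x η (hUΘ hη) u
  · exact hS.XΘ x η (hUΘ hη) u _
  · congr 1; ring

omit hU hUΘ in
theorem lintegral_chainΘ_le {θ : F} (hθ : θ ∈ Θ) (x : X) (v : F) :
    ∫⁻ ξ, ‖chainΘ f θ e x ξ v‖ₑ ∂ν ≤ ENNReal.ofReal (n₁ * L * ‖B x v‖) := by
  have hn1 := he.nonneg₁
  have hL0 := hS.L_nonneg
  have m1 := (stronglyMeasurable_A_apply hA hf hθ x (stronglyMeasurable_clm_apply_const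
      (stronglyMeasurable_fΘ hA hf hθ x) v)).enorm.aemeasurable (μ := ν)
  calc _ ≤ ∫⁻ ξ, ENNReal.ofReal n₁ * ‖A (f x ξ θ) (fΘ f x ξ θ v)‖ₑ ∂ν :=
        lintegral_mono fun ξ => he.enorm₁ _ _
    _ = ENNReal.ofReal n₁ * ∫⁻ ξ, ‖A (f x ξ θ) (fΘ f x ξ θ v)‖ₑ ∂ν :=
        lintegral_const_mul' _ _ (by simp)
    _ ≤ ENNReal.ofReal n₁ * ENNReal.ofReal (L * ‖B x v‖) := by
        gcongr
        exact lintegral_le_of_sq_le m1 (hS.sqΘ x θ hθ v)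
    _ = _ := by rw [← ENNReal.ofReal_mul hn1, mul_assoc]

omit hS hU hUΘ in
theorem stronglyMeasurable_chainΘ {θ : F} (hθ : θ ∈ Θ) (x : X) :
    StronglyMeasurable (chainΘ f θ e x) :=
  stronglyMeasurable_clm_of_apply fun v => stronglyMeasurable_dX_apply hA hf hθ x
    (stronglyMeasurable_clm_apply_const (stronglyMeasurable_fΘ hA hf hθ x) v) he

omit hU hUΘ in
-- The available bounds concern one direction at a time; a finite basis assembles them into
-- integrability of the linear form.
theorem integrable_chainΘ {θ : F} (hθ : θ ∈ Θ) (x : X) : Integrable (chainΘ f θ e x) ν := by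
  have h : ∀ v, Integrable (fun ξ => chainΘ f θ e x ξ v) ν := fun v =>
    ⟨(stronglyMeasurable_clm_apply_const
      (stronglyMeasurable_chainΘ hA hf he hθ x) v).aestronglyMeasurable,
      (lintegral_chainΘ_le hA hf hS he hθ x v).trans_lt ENNReal.ofReal_lt_top⟩
  let b := Module.finBasis ℝ F
  have : chainΘ f θ e x = fun ξ => ∑ i,
      (chainΘ f θ e x ξ (b i)) • (LinearMap.toContinuousLinearMap (b.coord i)) := by
    funext ξ
    ext u
    simp only [sum_apply, FunLike.coe_smul, Pi.smul_apply, smul_eq_mul,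
      LinearMap.coe_toContinuousLinearMap', Module.Basis.coord_apply]
    conv_lhs => rw [← b.sum_repr u]
    rw [map_sum]
    simp only [map_smul, smul_eq_mul, mul_comm]
  rw [this]
  exact integrable_finsetSum _ fun i _ => (h (b i)).smul_const _

omit hU hUΘ in
theorem abs_meanDeriv_le {θ : F} (hθ : θ ∈ Θ) (x : X) (v : F) :
    |meanDeriv ν f θ e x v| ≤ n₁ * L * ‖B x v‖ := by
  have hn1 := he.nonneg₁
  have hL0 := hS.L_nonneg
  rw [meanDeriv, ContinuousLinearMap.integral_apply (integrable_chainΘ hA hf hS he hθ x),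
    ← Real.norm_eq_abs, ← enorm_le_ofReal_iff (by positivity)]
  exact (enorm_integral_le_lintegral_enorm _).trans (lintegral_chainΘ_le hA hf hS he hθ x v)

/-- First-order expansion of `θ ↦ meanOp ν f θ e x` with a quadratic remainder. -/
theorem abs_meanOp_sub_sub_le (x : X) (θ θ' : U) :
    |meanOp ν f θ' e x - meanOp ν f θ e x - meanDeriv ν f θ e x ((θ' : F) - θ)| ≤
      (n₂ * L ^ 2 + n₁ * L) * ‖B x ((θ' : F) - θ)‖ ^ 2 := by
  have hn1 := he.nonneg₁
  have hn2 := he.nonneg₂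
  have hL0 := hS.L_nonneg
  let σ := segCurve hU θ θ'
  have hσ : ∀ t, (σ t : F) ∈ Θ := fun t => hUΘ (σ t).2
  have hσc : Continuous (fun t => (σ t : F)) :=
    continuous_subtype_val.comp (continuous_segCurve hU θ θ')
  let Δ : F := θ' - θ
  have key := lintegral_enorm_sub_le_of_hasDerivWithinAt (ν := ν)
    (c := fun t ξ => e (f x ξ (σ t)) - t * chainΘ f θ e x ξ Δ)
    (c' := fun t ξ => chainΘ f (σ t) e x ξ Δ - chainΘ f θ e x ξ Δ)
    (M := ENNReal.ofReal ((n₂ * L ^ 2 + n₁ * L) * ‖B x Δ‖ ^ 2)) ?_ ?_ ?_ ?_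
  · simp only [σ, segCurve_one, segCurve_zero, one_mul, zero_mul, sub_zero] at key
    have i1 := integrable_comp_f hA hf (hUΘ θ'.2) he x
    have i2 := integrable_comp_f hA hf (hUΘ θ.2) he x
    have i3 : Integrable (fun ξ => chainΘ f θ e x ξ Δ) ν :=
      (integrable_chainΘ hA hf hS he (hUΘ θ.2) x).apply_continuousLinearMap Δ
    have e1 : meanOp ν f θ' e x - meanOp ν f θ e x - meanDeriv ν f θ e x Δ =
        ∫ ξ, (e (f x ξ θ') - chainΘ f θ e x ξ Δ - e (f x ξ θ)) ∂ν := by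
      rw [integral_sub (f := fun ξ => e (f x ξ θ') - chainΘ f θ e x ξ Δ) (i1.sub i3) i2,
        integral_sub i1 i3, meanDeriv,
        ContinuousLinearMap.integral_apply (integrable_chainΘ hA hf hS he (hUΘ θ.2) x), meanOp, meanOp]
      ring
    rw [e1, ← Real.norm_eq_abs, ← enorm_le_ofReal_iff (by positivity)]
    exact (enorm_integral_le_lintegral_enorm _).trans key
  · intro ξ t ht
    have h1 := hasDerivWithinAt_comp_curve (h := e) (hasFDerivWithinAt_dX hA he.contDiff (f x ξ (σ t)))
      (hasDerivWithinAt_f_seg hA hf hU hUΘ x ξ θ θ' ht)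
    have h2 : HasDerivWithinAt (fun s => s * chainΘ f θ e x ξ Δ) (chainΘ f θ e x ξ Δ) (Icc 0 1) t := by
      simpa using (hasDerivWithinAt_id t (Icc (0 : ℝ) 1)).mul_const (chainΘ f θ e x ξ Δ)
    exact h1.sub h2
  · intro ξ
    have c1 := (continuous_dX hA he.contDiff).comp
      ((continuousOn_f_right hA hf x ξ).comp_continuous hσc hσ)
    have c2 := ((continuousOn_fΘ_right hA hf x ξ).comp_continuous hσc hσ).clm_apply
      (continuous_const (y := Δ))
    exact ((c1.clm_apply c2).sub continuous_const).continuousOn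
  · intro t _
    exact (stronglyMeasurable_clm_apply_const (stronglyMeasurable_chainΘ hA hf he (hσ t) x) Δ).sub
      (stronglyMeasurable_clm_apply_const (stronglyMeasurable_chainΘ hA hf he (hUΘ θ.2) x) Δ)
  · intro t ht
    refine (lintegral_chainΘ_sub_le hA hf hS he hU hUΘ x θ (σ t) Δ).trans
      (ENNReal.ofReal_le_ofReal ?_)
    have h1 : ((σ t : F) - θ) = t • Δ := by
      simp only [σ, segCurve_coe hU θ θ' ht, add_sub_cancel_left, Δ]
    rw [h1, map_smul, norm_smul, Real.norm_of_nonneg ht.1, mul_assoc _ (t * _)]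
    -- The increment up to time `t` is `t • Δ`. Using `t ≤ 1` gives up a factor one half, which is
    -- harmless here.
    have : t * ‖B x Δ‖ * ‖B x Δ‖ ≤ 1 * ‖B x Δ‖ * ‖B x Δ‖ := by gcongr; exact ht.2
    rw [one_mul, ← sq ‖B x Δ‖] at this
    exact mul_le_mul_of_nonneg_left this (by positivity)

omit hU hUΘ in
theorem hasFDerivAt_meanOp {θ : F} (hθ : θ ∈ Θ) (x : X) :
    HasFDerivAt (fun η => meanOp ν f η e x) (meanDeriv ν f θ e x) θ := by
  obtain ⟨r, hr, hball⟩ := Metric.isOpen_iff.1 hf.isOpen θ hθ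
  have hq : (fun η => meanOp ν f η e x - meanOp ν f θ e x - meanDeriv ν f θ e x (η - θ))
      =O[𝓝 θ] fun η => ‖η - θ‖ ^ 2 := by
    refine Asymptotics.IsBigO.of_bound ((n₂ * L ^ 2 + n₁ * L) * ‖(B x : F →L[ℝ] F)‖ ^ 2) ?_
    filter_upwards [Metric.ball_mem_nhds θ hr] with η hη
    have h := abs_meanOp_sub_sub_le hA hf hS he (convex_ball θ r) hball x
      ⟨θ, Metric.mem_ball_self hr⟩ ⟨η, hη⟩
    rw [Real.norm_eq_abs]
    refine h.trans ?_
    rw [Real.norm_of_nonneg (by positivity), mul_assoc, ← mul_pow]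
    have hn1 := he.nonneg₁
    have hn2 := he.nonneg₂
    have hL0 := hS.L_nonneg
    gcongr
    exact (B x : F →L[ℝ] F).le_opNorm _
  refine .of_isLittleO (hq.trans_isLittleO ?_)
  have h2 : (fun η : F => ‖η - θ‖ ^ 2) =o[𝓝 θ] fun η => ‖η - θ‖ ^ 1 :=
    (Asymptotics.isLittleO_pow_pow (𝕜 := ℝ) one_lt_two).comp_tendsto (by
      have : Continuous (fun η : F => ‖η - θ‖) := by fun_prop
      simpa using this.tendsto θ)
  simpa using h2

theorem abs_dX_meanOp_sub_le {K' : ℝ} (hL : BoundConditions ν Θ f A B K') (x : X) (θ θ' : U)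
    (u : E) : |dX (meanOp ν f θ' e) x u - dX (meanOp ν f θ e) x u| ≤
      (n₂ * L * K + n₁ * L) * ‖B x ((θ' : F) - θ)‖ * ‖A x u‖ := by
  have hn1 := he.nonneg₁
  have hn2 := he.nonneg₂
  have hL0 := hS.L_nonneg
  have hK0 := hS.K_nonneg
  have i1 := (chainX_L1 hA hf (hUΘ θ'.2) hL he).1 x
  have i2 := (chainX_L1 hA hf (hUΘ θ.2) hL he).1 x
  rw [dX_meanOp hA hf (hUΘ θ'.2) hL he, dX_meanOp hA hf (hUΘ θ.2) hL he,
    ContinuousLinearMap.integral_apply i1, ContinuousLinearMap.integral_apply i2,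
    ← integral_sub (i1.apply_continuousLinearMap u) (i2.apply_continuousLinearMap u),
    ← Real.norm_eq_abs, ← enorm_le_ofReal_iff (by positivity)]
  exact (enorm_integral_le_lintegral_enorm _).trans
    (lintegral_chainX_sub_le hA hf hS he hU hUΘ x θ θ' u)

end ParameterDerivative
end StationaryDiff
end

open MeasureTheory ProbabilityTheory Set Filter Topology
open scoped ENNReal

noncomputable section

namespace StationaryDiff

/-! ### Second moments along the chain and of the weight `‖B‖`. -/

section Moments

set_option linter.unusedSectionVars false
set_option maxSynthPendingDepth 3

variable {E F Ξ : Type*} [NormedAddCommGroup E] [NormedSpace ℝ E]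
  [NormedAddCommGroup F] [NormedSpace ℝ F] {X : Set E} {A : X → E ≃L[ℝ] E} {B : X → F ≃L[ℝ] F}
  [MeasurableSpace Ξ] {ν : Measure Ξ} [IsProbabilityMeasure ν] {Θ : Set F} {f : X → Ξ → F → X}

/-- Writing finite moments as squares of reals lets triangle inequalities in `L²` be iterated as
affine recursions on real numbers. -/
theorem exists_le_ofReal_sq {a : ℝ≥0∞} (ha : a < ⊤) : ∃ s : ℝ, 0 ≤ s ∧ a = ENNReal.ofReal s ^ 2 :=
  ⟨√a.toReal, Real.sqrt_nonneg _, by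
    rw [← ENNReal.ofReal_pow (Real.sqrt_nonneg _), Real.sq_sqrt ENNReal.toReal_nonneg,
      ENNReal.ofReal_toReal ha.ne]⟩

theorem lintegral_sq_le_of_le_add {S : Type*} [MeasurableSpace S] {μ : Measure S}
    {φ g h : S → ℝ≥0∞} (hle : ∀ z, φ z ≤ g z + h z) (hg : AEMeasurable g μ) (hh : AEMeasurable h μ)
    {a b : ℝ≥0∞} (ha : ∫⁻ z, g z ^ 2 ∂μ ≤ a ^ 2) (hb : ∫⁻ z, h z ^ 2 ∂μ ≤ b ^ 2) :
    ∫⁻ z, φ z ^ 2 ∂μ ≤ (a + b) ^ 2 :=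
  (lintegral_mono fun z => pow_le_pow_left' (hle z) 2).trans (lintegral_add_sq_le hg hh ha hb)

/-- One step of a dynamics driven by independent noise: integrate the noise with the state fixed,
then apply the triangle inequality in `L²(μ)`. It serves the moment recursion and the coupling
recursion alike. -/
theorem lintegral_map_prod_sq_le {S S' : Type*} [MeasurableSpace S] [MeasurableSpace S']
    {μ : Measure S} [SFinite μ] {T : S × Ξ → S'} (hT : Measurable T) {g : S' → ℝ≥0∞}
    (hg : Measurable g) {h₁ h₂ : S → ℝ≥0∞} (hm₁ : AEMeasurable h₁ μ) (hm₂ : AEMeasurable h₂ μ)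
    {a b : ℝ≥0∞} (ha : ∫⁻ z, h₁ z ^ 2 ∂μ ≤ a ^ 2) (hb : ∫⁻ z, h₂ z ^ 2 ∂μ ≤ b ^ 2)
    (h : ∀ z, ∫⁻ ξ, g (T (z, ξ)) ^ 2 ∂ν ≤ (h₁ z + h₂ z) ^ 2) :
    ∫⁻ y, g y ^ 2 ∂((μ.prod ν).map T) ≤ (a + b) ^ 2 := by
  rw [lintegral_map (hg.pow_const 2) hT, 
    lintegral_prod (fun p => g (T p) ^ 2) ((hg.pow_const 2).comp hT).aemeasurable]
  exact (lintegral_mono h).trans (lintegral_add_sq_le hm₁ hm₂ ha hb)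

variable [MeasurableSpace E]

/-- Realizes one step of the chain on `X × Ξ`, where Fubini applies and the same noise can drive two
chains. -/
theorem bind_transition {θ : F} (hm : Measurable (fun p : X × Ξ => f p.1 p.2 θ)) (μ : Measure X)
    [SFinite μ] : μ.bind (transition ν f θ) = (μ.prod ν).map (fun p : X × Ξ => f p.1 p.2 θ) := by
  ext s hs
  rw [Measure.bind_apply hs (Kernel.aemeasurable _), Measure.map_apply hm hs,
    Measure.prod_apply (hm hs)]
  refine lintegral_congr fun x => ?_
  have hx : Measurable (fun ξ => f x ξ θ) := hm.comp measurable_prodMk_left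
  rw [transition_apply ν f θ hm, Measure.map_apply hx hs]
  rfl

variable [BorelSpace E] [FiniteDimensional ℝ E]

section

variable (hA : FinslerConditions X A)
include hA

theorem measurable_dA : Measurable (fun z : X × X => dA A z.1 z.2) := by
  have := FiniteDimensional.complete ℝ E
  have := FiniteDimensional.proper_real E
  exact (continuous_dA hA).measurable

theorem measurable_ofReal_dA : Measurable (fun z : X × X => ENNReal.ofReal (dA A z.1 z.2)) :=
  (measurable_dA hA).ennreal_ofReal

theorem measurable_ofReal_dA_comp {T : Type*} [MeasurableSpace T] {g h : T → X}
    (hg : Measurable g) (hh : Measurable h) :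
    Measurable (fun t => ENNReal.ofReal (dA A (g t) (h t))) := by
  have := (measurable_ofReal_dA hA).comp (hg.prodMk hh)
  exact this

theorem measurable_ofReal_dA_left (y : X) : Measurable (fun x => ENNReal.ofReal (dA A x y)) :=
  (measurable_ofReal_dA hA).comp (measurable_id.prodMk measurable_const)

variable {x₀ : X}

omit [BorelSpace E] [FiniteDimensional ℝ E] hA in
theorem exists_moment {μ : Measure X} (hμ : μ ∈ P2A A x₀) :
    ∃ s : ℝ, 0 ≤ s ∧ ∫⁻ x, ENNReal.ofReal (dA A x x₀) ^ 2 ∂μ = ENNReal.ofReal s ^ 2 := by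
  refine exists_le_ofReal_sq (lt_of_eq_of_lt (lintegral_congr fun x => ?_) hμ.2)
  rw [ENNReal.ofReal_pow (dA_nonneg _ _)]

omit [BorelSpace E] [FiniteDimensional ℝ E] hA in
theorem mem_P2A_of_moment {μ : Measure X} [IsProbabilityMeasure μ] {s : ℝ}
    (h : ∫⁻ x, ENNReal.ofReal (dA A x x₀) ^ 2 ∂μ ≤ ENNReal.ofReal s ^ 2) : μ ∈ P2A A x₀ := by
  refine ⟨inferInstance, lt_of_eq_of_lt (lintegral_congr fun x => ?_)
    (h.trans_lt (ENNReal.pow_lt_top ENNReal.ofReal_lt_top))⟩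
  rw [ENNReal.ofReal_pow (dA_nonneg _ _)]

section Weight

variable {C : ℝ} (hB : ∀ x y : X, |‖(B x : F →L[ℝ] F)‖ - ‖(B y : F →L[ℝ] F)‖| ≤ C * dA A x y)
include hB

theorem continuous_norm_B : Continuous (fun x => ‖(B x : F →L[ℝ] F)‖) := by
  have := FiniteDimensional.complete ℝ E
  refine continuous_iff_continuousAt.2 fun x => tendsto_iff_dist_tendsto_zero.2 ?_
  refine squeeze_zero (fun _ => dist_nonneg) (fun y => ?_)
    (by simpa using (tendsto_dA_nhds hA x).const_mul C)
  rw [dist_comm, Real.dist_eq]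
  exact hB x y

omit [MeasurableSpace E] [BorelSpace E] [FiniteDimensional ℝ E] hA in
theorem norm_B_le (x : X) : ‖(B x : F →L[ℝ] F)‖ ≤ ‖(B x₀ : F →L[ℝ] F)‖ + C * dA A x x₀ := by
  have := (abs_le.1 (hB x x₀)).2
  linarith

theorem lintegral_norm_B_sq_le (hC : 0 ≤ C) {μ : Measure X} [IsProbabilityMeasure μ] {s : ℝ}
    (hs : 0 ≤ s) (h : ∫⁻ x, ENNReal.ofReal (dA A x x₀) ^ 2 ∂μ ≤ ENNReal.ofReal s ^ 2) :
    ∫⁻ x, ENNReal.ofReal ‖(B x : F →L[ℝ] F)‖ ^ 2 ∂μ ≤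
      ENNReal.ofReal (‖(B x₀ : F →L[ℝ] F)‖ + C * s) ^ 2 := by
  rw [ENNReal.ofReal_add (norm_nonneg _) (by positivity)]
  refine le_trans (lintegral_mono fun x => pow_le_pow_left'
    (b := ENNReal.ofReal ‖(B x₀ : F →L[ℝ] F)‖ + ENNReal.ofReal (C * dA A x x₀)) ?_ 2) ?_
  · rw [← ENNReal.ofReal_add (norm_nonneg _) (mul_nonneg hC (dA_nonneg _ _))]
    exact ENNReal.ofReal_le_ofReal (norm_B_le hB x)
  · have hm := measurable_ofReal_dA_left hA x₀
    simp_rw [ENNReal.ofReal_mul hC]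
    refine lintegral_add_sq_le aemeasurable_const (hm.const_mul _).aemeasurable
      (by simp) ?_
    simp_rw [mul_pow]
    rw [lintegral_const_mul _ (hm.pow_const 2)]
    gcongr

end Weight

end

section

variable (hA : FinslerConditions X A) (hf : SystemConditions ν Θ f A)
include hA hf

theorem measurable_uncurry_f {θ : F} (hθ : θ ∈ Θ) : Measurable (fun p : X × Ξ => f p.1 p.2 θ) := by
  have := FiniteDimensional.proper_real E
  exact measurable_uncurry_of_continuous_of_measurable (u := fun x ξ => f x ξ θ)
    (fun ξ => continuous_f_left hA hf hθ ξ) (fun x => hf.measurable x θ hθ)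

theorem isMarkovKernel_transition {θ : F} (hθ : θ ∈ Θ) : IsMarkovKernel (transition ν f θ) :=
  Kernel.IsMarkovKernel.map _ (measurable_uncurry_f hA hf hθ)

theorem kerOp_transition {θ : F} (hθ : θ ∈ Θ) {e : X → ℝ} (he : Continuous e) :
    kerOp (transition ν f θ) e = meanOp ν f θ e := by
  have := FiniteDimensional.proper_real E
  funext x
  rw [kerOp, meanOp, transition_apply ν f θ (measurable_uncurry_f hA hf hθ) x,
    integral_map (hf.measurable x θ hθ).aemeasurable he.measurable.aestronglyMeasurable]

theorem integrable_transition_iff {θ : F} (hθ : θ ∈ Θ) {e : X → ℝ} (he : Continuous e) (x : X) :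
    Integrable e (transition ν f θ x) ↔ Integrable (fun ξ => e (f x ξ θ)) ν := by
  rw [transition_apply ν f θ (measurable_uncurry_f hA hf hθ) x,
    integrable_map_measure he.measurable.aestronglyMeasurable (hf.measurable x θ hθ).aemeasurable]
  rfl

/-- Stationarity of `μ`, for integrable continuous functions. -/
theorem integral_meanOp_of_bind {θ : F} (hθ : θ ∈ Θ) {μ : Measure X} [IsProbabilityMeasure μ]
    {e : X → ℝ} (he : Continuous e) (hi : Integrable e (μ.bind (transition ν f θ))) :
    ∫ x, meanOp ν f θ e x ∂μ = ∫ x, e x ∂(μ.bind (transition ν f θ)) := by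
  have hm := measurable_uncurry_f hA hf hθ
  rw [bind_transition hm] at hi ⊢
  rw [integral_map hm.aemeasurable he.measurable.aestronglyMeasurable, integral_prod]
  · rfl
  · exact (integrable_map_measure he.measurable.aestronglyMeasurable hm.aemeasurable).1 hi

variable {K L : ℝ} (hS : SysBounds ν Θ f A B K L) {x₀ : X}

theorem exists_noise_bound {θ : F} (hθ : θ ∈ Θ) : ∃ c : ℝ, 0 ≤ c ∧
    ∫⁻ ξ, ENNReal.ofReal (dA A (f x₀ ξ θ) x₀) ^ 2 ∂ν ≤ ENNReal.ofReal c ^ 2 := by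
  have h := (hf.integrable x₀ θ hθ).2
  rw [hasFiniteIntegral_iff_ofReal (ae_of_all _ fun ξ => sq_nonneg _)] at h
  obtain ⟨c, hc, h'⟩ := exists_le_ofReal_sq h
  refine ⟨c, hc, le_of_eq (Eq.trans (lintegral_congr fun ξ => ?_) h')⟩
  rw [ENNReal.ofReal_pow (dA_nonneg _ _), dA_comm hA.convex]

include hS

theorem lintegral_dA_f_sq_le {θ : F} (hθ : θ ∈ Θ) {c : ℝ}
    (hc : ∫⁻ ξ, ENNReal.ofReal (dA A (f x₀ ξ θ) x₀) ^ 2 ∂ν ≤ ENNReal.ofReal c ^ 2) (x : X) :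
    ∫⁻ ξ, ENNReal.ofReal (dA A (f x ξ θ) x₀) ^ 2 ∂ν ≤
      (ENNReal.ofReal (K * dA A x x₀) + ENNReal.ofReal c) ^ 2 := by
  have m1 : Measurable (fun ξ => ENNReal.ofReal (dA A (f x ξ θ) (f x₀ ξ θ))) :=
    measurable_ofReal_dA_comp hA (hf.measurable x θ hθ) (hf.measurable x₀ θ hθ)
  have m2 : Measurable (fun ξ => ENNReal.ofReal (dA A (f x₀ ξ θ) x₀)) :=
    (measurable_ofReal_dA_left hA x₀).comp (hf.measurable x₀ θ hθ)
  refine lintegral_sq_le_of_le_add (fun ξ => ?_) m1.aemeasurable m2.aemeasurable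
      (lintegral_dA_f_left_le hA hf hS hθ x x₀) hc
  rw [← ENNReal.ofReal_add (dA_nonneg _ _) (dA_nonneg _ _)]
  exact ENNReal.ofReal_le_ofReal (dA_triangle hA _ _ _)

/-- The image of `x` is compared with that of `x₀` by contraction, and the image of `x₀` with `x₀`
itself by `c`. The root-mean-square distance to `x₀` therefore evolves at worst by `s ↦ K s + c`. -/
theorem moment_bind_le {θ : F} (hθ : θ ∈ Θ) {c : ℝ} (hc0 : 0 ≤ c)
    (hc : ∫⁻ ξ, ENNReal.ofReal (dA A (f x₀ ξ θ) x₀) ^ 2 ∂ν ≤ ENNReal.ofReal c ^ 2)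
    {μ : Measure X} [IsProbabilityMeasure μ] {s : ℝ} (hs : 0 ≤ s)
    (h : ∫⁻ x, ENNReal.ofReal (dA A x x₀) ^ 2 ∂μ ≤ ENNReal.ofReal s ^ 2) :
    ∫⁻ x, ENNReal.ofReal (dA A x x₀) ^ 2 ∂(μ.bind (transition ν f θ)) ≤
      ENNReal.ofReal (K * s + c) ^ 2 := by
  have hK := hS.K_nonneg
  have hm := measurable_ofReal_dA_left hA x₀
  rw [bind_transition (measurable_uncurry_f hA hf hθ), ENNReal.ofReal_add (by positivity) hc0]
  refine lintegral_map_prod_sq_le (measurable_uncurry_f hA hf hθ) hm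
    (h₁ := fun x => ENNReal.ofReal (K * dA A x x₀)) (h₂ := fun _ => ENNReal.ofReal c) ?_
    aemeasurable_const ?_ (by simp) (lintegral_dA_f_sq_le hA hf hS hθ hc)
  · simp_rw [ENNReal.ofReal_mul hK]
    exact (hm.const_mul _).aemeasurable
  · simp_rw [ENNReal.ofReal_mul hK, mul_pow]
    rw [lintegral_const_mul _ (hm.pow_const 2)]
    gcongr

theorem bind_mem_P2A {θ : F} (hθ : θ ∈ Θ) {μ : Measure X} (hμ : μ ∈ P2A A x₀) :
    μ.bind (transition ν f θ) ∈ P2A A x₀ := by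
  have := hμ.1
  have := isMarkovKernel_transition hA hf hθ
  obtain ⟨c, hc0, hc⟩ := exists_noise_bound hA hf (x₀ := x₀) hθ
  obtain ⟨s, hs, h⟩ := exists_moment hμ
  exact mem_P2A_of_moment (moment_bind_le hA hf hS hθ hc0 hc hs h.le)

/-- Stationarity gives `s ≤ K s + c`, and `s` is finite because `μ` lies in `P2A`, so it can be
solved for. The bound depends on `θ` only through `c`. -/
theorem moment_le_of_invariant (hK1 : K < 1) {θ : F} (hθ : θ ∈ Θ) {c : ℝ} (hc0 : 0 ≤ c)
    (hc : ∫⁻ ξ, ENNReal.ofReal (dA A (f x₀ ξ θ) x₀) ^ 2 ∂ν ≤ ENNReal.ofReal c ^ 2)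
    {μ : Measure X} (hμ : μ ∈ P2A A x₀) (hi : Kernel.Invariant (transition ν f θ) μ) :
    ∫⁻ x, ENNReal.ofReal (dA A x x₀) ^ 2 ∂μ ≤ ENNReal.ofReal (c / (1 - K)) ^ 2 := by
  have := hμ.1
  have hK := hS.K_nonneg
  obtain ⟨s, hs, h⟩ := exists_moment hμ
  have h2 := moment_bind_le hA hf hS hθ hc0 hc hs h.le
  rw [show μ.bind (transition ν f θ) = μ from hi, h, ← ENNReal.ofReal_pow hs,
    ← ENNReal.ofReal_pow (by positivity), ENNReal.ofReal_le_ofReal_iff (by positivity)] at h2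
  have h3 : s ≤ K * s + c := (pow_le_pow_iff_left₀ hs (by positivity) two_ne_zero).1 h2
  rw [h]
  gcongr
  rw [le_div_iff₀ (by linarith)]
  linarith

variable [FiniteDimensional ℝ F] {U : Set F} (hU : Convex ℝ U) (hUΘ : U ⊆ Θ)
include hU hUΘ

/-- Moves the constant `c` from one parameter to another, which makes the moment bounds of the
stationary measures locally uniform in `θ`. -/
theorem noise_bound_of_mem (θ θ' : U) {c : ℝ} (hc0 : 0 ≤ c)
    (hc : ∫⁻ ξ, ENNReal.ofReal (dA A (f x₀ ξ θ) x₀) ^ 2 ∂ν ≤ ENNReal.ofReal c ^ 2) :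
    ∫⁻ ξ, ENNReal.ofReal (dA A (f x₀ ξ θ') x₀) ^ 2 ∂ν ≤
      ENNReal.ofReal (L * ‖B x₀ ((θ : F) - θ')‖ + c) ^ 2 := by
  have hL0 := hS.L_nonneg
  have m1 : Measurable (fun ξ => ENNReal.ofReal (dA A (f x₀ ξ θ') (f x₀ ξ θ))) :=
    measurable_ofReal_dA_comp hA (hf.measurable x₀ _ (hUΘ θ'.2)) (hf.measurable x₀ _ (hUΘ θ.2))
  have m2 : Measurable (fun ξ => ENNReal.ofReal (dA A (f x₀ ξ θ) x₀)) :=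
    (measurable_ofReal_dA_left hA x₀).comp (hf.measurable x₀ _ (hUΘ θ.2))
  rw [ENNReal.ofReal_add (by positivity) hc0]
  refine lintegral_sq_le_of_le_add (fun ξ => ?_) m1.aemeasurable m2.aemeasurable
      (lintegral_dA_f_right_le hA hf hS hU hUΘ x₀ θ' θ) hc
  rw [← ENNReal.ofReal_add (dA_nonneg _ _) (dA_nonneg _ _)]
  exact ENNReal.ofReal_le_ofReal (dA_triangle hA _ _ _)

/-! ### Coupling of the stationary measures at two parameters. -/

section Coupling

variable (hK1 : K < 1) {θ θ' : U} {μ μ' : Measure X} (hμ : μ ∈ P2A A x₀) (hμ' : μ' ∈ P2A A x₀)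
  (hi : Kernel.Invariant (transition ν f θ) μ) (hi' : Kernel.Invariant (transition ν f θ') μ')
  (hBm : Measurable (fun x => ‖(B x : F →L[ℝ] F)‖)) {b : ℝ} (hb0 : 0 ≤ b)
  (hb : ∫⁻ x, ENNReal.ofReal ‖(B x : F →L[ℝ] F)‖ ^ 2 ∂μ' ≤ ENNReal.ofReal b ^ 2)
include hK1 hμ hμ' hi hi' hBm hb0 hb

/-- Running both chains with the same noise couples the stationary measures. -/
theorem exists_coupling {ε : ℝ} (hε : 0 < ε) : ∃ Γ : Measure (X × X), IsProbabilityMeasure Γ ∧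
    Γ.map Prod.fst = μ' ∧ Γ.map Prod.snd = μ ∧
    ∫⁻ z, ENNReal.ofReal (dA A z.1 z.2) ^ 2 ∂Γ ≤
      ENNReal.ofReal (L * b * ‖(θ' : F) - θ‖ / (1 - K) + ε) ^ 2 := by
  have := hμ.1
  have := hμ'.1
  have hK := hS.K_nonneg
  have hL0 := hS.L_nonneg
  have h1K : 0 < 1 - K := by linarith
  have hθ := hUΘ θ.2
  have hθ' := hUΘ θ'.2
  obtain ⟨s, hs, h⟩ := exists_moment hμ
  obtain ⟨s', hs', h'⟩ := exists_moment hμ'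
  -- The fixed point of `r ↦ L b ‖θ' - θ‖ + K r`, the recursion satisfied by the coupling distance.
  set κ := L * b * ‖(θ' : F) - θ‖ / (1 - K) with hκ
  have hκ0 : 0 ≤ κ := by positivity
  have mD := measurable_ofReal_dA hA
  have mD0 := measurable_ofReal_dA_left hA x₀
  -- Start from the product coupling, whose distance is at most `s' + s` through `x₀`, and push it
  -- forward by the joint dynamics. Stationarity preserves the marginals, while the excess over `κ`
  -- shrinks by `K` at each step.
  have key : ∀ n : ℕ, ∃ Γ : Measure (X × X), IsProbabilityMeasure Γ ∧
      Γ.map Prod.fst = μ' ∧ Γ.map Prod.snd = μ ∧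
      ∫⁻ z, ENNReal.ofReal (dA A z.1 z.2) ^ 2 ∂Γ ≤
        ENNReal.ofReal (κ + K ^ n * (s' + s)) ^ 2 := by
    intro n
    induction n with
    | zero =>
      refine ⟨μ'.prod μ, inferInstance, by simp, by simp, ?_⟩
      have h1 : ∫⁻ z : X × X, ENNReal.ofReal (dA A z.1 x₀) ^ 2 ∂(μ'.prod μ) ≤
          ENNReal.ofReal s' ^ 2 := by
        rw [(measurePreserving_fst (μ := μ') (ν := μ)).lintegral_comp (mD0.pow_const 2), h']
      have h2 : ∫⁻ z : X × X, ENNReal.ofReal (dA A z.2 x₀) ^ 2 ∂(μ'.prod μ) ≤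
          ENNReal.ofReal s ^ 2 := by
        rw [(measurePreserving_snd (μ := μ') (ν := μ)).lintegral_comp (mD0.pow_const 2), h]
      refine (lintegral_sq_le_of_le_add (fun z => ?_) (mD0.comp measurable_fst).aemeasurable
          (mD0.comp measurable_snd).aemeasurable h1 h2).trans ?_
      · rw [Function.comp_apply, Function.comp_apply,
          ← ENNReal.ofReal_add (dA_nonneg _ _) (dA_nonneg _ _)]
        refine ENNReal.ofReal_le_ofReal ?_
        have := dA_triangle hA z.1 x₀ z.2
        rwa [dA_comm hA.convex x₀] at this
      · rw [← ENNReal.ofReal_add hs' hs]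
        refine pow_le_pow_left' (ENNReal.ofReal_le_ofReal ?_) 2
        rw [pow_zero, one_mul]
        linarith
    | succ n ih =>
      obtain ⟨Γ, hΓp, h1, h2, h3⟩ := ih
      have mf := measurable_uncurry_f hA hf hθ
      have mf' := measurable_uncurry_f hA hf hθ'
      let T : (X × X) × Ξ → X × X := fun p => (f p.1.1 p.2 θ', f p.1.2 p.2 θ)
      have hT : Measurable T :=
        (mf'.comp (measurable_fst.fst.prodMk measurable_snd)).prodMk
          (mf.comp (measurable_fst.snd.prodMk measurable_snd))
      refine ⟨(Γ.prod ν).map T, Measure.isProbabilityMeasure_map hT.aemeasurable, ?_, ?_, ?_⟩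
      · rw [Measure.map_map measurable_fst hT,
          show Prod.fst ∘ T = (fun p : X × Ξ => f p.1 p.2 θ') ∘ Prod.map Prod.fst id from rfl,
          ← Measure.map_map mf' (measurable_fst.prodMap measurable_id),
          ← Measure.map_prod_map _ _ measurable_fst measurable_id, h1, Measure.map_id,
          ← bind_transition mf']
        exact hi'
      · rw [Measure.map_map measurable_snd hT,
          show Prod.snd ∘ T = (fun p : X × Ξ => f p.1 p.2 θ) ∘ Prod.map Prod.snd id from rfl,
          ← Measure.map_map mf (measurable_snd.prodMap measurable_id),
          ← Measure.map_prod_map _ _ measurable_snd measurable_id, h2, Measure.map_id,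
          ← bind_transition mf]
        exact hi
      · have e : κ + K ^ (n + 1) * (s' + s) =
            L * ‖(θ : F) - θ'‖ * b + K * (κ + K ^ n * (s' + s)) := by
          have : κ * (1 - K) = L * b * ‖(θ' : F) - θ‖ := div_mul_cancel₀ _ h1K.ne'
          rw [norm_sub_rev (θ : F)]
          linear_combination this
        rw [e, ENNReal.ofReal_add (by positivity) (by positivity)]
        refine lintegral_map_prod_sq_le hT mD
          (h₁ := fun z => ENNReal.ofReal (L * ‖(θ : F) - θ'‖) * ENNReal.ofReal ‖(B z.1 : F →L[ℝ] F)‖)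
          (h₂ := fun z => ENNReal.ofReal K * ENNReal.ofReal (dA A z.1 z.2))
          ((hBm.comp measurable_fst).ennreal_ofReal.const_mul _).aemeasurable
          (mD.const_mul _).aemeasurable ?_ ?_ ?_
        · simp_rw [mul_pow]
          rw [lintegral_const_mul' _ _ (by finiteness), ENNReal.ofReal_mul (q := b) (by positivity),
            mul_pow]
          rw [← h1, lintegral_map (hBm.ennreal_ofReal.pow_const 2) measurable_fst] at hb
          exact mul_le_mul_right hb _
        · simp_rw [mul_pow]
          rw [lintegral_const_mul' _ _ (by simp), ENNReal.ofReal_mul hK, mul_pow]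
          gcongr
        -- The intermediate point is `f(z.1, ξ, θ)`: first change the parameter at `z.1`, then the
        -- state at parameter `θ`. The weight is thus evaluated at `z.1`, whose law is `μ'`, the
        -- measure whose moment `b` bounds.
        · intro z
          have m1 : Measurable (fun ξ => ENNReal.ofReal (dA A (f z.1 ξ θ') (f z.1 ξ θ))) :=
            measurable_ofReal_dA_comp hA (hf.measurable z.1 _ hθ') (hf.measurable z.1 _ hθ)
          have m2 : Measurable (fun ξ => ENNReal.ofReal (dA A (f z.1 ξ θ) (f z.2 ξ θ))) :=
            measurable_ofReal_dA_comp hA (hf.measurable z.1 _ hθ) (hf.measurable z.2 _ hθ)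
          refine lintegral_sq_le_of_le_add (fun ξ => ?_) m1.aemeasurable m2.aemeasurable
              ((lintegral_dA_f_right_le hA hf hS hU hUΘ z.1 θ' θ).trans
                (pow_le_pow_left' ?_ 2))
              ((lintegral_dA_f_left_le hA hf hS hθ z.1 z.2).trans (pow_le_pow_left' ?_ 2))
          · rw [← ENNReal.ofReal_add (dA_nonneg _ _) (dA_nonneg _ _)]
            exact ENNReal.ofReal_le_ofReal (dA_triangle hA _ _ _)
          · rw [← ENNReal.ofReal_mul (by positivity), mul_assoc]
            refine ENNReal.ofReal_le_ofReal (mul_le_mul_of_nonneg_left ?_ hL0)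
            rw [mul_comm]
            exact (B z.1 : F →L[ℝ] F).le_opNorm _
          · rw [ENNReal.ofReal_mul hK]
  have ht : Tendsto (fun n : ℕ => K ^ n * (s' + s)) atTop (𝓝 0) := by
    simpa using (tendsto_pow_atTop_nhds_zero_of_lt_one hK hK1).mul_const (s' + s)
  obtain ⟨n, hn⟩ := (ht.eventually_lt_const hε).exists
  obtain ⟨Γ, hΓ, h1, h2, h3⟩ := key n
  refine ⟨Γ, hΓ, h1, h2, h3.trans ?_⟩
  gcongr

/-- Difference of two stationary measures on functions with a locally Lipschitz bound. -/
theorem abs_integral_sub_le {φ : X → ℝ} (hφ : Continuous φ) (hφi : Integrable φ μ)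
    (hφi' : Integrable φ μ') {β : X → ℝ} (hβ : Measurable β) (hβ0 : ∀ x, 0 ≤ β x)
    {M C b₁ : ℝ} (hM : 0 ≤ M) (hC : 0 ≤ C) (hb₁ : 0 ≤ b₁)
    (hβb : ∫⁻ x, ENNReal.ofReal (β x) ^ 2 ∂μ' ≤ ENNReal.ofReal b₁ ^ 2)
    (hφl : ∀ x y, |φ x - φ y| ≤ M * ((β x + C * dA A x y) * dA A x y)) :
    |∫ x, φ x ∂μ' - ∫ x, φ x ∂μ| ≤ M * ((b₁ + C * (L * b * ‖(θ' : F) - θ‖ / (1 - K))) *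
      (L * b * ‖(θ' : F) - θ‖ / (1 - K))) := by
  have hK := hS.K_nonneg
  have hL0 := hS.L_nonneg
  have h1K : 0 < 1 - K := by linarith
  set κ := L * b * ‖(θ' : F) - θ‖ / (1 - K) with hκ
  have hκ0 : 0 ≤ κ := by positivity
  have mD := measurable_ofReal_dA hA
  have key : ∀ ε > 0, |∫ x, φ x ∂μ' - ∫ x, φ x ∂μ| ≤ M * ((b₁ + C * (κ + ε)) * (κ + ε)) := by
    intro ε hε
    obtain ⟨Γ, hΓ, h1, h2, h3⟩ :=
      exists_coupling hA hf hS hU hUΘ hK1 hμ hμ' hi hi' hBm hb0 hb hε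
    have hφm := hφ.measurable
    rw [← h1] at hφi'
    rw [← h2] at hφi
    have j1 := (integrable_map_measure hφm.aestronglyMeasurable measurable_fst.aemeasurable).1 hφi'
    have j2 := (integrable_map_measure hφm.aestronglyMeasurable measurable_snd.aemeasurable).1 hφi
    have e : ∫ x, φ x ∂μ' - ∫ x, φ x ∂μ = ∫ z, (φ z.1 - φ z.2) ∂Γ := by
      rw [integral_sub (f := fun z : X × X => φ z.1) (g := fun z : X × X => φ z.2) j1 j2, ← h1, ← h2,
        integral_map measurable_fst.aemeasurable hφm.aestronglyMeasurable,
        integral_map measurable_snd.aemeasurable hφm.aestronglyMeasurable]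
    have hβb' : ∫⁻ z, ENNReal.ofReal (β z.1) ^ 2 ∂Γ ≤ ENNReal.ofReal b₁ ^ 2 := by
      rw [← h1, lintegral_map (hβ.ennreal_ofReal.pow_const 2) measurable_fst] at hβb
      exact hβb
    have hCd : ∫⁻ z, (ENNReal.ofReal C * ENNReal.ofReal (dA A z.1 z.2)) ^ 2 ∂Γ ≤
        ENNReal.ofReal (C * (κ + ε)) ^ 2 := by
      simp_rw [mul_pow]
      rw [lintegral_const_mul' _ _ (by simp), ENNReal.ofReal_mul hC, mul_pow]
      gcongr
    have mβ : AEMeasurable (fun z : X × X => ENNReal.ofReal (β z.1)) Γ :=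
      (hβ.comp measurable_fst).ennreal_ofReal.aemeasurable
    have mC : AEMeasurable (fun z : X × X => ENNReal.ofReal C * ENNReal.ofReal (dA A z.1 z.2)) Γ :=
      (mD.const_mul _).aemeasurable
    rw [e, ← Real.norm_eq_abs, ← enorm_le_ofReal_iff (by positivity)]
    refine (enorm_integral_le_lintegral_enorm _).trans ?_
    calc ∫⁻ z, ‖φ z.1 - φ z.2‖ₑ ∂Γ
        ≤ ∫⁻ z, ENNReal.ofReal M * ((ENNReal.ofReal (β z.1) +
            ENNReal.ofReal C * ENNReal.ofReal (dA A z.1 z.2)) * ENNReal.ofReal (dA A z.1 z.2)) ∂Γ := by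
          refine lintegral_mono fun z => ?_
          have hd := dA_nonneg (A := A) z.1 z.2
          have hβz := hβ0 z.1
          rw [← ENNReal.ofReal_mul hC, ← ENNReal.ofReal_add hβz (by positivity),
            ← ENNReal.ofReal_mul (by positivity), ← ENNReal.ofReal_mul hM,
            enorm_le_ofReal_iff (by positivity)]
          exact hφl _ _
      _ = ENNReal.ofReal M * ∫⁻ z, (ENNReal.ofReal (β z.1) +
            ENNReal.ofReal C * ENNReal.ofReal (dA A z.1 z.2)) * ENNReal.ofReal (dA A z.1 z.2) ∂Γ :=
          lintegral_const_mul' _ _ (by simp)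
      -- Cauchy–Schwarz under the coupling: the local Lipschitz weight against the distance, the
      -- weight being split by the triangle inequality in `L²(Γ)`.
      _ ≤ ENNReal.ofReal M * ((ENNReal.ofReal b₁ + ENNReal.ofReal (C * (κ + ε))) *
            ENNReal.ofReal (κ + ε)) := by
          gcongr
          exact lintegral_mul_le_of_sq_le (mβ.add mC) mD.aemeasurable
            (lintegral_add_sq_le mβ mC hβb' hCd) h3
      _ = _ := by
          rw [← ENNReal.ofReal_add hb₁ (by positivity), ← ENNReal.ofReal_mul (by positivity),
            ← ENNReal.ofReal_mul hM]
  -- Letting `ε` tend to zero makes an optimal coupling unnecessary.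
  have hc : Continuous (fun ε => M * ((b₁ + C * (κ + ε)) * (κ + ε))) := by fun_prop
  have ht := (hc.tendsto 0).mono_left (nhdsWithin_le_nhds (s := Ioi 0))
  simp only [add_zero] at ht
  exact ge_of_tendsto ht (eventually_nhdsWithin_of_forall key)

end Coupling

end

end Moments
end StationaryDiff
end

open MeasureTheory ProbabilityTheory Set Filter Topology
open scoped ENNReal

noncomputable section

namespace StationaryDiff

/-! ### Existence, uniqueness and ergodicity of the stationary measure. -/

section Stationary

set_option linter.unusedSectionVars false
set_option maxSynthPendingDepth 3

variable {E F Ξ : Type*} [NormedAddCommGroup E] [NormedSpace ℝ E]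
  [NormedAddCommGroup F] [NormedSpace ℝ F] {X : Set E} {A : X → E ≃L[ℝ] E} {B : X → F ≃L[ℝ] F}
  [MeasurableSpace Ξ] {ν : Measure Ξ} [IsProbabilityMeasure ν] {Θ : Set F} {f : X → Ξ → F → X}
  [MeasurableSpace E] [BorelSpace E] [FiniteDimensional ℝ E] {x₀ : X}

/-- `φ` is Lipschitz for `d_A`. -/
def LipA (A : X → E ≃L[ℝ] E) (M : ℝ) (φ : X → ℝ) : Prop :=
  ∀ x y, |φ x - φ y| ≤ M * dA A x y

section

variable (hA : FinslerConditions X A)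
include hA

theorem LipA.continuous {M : ℝ} {φ : X → ℝ} (h : LipA A M φ) : Continuous φ := by
  have := FiniteDimensional.complete ℝ E
  refine continuous_iff_continuousAt.2 fun x => tendsto_iff_dist_tendsto_zero.2 ?_
  refine squeeze_zero (fun _ => dist_nonneg) (fun y => ?_)
    (by simpa using (tendsto_dA_nhds hA x).const_mul M)
  rw [dist_comm, Real.dist_eq]
  exact h x y

omit [MeasurableSpace E] [BorelSpace E] [FiniteDimensional ℝ E] hA in
theorem LipA.abs_le {M : ℝ} (hM : 0 ≤ M) {φ : X → ℝ} (h : LipA A M φ) (x : X) :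
    |φ x| ≤ (|φ x₀| + M) * (1 + dA A x x₀) := by
  have h1 := h x x₀
  have h2 := abs_add_le (φ x - φ x₀) (φ x₀)
  rw [sub_add_cancel] at h2
  nlinarith [abs_nonneg (φ x₀), dA_nonneg (A := A) x x₀,
    mul_nonneg (abs_nonneg (φ x₀)) (dA_nonneg (A := A) x x₀)]

theorem LipA.integrable {M : ℝ} (hM : 0 ≤ M) {φ : X → ℝ} (h : LipA A M φ) {μ : Measure X}
    (hμ : μ ∈ P2A A x₀) : Integrable φ μ := by
  have := FiniteDimensional.complete ℝ E
  exact integrable_of_abs_le hA hμ (h.continuous hA) (h.abs_le hM)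

theorem CostBound.lipA {e : X → ℝ} {n₁ n₂ : ℝ} (h : CostBound A e n₁ n₂) : LipA A n₁ e := by
  have := FiniteDimensional.complete ℝ E
  exact fun x y => h.lipschitz hA x y

theorem abs_sub_integral_le {M : ℝ} (hM : 0 ≤ M) {φ : X → ℝ} (h : LipA A M φ) {μ : Measure X}
    (hμ : μ ∈ P2A A x₀) (x : X) :
    |φ x - ∫ y, φ y ∂μ| ≤ M * (dA A x x₀ + ∫ y, dA A y x₀ ∂μ) := by
  have := FiniteDimensional.complete ℝ E
  have := hμ.1
  have hi := h.integrable hA hM hμ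
  have hd := integrable_dA hA hμ
  have e : φ x - ∫ y, φ y ∂μ = ∫ y, (φ x - φ y) ∂μ := by
    rw [integral_sub (integrable_const _) hi]; simp
  have e2 : M * (dA A x x₀ + ∫ y, dA A y x₀ ∂μ) = ∫ y, M * (dA A x x₀ + dA A y x₀) ∂μ := by
    rw [integral_const_mul, integral_add (integrable_const _) hd]; simp
  rw [e, e2, ← Real.norm_eq_abs]
  refine norm_integral_le_of_norm_le (((integrable_const _).add hd).const_mul M)
    (ae_of_all _ fun y => (h x y).trans ?_)
  have := dA_triangle hA x x₀ y
  rw [dA_comm hA.convex x₀] at this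
  exact mul_le_mul_of_nonneg_left this hM

/-- Borel probability measures on `X` are determined by bounded `d_A`-Lipschitz functions. -/
theorem eq_of_forall_integral_eq {μ μ' : Measure X} [IsProbabilityMeasure μ]
    [IsProbabilityMeasure μ']
    (h : ∀ φ : X → ℝ, ∀ M, 0 ≤ M → LipA A M φ → (∃ C, ∀ x, |φ x| ≤ C) →
      ∫ x, φ x ∂μ = ∫ x, φ x ∂μ') : μ = μ' := by
  have := FiniteDimensional.complete ℝ E
  obtain ⟨z, hz⟩ := hA.interior.mono interior_subset
  let x₀ : X := ⟨z, hz⟩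
  obtain ⟨C, hC, -, hCd⟩ := exists_norm_sub_le_dA hA
  let p : ProbabilityMeasure X := ⟨μ, inferInstance⟩
  let p' : ProbabilityMeasure X := ⟨μ', inferInstance⟩
  -- Weak convergence can be tested on bounded norm-Lipschitz functions, and these are
  -- `d_A`-Lipschitz. The constant sequence `p` thus converges weakly to `p'`, and limits are
  -- unique.
  have ht : Tendsto (fun _ : ℕ => p) atTop (𝓝 p') := by
    rw [tendsto_iff_forall_lipschitz_integral_tendsto]
    rintro φ ⟨D, hD⟩ ⟨L, hL⟩
    have hL2 : LipA A (L * C) φ := fun x y => by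
      have h1 := hL.dist_le_mul x y
      rw [Real.dist_eq, Subtype.dist_eq, dist_eq_norm] at h1
      rw [mul_assoc]
      exact h1.trans (mul_le_mul_of_nonneg_left (hCd x y) L.2)
    rw [show ∫ x, φ x ∂(p' : Measure X) = ∫ x, φ x ∂(p : Measure X) from
      (h φ _ (by positivity) hL2 ⟨|φ x₀| + D, fun x => by
        have h1 := hD x x₀
        rw [Real.dist_eq] at h1
        have h2 := abs_add_le (φ x - φ x₀) (φ x₀)
        rw [sub_add_cancel] at h2
        linarith⟩).symm]
    exact tendsto_const_nhds
  exact congrArg (fun q : ProbabilityMeasure X => (q : Measure X))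
    (tendsto_nhds_unique tendsto_const_nhds ht)

/-- `d_A` dominates a multiple of the norm, so these sets are bounded in a finite-dimensional space,
and closed by continuity of `d_A`. They supply the compact sets for tightness. -/
theorem isCompact_dA_le (r : ℝ) : IsCompact {x : X | dA A x x₀ ≤ r} := by
  have := FiniteDimensional.complete ℝ E
  have := FiniteDimensional.proper_real E
  obtain ⟨C, hC, -, hCd⟩ := exists_norm_sub_le_dA hA
  refine (hA.closed.isClosedEmbedding_subtypeVal.isCompact_preimage
    (isCompact_closedBall (x₀ : E) (C * r))).of_isClosed_subset ?_ fun x hx => ?_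
  · exact isClosed_le ((continuous_dA hA).comp (continuous_id.prodMk continuous_const))
      continuous_const
  · rw [mem_preimage, mem_closedBall_iff_norm]
    exact (hCd x x₀).trans (mul_le_mul_of_nonneg_left hx hC.le)

end

section

variable (hA : FinslerConditions X A) (hf : SystemConditions ν Θ f A) {θ : F} (hθ : θ ∈ Θ)
include hA hf hθ

theorem LipA.integrable_comp_f {M : ℝ} (hM : 0 ≤ M) {φ : X → ℝ} (h : LipA A M φ) (x : X) :
    Integrable (fun ξ => φ (f x ξ θ)) ν := by
  refine Integrable.mono' (((integrable_const 1).add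
    (integrable_dA_f hA hf hθ x)).const_mul (|φ x| + M))
    (stronglyMeasurable_comp_f hA hf hθ (h.continuous hA) x).aestronglyMeasurable
    (ae_of_all _ fun ξ => ?_)
  have := h.abs_le (x₀ := x) hM (f x ξ θ)
  rwa [dA_comm hA.convex] at this

theorem integral_meanOp {μ : Measure X} [IsProbabilityMeasure μ]
    (hi : Kernel.Invariant (transition ν f θ) μ) {e : X → ℝ} (he : Continuous e)
    (hint : Integrable e μ) : ∫ x, meanOp ν f θ e x ∂μ = ∫ x, e x ∂μ := by
  have h : μ.bind (transition ν f θ) = μ := hi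
  have := integral_meanOp_of_bind hA hf hθ (μ := μ) he (by rwa [h])
  rwa [h] at this

variable {K L : ℝ} (hS : SysBounds ν Θ f A B K L)
include hS

/-- Uses only the pathwise contraction of `d_A`, not derivatives of `φ`. Lipschitz functions are
what weak convergence is tested on, and they need not be `C²`. -/
theorem LipA.meanOp {M : ℝ} (hM : 0 ≤ M) {φ : X → ℝ} (h : LipA A M φ) :
    LipA A (K * M) (meanOp ν f θ φ) := by
  intro x y
  have hK := hS.K_nonneg
  have hd := dA_nonneg (A := A) x y
  have hm : Measurable (fun ξ => ENNReal.ofReal (dA A (f x ξ θ) (f y ξ θ))) :=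
    measurable_ofReal_dA_comp hA (hf.measurable x θ hθ) (hf.measurable y θ hθ)
  rw [StationaryDiff.meanOp, StationaryDiff.meanOp,
    ← integral_sub (h.integrable_comp_f hA hf hθ hM x) (h.integrable_comp_f hA hf hθ hM y),
    ← Real.norm_eq_abs, ← enorm_le_ofReal_iff (by positivity)]
  refine (enorm_integral_le_lintegral_enorm _).trans ?_
  calc ∫⁻ ξ, ‖φ (f x ξ θ) - φ (f y ξ θ)‖ₑ ∂ν
      ≤ ∫⁻ ξ, ENNReal.ofReal M * ENNReal.ofReal (dA A (f x ξ θ) (f y ξ θ)) ∂ν := by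
        refine lintegral_mono fun ξ => ?_
        rw [← ENNReal.ofReal_mul hM,
          enorm_le_ofReal_iff (mul_nonneg hM (dA_nonneg _ _))]
        exact h _ _
    _ = ENNReal.ofReal M * ∫⁻ ξ, ENNReal.ofReal (dA A (f x ξ θ) (f y ξ θ)) ∂ν :=
        lintegral_const_mul' _ _ (by simp)
    _ ≤ ENNReal.ofReal M * ENNReal.ofReal (K * dA A x y) := by
        gcongr
        exact lintegral_le_of_sq_le hm.aemeasurable (lintegral_dA_f_left_le hA hf hS hθ x y)
    _ = _ := by rw [← ENNReal.ofReal_mul hM]; congr 1; ring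

theorem LipA.iterate_meanOp {M : ℝ} (hM : 0 ≤ M) {φ : X → ℝ} (h : LipA A M φ) (n : ℕ) :
    LipA A (K ^ n * M) ((StationaryDiff.meanOp ν f θ)^[n] φ) := by
  have hK := hS.K_nonneg
  induction n with
  | zero => simpa using h
  | succ n ih =>
    rw [Function.iterate_succ_apply', pow_succ', mul_assoc]
    exact ih.meanOp hA hf hθ hS (by positivity)

theorem integral_iterate_meanOp {μ : Measure X} (hμ : μ ∈ P2A A x₀)
    (hi : Kernel.Invariant (transition ν f θ) μ) {M : ℝ} (hM : 0 ≤ M) {φ : X → ℝ}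
    (h : LipA A M φ) (n : ℕ) : ∫ x, (meanOp ν f θ)^[n] φ x ∂μ = ∫ x, φ x ∂μ := by
  have hK := hS.K_nonneg
  have := hμ.1
  induction n with
  | zero => rfl
  | succ n ih =>
    have h1 := h.iterate_meanOp hA hf hθ hS hM n
    rw [Function.iterate_succ_apply', integral_meanOp hA hf hθ hi (h1.continuous hA)
      (h1.integrable hA (by positivity) hμ), ih]

theorem abs_iterate_meanOp_sub_le {μ : Measure X} (hμ : μ ∈ P2A A x₀)
    (hi : Kernel.Invariant (transition ν f θ) μ) {M : ℝ} (hM : 0 ≤ M) {φ : X → ℝ}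
    (h : LipA A M φ) (n : ℕ) (x : X) : |(meanOp ν f θ)^[n] φ x - ∫ y, φ y ∂μ| ≤
      K ^ n * M * (dA A x x₀ + ∫ y, dA A y x₀ ∂μ) := by
  have hK := hS.K_nonneg
  rw [← integral_iterate_meanOp hA hf hθ hS hμ hi hM h n]
  exact abs_sub_integral_le hA (by positivity) (h.iterate_meanOp hA hf hθ hS hM n) hμ x

variable (hK1 : K < 1)
include hK1

theorem tendsto_iterate_meanOp {μ : Measure X} (hμ : μ ∈ P2A A x₀)
    (hi : Kernel.Invariant (transition ν f θ) μ) {M : ℝ} (hM : 0 ≤ M) {φ : X → ℝ}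
    (h : LipA A M φ) (x : X) :
    Tendsto (fun n => (meanOp ν f θ)^[n] φ x) atTop (𝓝 (∫ y, φ y ∂μ)) := by
  rw [tendsto_iff_dist_tendsto_zero]
  refine squeeze_zero (fun _ => dist_nonneg)
    (fun n => abs_iterate_meanOp_sub_le hA hf hθ hS hμ hi hM h n x) ?_
  simpa [mul_assoc] using (tendsto_pow_atTop_nhds_zero_of_lt_one hS.K_nonneg hK1).mul_const
    (M * (dA A x x₀ + ∫ y, dA A y x₀ ∂μ))

/-- The iterates at the single point `x₀` do not involve the measure, yet their limit is its
integral of `φ`. -/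
theorem invariant_unique {μ μ' : Measure X} (hμ : μ ∈ P2A A x₀) (hμ' : μ' ∈ P2A A x₀)
    (hi : Kernel.Invariant (transition ν f θ) μ) (hi' : Kernel.Invariant (transition ν f θ) μ') :
    μ = μ' := by
  have := hμ.1
  have := hμ'.1
  refine eq_of_forall_integral_eq hA fun φ M hM h _ => ?_
  exact tendsto_nhds_unique (tendsto_iterate_meanOp hA hf hθ hS hK1 hμ hi hM h x₀)
    (tendsto_iterate_meanOp hA hf hθ hS hK1 hμ' hi' hM h x₀)

/-- The laws of the chain started at `x₀` have bounded second moments, hence are tight, and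
Prokhorov's theorem gives a weak limit point. No Cesàro averaging is needed: the integrals of a
Lipschitz function under consecutive laws differ by `O(Kⁿ)`, so the limit point is stationary. -/
theorem exists_invariant (x₀ : X) :
    ∃ μ : Measure X, μ ∈ P2A A x₀ ∧ Kernel.Invariant (transition ν f θ) μ := by
  have := FiniteDimensional.complete ℝ E
  have := FiniteDimensional.proper_real E
  have := hA.closed.polishSpace
  have hK := hS.K_nonneg
  have h1K : 0 < 1 - K := by linarith
  have := isMarkovKernel_transition hA hf hθ
  obtain ⟨c, hc0, hc⟩ := exists_noise_bound hA hf (x₀ := x₀) hθ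
  -- The fixed point of `s ↦ K s + c`. The Dirac mass has moment `0`, so this bound persists along
  -- the chain.
  set s := c / (1 - K) with hs
  have hs0 : 0 ≤ s := by positivity
  have hsK : K * s + c = s := by
    have : s * (1 - K) = c := div_mul_cancel₀ _ h1K.ne'
    linarith
  let law : ℕ → Measure X := fun n => (fun μ => μ.bind (transition ν f θ))^[n] (Measure.dirac x₀)
  have law_succ : ∀ n, law (n + 1) = (law n).bind (transition ν f θ) := fun n =>
    Function.iterate_succ_apply' _ _ _
  have hlaw : ∀ n, IsProbabilityMeasure (law n) ∧
      ∫⁻ x, ENNReal.ofReal (dA A x x₀) ^ 2 ∂(law n) ≤ ENNReal.ofReal s ^ 2 := by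
    intro n
    induction n with
    | zero =>
      refine ⟨by simp only [law, Function.iterate_zero, id]; infer_instance, ?_⟩
      simp only [law, Function.iterate_zero, id]
      rw [lintegral_dirac' _ ((measurable_ofReal_dA_left hA x₀).pow_const 2), dA_self]
      simp
    | succ n ih =>
      obtain ⟨i1, i2⟩ := ih
      rw [law_succ]
      refine ⟨inferInstance, ?_⟩
      have := moment_bind_le hA hf hS hθ hc0 hc hs0 i2
      rwa [hsK] at this
  have hprob : ∀ n, IsProbabilityMeasure (law n) := fun n => (hlaw n).1
  have hmem : ∀ n, law n ∈ P2A A x₀ := fun n => mem_P2A_of_moment (hlaw n).2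
  have hint : ∀ n φ M, 0 ≤ M → LipA A M φ → ∫ x, φ x ∂(law n) = (meanOp ν f θ)^[n] φ x₀ := by
    intro n
    induction n with
    | zero =>
      intro φ M hM h
      simp only [law, Function.iterate_zero, id]
      rw [integral_dirac' _ _ (h.continuous hA).stronglyMeasurable]
    | succ n ih =>
      intro φ M hM h
      rw [law_succ, ← integral_meanOp_of_bind hA hf hθ (h.continuous hA)
        (by rw [← law_succ]; exact h.integrable hA hM (hmem _)),
        ih _ _ (by positivity) (h.meanOp hA hf hθ hS hM), Function.iterate_succ_apply]
  let P : ℕ → ProbabilityMeasure X := fun n => ⟨law n, hprob n⟩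
  -- Markov's inequality: outside the compact `d_A`-ball of radius `r` every law has mass at most
  -- `s² / r²`.
  have htight : IsTightMeasureSet {((μ : ProbabilityMeasure X) : Measure X) | μ ∈ range P} := by
    rw [isTightMeasureSet_iff_exists_isCompact_measure_compl_le]
    intro ε hε
    obtain ⟨r, hr0, hr⟩ : ∃ r : ℝ, 0 < r ∧ ENNReal.ofReal (s ^ 2) / ENNReal.ofReal (r ^ 2) ≤ ε := by
      have ht : Tendsto (fun r : ℝ => ENNReal.ofReal (s ^ 2 / r ^ 2)) atTop (𝓝 0) := by
        have h1 : Tendsto (fun r : ℝ => s ^ 2 / r ^ 2) atTop (𝓝 0) :=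
          tendsto_const_nhds.div_atTop (tendsto_pow_atTop two_ne_zero)
        simpa using ENNReal.tendsto_ofReal h1
      obtain ⟨r, h1, h2⟩ := ((ht.eventually_lt_const hε).and (eventually_gt_atTop 0)).exists
      refine ⟨r, h2, ?_⟩
      rw [← ENNReal.ofReal_div_of_pos (by positivity)]
      exact h1.le
    refine ⟨_, isCompact_dA_le hA (x₀ := x₀) r, ?_⟩
    rintro _ ⟨_, ⟨n, rfl⟩, rfl⟩
    have hm := (measurable_ofReal_dA_left hA x₀).pow_const 2
    refine le_trans (measure_mono fun x hx => ?_) ((meas_ge_le_lintegral_div (μ := law n)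
      (ε := ENNReal.ofReal (r ^ 2)) hm.aemeasurable (by simp [hr0.ne']) (by simp)).trans ?_)
    · rw [mem_ofPred_eq, ENNReal.ofReal_pow hr0.le]
      refine pow_le_pow_left' (ENNReal.ofReal_le_ofReal ?_) 2
      have : ¬ dA A x x₀ ≤ r := hx
      exact (not_le.1 this).le
    · refine le_trans ?_ hr
      rw [ENNReal.ofReal_pow hs0]
      gcongr
      exact (hlaw n).2
  obtain ⟨μ, -, k, hk, hμ⟩ := (isCompact_closure_of_isTightMeasureSet htight).tendsto_subseq
    (x := P) (fun n => subset_closure (mem_range_self n))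
  have hμP : (μ : Measure X) ∈ P2A A x₀ := by
    refine mem_P2A_of_moment (s := s) ?_
    -- The second moment is lower semicontinuous under weak convergence, so the limit stays in
    -- `P2A`.
    have h1 := lintegral_le_liminf_lintegral_of_forall_isOpen_measure_le_liminf_measure
      (μ := (μ : Measure X)) (μs := fun n => law (k n)) (f := fun x => dA A x x₀ ^ 2)
      (((continuous_dA hA).comp (continuous_id.prodMk continuous_const)).pow 2)
      (fun x => sq_nonneg _)
      (fun G hG => ProbabilityMeasure.le_liminf_measure_open_of_tendsto hμ hG)
    simp_rw [ENNReal.ofReal_pow (dA_nonneg _ _)] at h1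
    refine h1.trans ((liminf_le_liminf (Eventually.of_forall fun n => (hlaw (k n)).2)).trans ?_)
    simp
  refine ⟨μ, hμP, ?_⟩
  have hbP := bind_mem_P2A hA hf hS hθ hμP
  have := hbP.1
  refine eq_of_forall_integral_eq hA fun φ M hM h hb => ?_
  obtain ⟨D, hD⟩ := hb
  have hc1 := h.continuous hA
  have h' := h.meanOp hA hf hθ hS hM
  have hD' : ∀ x, |meanOp ν f θ φ x| ≤ D := fun x => by
    rw [meanOp, ← Real.norm_eq_abs]
    exact (norm_integral_le_of_norm_le_const (ae_of_all _ fun ξ => hD _)).trans (by simp)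
  have conv : ∀ ψ : X → ℝ, Continuous ψ → (∀ x, |ψ x| ≤ D) →
      Tendsto (fun n => ∫ x, ψ x ∂(law (k n))) atTop (𝓝 (∫ x, ψ x ∂(μ : Measure X))) := by
    intro ψ hψ hψD
    exact (ProbabilityMeasure.tendsto_iff_forall_integral_tendsto.1 hμ)
      (BoundedContinuousFunction.ofNormedAddCommGroup ψ hψ D hψD)
  have t1 := conv φ hc1 hD
  have t2 := conv _ (h'.continuous hA) hD'
  rw [← integral_meanOp_of_bind hA hf hθ hc1 (h.integrable hA hM hbP)]
  refine tendsto_nhds_unique t2 ?_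
  have t3 : Tendsto (fun n => ∫ x, meanOp ν f θ φ x ∂(law (k n)) - ∫ x, φ x ∂(law (k n)))
      atTop (𝓝 0) := by
    -- The two integrals are the iterates `n + 1` and `n` of `φ` at `x₀`. The former is the integral
    -- of the `n`-th iterate against `law 1`, and that iterate is `Kⁿ M`-Lipschitz.
    have hd : ∀ n, |∫ x, meanOp ν f θ φ x ∂(law n) - ∫ x, φ x ∂(law n)| ≤
        K ^ n * (M * (dA A x₀ x₀ + ∫ y, dA A y x₀ ∂(law 1))) := by
      intro n
      have hg := h.iterate_meanOp hA hf hθ hS hM n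
      have hb := abs_sub_integral_le hA (by positivity) hg (hmem 1) x₀
      rw [hint 1 _ _ (by positivity) hg, Function.iterate_one,
        ← Function.iterate_succ_apply' (meanOp ν f θ) n φ] at hb
      rw [hint n _ _ (by positivity) h', hint n _ _ hM h, ← Function.iterate_succ_apply (meanOp ν f θ) n φ,
        abs_sub_comm, ← mul_assoc]
      exact hb
    refine squeeze_zero_norm (fun n => hd (k n)) ?_
    simpa using ((tendsto_pow_atTop_nhds_zero_of_lt_one hK hK1).comp
      hk.tendsto_atTop).mul_const
        (M * (dA A x₀ x₀ + ∫ y, dA A y x₀ ∂(law 1)))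
  simpa using t3.add t1

end

end Stationary
end StationaryDiff
end

open MeasureTheory ProbabilityTheory Set Filter Topology
open scoped ENNReal

noncomputable section

namespace StationaryDiff

/-! ### Decay of iterated costs, and first-order perturbation of integrals. -/

section Perturbation

set_option linter.unusedSectionVars false
set_option maxSynthPendingDepth 3

variable {E F Ξ : Type*} [NormedAddCommGroup E] [NormedSpace ℝ E]
  [NormedAddCommGroup F] [NormedSpace ℝ F] {X : Set E} {A : X → E ≃L[ℝ] E} {B : X → F ≃L[ℝ] F}
  [MeasurableSpace Ξ] {ν : Measure Ξ} [IsProbabilityMeasure ν] {Θ : Set F} {f : X → Ξ → F → X}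
  {x₀ : X}

theorem CostBound.mono {e : X → ℝ} {n₁ n₂ m₁ m₂ : ℝ} (h : CostBound A e n₁ n₂) (h₁ : n₁ ≤ m₁)
    (h₂ : n₂ ≤ m₂) : CostBound A e m₁ m₂ :=
  ⟨h.contDiff, h.nonneg₁.trans h₁, h.nonneg₂.trans h₂,
    fun x u => (h.bound₁ x u).trans (by gcongr), fun x u v => (h.bound₂ x u v).trans (by gcongr)⟩

/-- A vanishing first derivative forces the second to vanish. This covers `K = 0` in the decay of
iterates. -/
theorem CostBound.of_zero (hA : FinslerConditions X A) {e : X → ℝ} {n₂ : ℝ}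
    (h : CostBound A e 0 n₂) : CostBound A e 0 0 := by
  have h0 : dX e = fun _ => 0 := by
    funext x
    ext u
    have := h.bound₁ x u
    rw [zero_mul] at this
    simpa using abs_nonpos_iff.1 this
  refine ⟨h.contDiff, le_rfl, le_rfl, fun x u => by simp [h0], fun x u v => ?_⟩
  rw [h0, dX_const hA]; simp

theorem CostBound.sub_const (hA : FinslerConditions X A) {e : X → ℝ} {n₁ n₂ : ℝ}
    (h : CostBound A e n₁ n₂) (c : ℝ) : CostBound A (fun x => e x - c) n₁ n₂ := by
  have := h.add hA (CostBound.const hA (-c))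
  rw [add_zero, add_zero] at this
  exact this

variable [MeasurableSpace E] [BorelSpace E] [FiniteDimensional ℝ E]
  (hA : FinslerConditions X A) (hf : SystemConditions ν Θ f A) {θ : F} (hθ : θ ∈ Θ)
  {K L : ℝ} (hS : SysBounds ν Θ f A B K L) (hL : BoundConditions ν Θ f A B K)
  (hK1 : K < 1) {e : X → ℝ} {n₁ n₂ : ℝ}
include hA hf hS hL

omit hA hf hL in
/-- The ratio of the second-order to the first-order decay constants of the iterates. -/
theorem curvature_nonneg (hK1 : K < 1) : 0 ≤ L / (K * (1 - K)) :=
  div_nonneg hS.L_nonneg (mul_nonneg hS.K_nonneg (by linarith))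

include hθ hK1 in
/-- Geometric decay of both derivatives along the iterates of the transition kernel. -/
theorem CostBound.iterate_meanOp (he : CostBound A e n₁ n₂) (n : ℕ) :
    CostBound A ((StationaryDiff.meanOp ν f θ)^[n] e) (K ^ n * n₁)
      (K ^ n * (n₂ + L / (K * (1 - K)) * n₁)) := by
  have hn1 := he.nonneg₁
  have hn2 := he.nonneg₂
  have hK := hS.K_nonneg
  have hR := curvature_nonneg hS hK1
  have h1K : 0 < 1 - K := by linarith
  set R := L / (K * (1 - K))
  induction n with
  | zero =>
    simp only [pow_zero, one_mul, Function.iterate_zero, id]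
    exact he.mono le_rfl (le_add_of_nonneg_right (by positivity))
  | succ n ih =>
    rw [Function.iterate_succ_apply']
    have h := ih.meanOp hA hf hθ hL hS
    rcases hK.eq_or_lt with h0 | h0
    -- For `K = 0` the quotient `L / (K * (1 - K))` is `0` by convention, and from the first step on
    -- both bounds must be zero. The contraction gives this for the first derivative, hence for the
    -- second.
    · rw [← h0] at h ⊢
      simp only [zero_mul, ne_eq, Nat.add_eq_zero_iff, one_ne_zero, and_false, not_false_eq_true,
        zero_pow] at h ⊢
      exact CostBound.of_zero hA h
    · refine h.mono (by rw [pow_succ']; linarith) ?_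
      -- `R` is chosen so that in `K² n₂ + L n₁` the source term `L n₁` fills exactly the gap
      -- between the rates `K²` and `K`; the terms in `n₂` only leave slack.
      have hRL : K * R * (1 - K) = L := by
        simp only [R]
        field_simp
      have e1 : K ^ (n + 1) * (n₂ + R * n₁) - (K ^ 2 * (K ^ n * (n₂ + R * n₁)) + L * (K ^ n * n₁)) =
          K ^ n * (K * n₂ * (1 - K)) := by
        rw [← hRL]; ring
      have e2 : 0 ≤ K ^ n * (K * n₂ * (1 - K)) := by positivity
      linarith

variable [FiniteDimensional ℝ F]

include hθ in
theorem stronglyMeasurable_meanDeriv (he : CostBound A e n₁ n₂) :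
    StronglyMeasurable (meanDeriv ν f θ e) := by
  have := FiniteDimensional.proper_real E
  have h : ∀ η ∈ Θ, StronglyMeasurable (fun x => StationaryDiff.meanOp ν f η e x) := fun η hη =>
    (continuous_of_contDiffOn hA (contDiffOn_meanOp hA hf hη hL he)).stronglyMeasurable
  exact stronglyMeasurable_of_hasFDerivWithinAt hθ (hf.isOpen.uniqueDiffOn θ hθ)
    (v := fun η x => StationaryDiff.meanOp ν f η e x) h
    fun x => (hasFDerivAt_meanOp hA hf hS he hθ x).hasFDerivWithinAt

omit hL in
include hθ in
theorem norm_meanDeriv_le (he : CostBound A e n₁ n₂) (x : X) :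
    ‖meanDeriv ν f θ e x‖ ≤ n₁ * L * ‖(B x : F →L[ℝ] F)‖ := by
  have hn1 := he.nonneg₁
  have hL0 := hS.L_nonneg
  refine ContinuousLinearMap.opNorm_le_bound _ (by positivity) fun v => ?_
  rw [Real.norm_eq_abs, mul_assoc]
  exact (abs_meanDeriv_le hA hf hS he hθ x v).trans
    (mul_le_mul_of_nonneg_left ((B x : F →L[ℝ] F).le_opNorm v) (by positivity))

variable {C : ℝ} (hC : 0 ≤ C)
  (hB : ∀ x y : X, |‖(B x : F →L[ℝ] F)‖ - ‖(B y : F →L[ℝ] F)‖| ≤ C * dA A x y)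
include hC hB

omit hf hS hL hC in
theorem integrable_norm_B {μ : Measure X} (hμ : μ ∈ P2A A x₀) :
    Integrable (fun x => ‖(B x : F →L[ℝ] F)‖) μ := by
  have := FiniteDimensional.complete ℝ E
  have := hμ.1
  refine Integrable.mono' ((integrable_const ‖(B x₀ : F →L[ℝ] F)‖).add
    ((integrable_dA hA hμ).const_mul C))
    (continuous_norm_B hA hB).measurable.aestronglyMeasurable (ae_of_all _ fun x => ?_)
  rw [norm_norm]
  exact norm_B_le hB x

include hθ in
omit hC in
theorem integrable_meanDeriv (he : CostBound A e n₁ n₂) {μ : Measure X} (hμ : μ ∈ P2A A x₀) :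
    Integrable (meanDeriv ν f θ e) μ :=
  Integrable.mono' ((integrable_norm_B hA hB hμ).const_mul (n₁ * L))
    (stronglyMeasurable_meanDeriv hA hf hθ hS hL he).aestronglyMeasurable
    (ae_of_all _ fun x => norm_meanDeriv_le hA hf hθ hS he x)

variable {μ : Measure X} (hμ : μ ∈ P2A A x₀) {b : ℝ} (hb0 : 0 ≤ b)

include hθ hμ hb0 in
omit hC in
theorem norm_integral_meanDeriv_le (he : CostBound A e n₁ n₂)
    (hb : ∫⁻ x, ENNReal.ofReal ‖(B x : F →L[ℝ] F)‖ ^ 2 ∂μ ≤ ENNReal.ofReal b ^ 2) :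
    ‖∫ x, meanDeriv ν f θ e x ∂μ‖ ≤ n₁ * L * b := by
  have hn1 := he.nonneg₁
  have hL0 := hS.L_nonneg
  have := hμ.1
  rw [← enorm_le_ofReal_iff (by positivity)]
  refine (enorm_integral_le_lintegral_enorm _).trans ?_
  calc ∫⁻ x, ‖meanDeriv ν f θ e x‖ₑ ∂μ
      ≤ ∫⁻ x, ENNReal.ofReal (n₁ * L) * ENNReal.ofReal ‖(B x : F →L[ℝ] F)‖ ∂μ := by
        refine lintegral_mono fun x => ?_
        rw [← ENNReal.ofReal_mul (by positivity), enorm_le_ofReal_iff (by positivity)]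
        exact norm_meanDeriv_le hA hf hθ hS he x
    _ = ENNReal.ofReal (n₁ * L) * ∫⁻ x, ENNReal.ofReal ‖(B x : F →L[ℝ] F)‖ ∂μ :=
        lintegral_const_mul' _ _ (by simp)
    _ ≤ ENNReal.ofReal (n₁ * L) * ENNReal.ofReal b := by
        gcongr
        exact lintegral_le_of_sq_le
          (continuous_norm_B hA hB).measurable.ennreal_ofReal.aemeasurable hb
    _ = _ := by rw [← ENNReal.ofReal_mul (by positivity)]

variable {U : Set F} (hU : Convex ℝ U) (hUΘ : U ⊆ Θ) {η η' : U}
include hU hUΘ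

include hμ hb0 in
omit hC in
/-- First-order expansion of `μ P_η` in `η`, on costs. -/
theorem abs_integral_remainder_le (hK : 0 ≤ K) (he : CostBound A e n₁ n₂)
    (hb : ∫⁻ x, ENNReal.ofReal ‖(B x : F →L[ℝ] F)‖ ^ 2 ∂μ ≤ ENNReal.ofReal b ^ 2) :
    |∫ x, StationaryDiff.meanOp ν f η' e x ∂μ - ∫ x, StationaryDiff.meanOp ν f η e x ∂μ -
      ∫ x, meanDeriv ν f η e x ((η' : F) - η) ∂μ| ≤
      (n₂ * L ^ 2 + n₁ * L) * (b * ‖(η' : F) - η‖) ^ 2 := by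
  have hn1 := he.nonneg₁
  have hn2 := he.nonneg₂
  have hL0 := hS.L_nonneg
  have i1 := (he.meanOp hA hf (hUΘ η'.2) hL hS).lipA hA |>.integrable hA (by positivity) hμ
  have i2 := (he.meanOp hA hf (hUΘ η.2) hL hS).lipA hA |>.integrable hA (by positivity) hμ
  have i3 := (integrable_meanDeriv hA hf (hUΘ η.2) hS hL hB he hμ).apply_continuousLinearMap
    ((η' : F) - η)
  rw [← integral_sub i1 i2, ← integral_sub (f := fun x => StationaryDiff.meanOp ν f η' e x -
    StationaryDiff.meanOp ν f η e x) (i1.sub i2) i3, ← Real.norm_eq_abs,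
    ← enorm_le_ofReal_iff (by positivity)]
  refine (enorm_integral_le_lintegral_enorm _).trans ?_
  calc _ ≤ ∫⁻ x, ENNReal.ofReal ((n₂ * L ^ 2 + n₁ * L) * ‖(η' : F) - η‖ ^ 2) *
        ENNReal.ofReal ‖(B x : F →L[ℝ] F)‖ ^ 2 ∂μ := by
        refine lintegral_mono fun x => ?_
        rw [← ENNReal.ofReal_pow (norm_nonneg _), ← ENNReal.ofReal_mul (by positivity),
          enorm_le_ofReal_iff (by positivity)]
        refine (abs_meanOp_sub_sub_le hA hf hS he hU hUΘ x η η').trans ?_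
        rw [mul_assoc, ← mul_pow]
        have := (B x : F →L[ℝ] F).le_opNorm ((η' : F) - η)
        rw [mul_comm ‖(B x : F →L[ℝ] F)‖] at this
        gcongr
        exact this
    _ = ENNReal.ofReal ((n₂ * L ^ 2 + n₁ * L) * ‖(η' : F) - η‖ ^ 2) *
        ∫⁻ x, ENNReal.ofReal ‖(B x : F →L[ℝ] F)‖ ^ 2 ∂μ := lintegral_const_mul' _ _ (by simp)
    _ ≤ ENNReal.ofReal ((n₂ * L ^ 2 + n₁ * L) * ‖(η' : F) - η‖ ^ 2) * ENNReal.ofReal b ^ 2 := by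
        gcongr
    _ = _ := by
        rw [← ENNReal.ofReal_pow hb0, ← ENNReal.ofReal_mul (by positivity)]
        congr 1; ring

/-- Weighted Lipschitz bound for the change of the transition operator. -/
theorem abs_meanOp_sub_sub_le_mul_dA (he : CostBound A e n₁ n₂) (x y : X) :
    |(StationaryDiff.meanOp ν f η' e x - StationaryDiff.meanOp ν f η e x) -
      (StationaryDiff.meanOp ν f η' e y - StationaryDiff.meanOp ν f η e y)| ≤
      (n₂ * L * K + n₁ * L) * ‖(η' : F) - η‖ *
        ((‖(B x : F →L[ℝ] F)‖ + C * dA A x y) * dA A x y) := by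
  have := FiniteDimensional.complete ℝ E
  have hn1 := he.nonneg₁
  have hn2 := he.nonneg₂
  have hL0 := hS.L_nonneg
  have hK := hS.K_nonneg
  set M := (n₂ * L * K + n₁ * L) * ‖(η' : F) - η‖ with hM
  have hM0 : 0 ≤ M := by positivity
  have hd : ∀ z : X, HasFDerivWithinAt
      (extZero (fun z => StationaryDiff.meanOp ν f η' e z - StationaryDiff.meanOp ν f η e z))
      (dX (StationaryDiff.meanOp ν f η' e) z - dX (StationaryDiff.meanOp ν f η e) z) X z := by
    intro z
    have h1 := hasFDerivWithinAt_dX hA (contDiffOn_meanOp hA hf (hUΘ η'.2) hL he) z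
    have h2 := hasFDerivWithinAt_dX hA (contDiffOn_meanOp hA hf (hUΘ η.2) hL he) z
    refine (h1.sub h2).congr' (fun w hw => ?_) z.2
    obtain ⟨w, rfl⟩ : ∃ z : X, (z : E) = w := ⟨⟨w, hw⟩, rfl⟩
    rw [Pi.sub_apply, extZero_coe, extZero_coe, extZero_coe]
  have key : ∀ r, dA A x y < r → |(StationaryDiff.meanOp ν f η' e x - StationaryDiff.meanOp ν f η e x) -
      (StationaryDiff.meanOp ν f η' e y - StationaryDiff.meanOp ν f η e y)| ≤
      M * ((‖(B x : F →L[ℝ] F)‖ + C * r) * r) := by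
    intro r hr
    obtain ⟨γ, a, b, -, hγ, rfl, rfl, hl⟩ := exists_curve_of_dA_lt hA.convex hr
    have hr0 : 0 < r := (dA_nonneg _ _).trans_lt hr
    -- Points of a curve of length below `r` are within `r` of its start, so `‖B‖` is at most `‖B (γ
    -- a)‖ + C r` along it.
    have h := norm_sub_le_mul_curveLength hA hd hγ
      (β := M * (‖(B (γ a) : F →L[ℝ] F)‖ + C * r)) (fun t ht u => ?_)
    · rw [Real.norm_eq_abs, abs_sub_comm] at h
      refine h.trans ?_
      rw [mul_assoc]
      gcongr
    · rw [Real.norm_eq_abs]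
      refine (abs_dX_meanOp_sub_le hA hf hS he hU hUΘ hL (γ t) η η' u).trans ?_
      have h1 : ‖(B (γ t) : F →L[ℝ] F)‖ ≤ ‖(B (γ a) : F →L[ℝ] F)‖ + C * r := by
        have h2 := norm_B_le (x₀ := γ a) hB (γ t)
        rw [dA_comm hA.convex] at h2
        have h3 := mul_le_mul_of_nonneg_left ((dA_left_le_curveLength hA hγ ht).trans hl.le) hC
        linarith
      have h4 := ((B (γ t) : F →L[ℝ] F).le_opNorm ((η' : F) - η)).trans
        (mul_le_mul_of_nonneg_right h1 (norm_nonneg _))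
      calc _ ≤ (n₂ * L * K + n₁ * L) * ((‖(B (γ a) : F →L[ℝ] F)‖ + C * r) * ‖(η' : F) - η‖) *
            ‖A (γ t) u‖ := by gcongr; exact h4
        _ = _ := by rw [hM]; ring
  have hc : Continuous (fun r => M * ((‖(B x : F →L[ℝ] F)‖ + C * r) * r)) := by fun_prop
  exact ge_of_tendsto ((hc.tendsto _).mono_left (nhdsWithin_le_nhds (s := Ioi (dA A x y))))
    (eventually_nhdsWithin_of_forall key)

section Invariant

variable {μ' : Measure X} (hμ' : μ' ∈ P2A A x₀)
  (hi : Kernel.Invariant (transition ν f η) μ) (hi' : Kernel.Invariant (transition ν f η') μ')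
  (hb : ∫⁻ x, ENNReal.ofReal ‖(B x : F →L[ℝ] F)‖ ^ 2 ∂μ' ≤ ENNReal.ofReal b ^ 2)
include hμ hμ' hi hi' hb hb0 hK1

theorem abs_integral_cost_sub_le (he : CostBound A e n₁ n₂) :
    |∫ x, e x ∂μ' - ∫ x, e x ∂μ| ≤ n₁ * (L * b * ‖(η' : F) - η‖ / (1 - K)) := by
  have := hμ'.1
  have h := he.lipA hA
  -- With `β = 1` and `C = 0` the weighted bound is the plain Lipschitz bound.
  have := abs_integral_sub_le hA hf hS hU hUΘ hK1 hμ hμ' hi hi'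
    (continuous_norm_B hA hB).measurable hb0 hb (h.continuous hA) (h.integrable hA he.nonneg₁ hμ)
    (h.integrable hA he.nonneg₁ hμ') (β := fun _ => 1) measurable_const (fun _ => zero_le_one)
    (C := 0) (b₁ := 1) he.nonneg₁ le_rfl zero_le_one (by simp)
    (fun x y => by simpa using h x y)
  simpa using this

theorem abs_integral_cross_le (he : CostBound A e n₁ n₂) :
    |∫ x, (StationaryDiff.meanOp ν f η' e x - StationaryDiff.meanOp ν f η e x) ∂μ' -
      ∫ x, (StationaryDiff.meanOp ν f η' e x - StationaryDiff.meanOp ν f η e x) ∂μ| ≤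
      (n₂ * L * K + n₁ * L) * ‖(η' : F) - η‖ *
        ((b + C * (L * b * ‖(η' : F) - η‖ / (1 - K))) * (L * b * ‖(η' : F) - η‖ / (1 - K))) := by
  have hn1 := he.nonneg₁
  have hn2 := he.nonneg₂
  have hL0 := hS.L_nonneg
  have hK := hS.K_nonneg
  have l1 := (he.meanOp hA hf (hUΘ η'.2) hL hS).lipA hA
  have l2 := (he.meanOp hA hf (hUΘ η.2) hL hS).lipA hA
  have p : 0 ≤ K * n₁ := by positivity
  exact abs_integral_sub_le hA hf hS hU hUΘ hK1 hμ hμ' hi hi'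
    (continuous_norm_B hA hB).measurable hb0 hb ((l1.continuous hA).sub (l2.continuous hA))
    ((l1.integrable hA p hμ).sub (l2.integrable hA p hμ))
    ((l1.integrable hA p hμ').sub (l2.integrable hA p hμ'))
    (continuous_norm_B hA hB).measurable (fun x => norm_nonneg _) (by positivity) hC hb0 hb
    (abs_meanOp_sub_sub_le_mul_dA hA hf hS hL hC hB hU hUΘ he)

end Invariant

end Perturbation
end StationaryDiff
end

open MeasureTheory ProbabilityTheory Set Filter Topology
open scoped ENNReal

noncomputable section

namespace StationaryDiff

/-! ### Operator norms, the kernel conditions, and differentiation of stationary expectations. -/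

section Conditions

set_option linter.unusedSectionVars false
set_option maxSynthPendingDepth 3

variable {E F Ξ : Type*} [NormedAddCommGroup E] [NormedSpace ℝ E]
  [NormedAddCommGroup F] [NormedSpace ℝ F] {X : Set E} {A : X → E ≃L[ℝ] E} {B : X → F ≃L[ℝ] F}
  [MeasurableSpace Ξ] {ν : Measure Ξ} [IsProbabilityMeasure ν] {Θ : Set F} {f : X → Ξ → F → X}
  {x₀ : X}

/-- The zeroth-order part of the norm is dropped: the functionals estimated with it vanish on
constants, so bounds on the derivatives of `e` suffice. -/
theorem funENorm_le {G : Type*} [NormedAddCommGroup G] {l : (X → ℝ) → G} {Q : ℝ} (hQ : 0 ≤ Q)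
    (h : ∀ e, CostBound A e 1 1 → ‖l e‖ ≤ Q) :
    funENorm (E2 A x₀) (E2norm A x₀) l ≤ ENNReal.ofReal Q := by
  refine iSup₂_le fun e he => iSup_le fun h1 => ?_
  rw [← ENNReal.ofReal_one] at h1
  exact (enorm_le_ofReal_iff hQ).2 (h e (.of_E2norm_le he.1 zero_le_one h1))

theorem opENorm_le {T : (X → ℝ) → X → ℝ} {n₀ n₁ n₂ : ℝ} (hn₀ : 0 ≤ n₀)
    (h : ∀ e, CostBound A e 1 1 → (∀ x, |e x| ≤ 1 + dA A x x₀) →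
      CostBound A (T e) n₁ n₂ ∧ ∀ x, |T e x| ≤ n₀ * (1 + dA A x x₀)) :
    opENorm (E2 A x₀) (E2norm A x₀) T ≤ ENNReal.ofReal (n₀ + n₁ + n₂) := by
  refine iSup₂_le fun e he => iSup_le fun h1 => ?_
  rw [← ENNReal.ofReal_one] at h1
  obtain ⟨h2, h3⟩ := h e (.of_E2norm_le he.1 zero_le_one h1) fun x => by
    simpa using abs_le_of_E2norm_le zero_le_one h1 x
  exact h2.E2norm_le hn₀ h3

theorem tendsto_div_enorm_of_le_sq {l : F → ℝ≥0∞} {Q : ℝ} (hQ : 0 ≤ Q)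
    (h : ∀ᶠ Δ in 𝓝 (0 : F), l Δ ≤ ENNReal.ofReal (Q * ‖Δ‖ ^ 2)) :
    Tendsto (fun Δ => l Δ / ‖Δ‖ₑ) (𝓝[≠] 0) (𝓝 0) := by
  have hc : Tendsto (fun Δ : F => ENNReal.ofReal (Q * ‖Δ‖)) (𝓝[≠] 0) (𝓝 0) := by
    have : Continuous (fun Δ : F => ENNReal.ofReal (Q * ‖Δ‖)) :=
      ENNReal.continuous_ofReal.comp (by fun_prop)
    simpa using (this.tendsto 0).mono_left (nhdsWithin_le_nhds (s := {0}ᶜ))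
  refine tendsto_of_tendsto_of_tendsto_of_le_of_le' tendsto_const_nhds hc
    (Eventually.of_forall fun _ => zero_le) ?_
  filter_upwards [nhdsWithin_le_nhds h, self_mem_nhdsWithin] with Δ h1 h2
  refine ENNReal.div_le_of_le_mul (h1.trans (le_of_eq ?_))
  rw [← ofReal_norm, ← ENNReal.ofReal_mul (by positivity), sq, mul_assoc]

variable [MeasurableSpace E] [BorelSpace E] [FiniteDimensional ℝ E]
  (hA : FinslerConditions X A) (hf : SystemConditions ν Θ f A)
  {K L : ℝ} (hS : SysBounds ν Θ f A B K L) (hL : BoundConditions ν Θ f A B K) (hK1 : K < 1)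
include hA hf hS hL

theorem CostBound.kerOp_eq {e : X → ℝ} {n₁ n₂ : ℝ} (he : CostBound A e n₁ n₂) {θ : F}
    (hθ : θ ∈ Θ) : kerOp (transition ν f θ) e = StationaryDiff.meanOp ν f θ e :=
  kerOp_transition hA hf hθ (continuous_of_contDiffOn hA he.contDiff)

/-- The value at `x₀` is bounded by the growth of `e` and the first moment of the noise; other
points are reached through the Lipschitz constant `K N`. -/
theorem abs_meanOp_le {e : X → ℝ} {N : ℝ} (he : CostBound A e N N)
    (h0 : ∀ x, |e x| ≤ N * (1 + dA A x x₀)) {θ : F} (hθ : θ ∈ Θ) (x : X) :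
    |meanOp ν f θ e x| ≤ N * (1 + K + ∫ ξ, dA A x₀ (f x₀ ξ θ) ∂ν) * (1 + dA A x x₀) := by
  have hN := he.nonneg₁
  have hK := hS.K_nonneg
  have hd := dA_nonneg (A := A) x x₀
  have hi := integrable_dA_f hA hf hθ x₀
  have hm : 0 ≤ ∫ ξ, dA A x₀ (f x₀ ξ θ) ∂ν := integral_nonneg fun ξ => dA_nonneg _ _
  have h1 := (he.meanOp hA hf hθ hL hS).lipA hA x x₀
  have h2 : |meanOp ν f θ e x₀| ≤ N * (1 + ∫ ξ, dA A x₀ (f x₀ ξ θ) ∂ν) := by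
    have e1 : N * (1 + ∫ ξ, dA A x₀ (f x₀ ξ θ) ∂ν) = ∫ ξ, N * (1 + dA A x₀ (f x₀ ξ θ)) ∂ν := by
      rw [integral_const_mul, integral_add (integrable_const _) hi]; simp
    rw [e1, meanOp, ← Real.norm_eq_abs]
    refine norm_integral_le_of_norm_le (((integrable_const 1).add hi).const_mul N)
      (ae_of_all _ fun ξ => ?_)
    have := h0 (f x₀ ξ θ)
    rwa [dA_comm hA.convex] at this
  have h3 := abs_add_le (meanOp ν f θ e x - meanOp ν f θ e x₀) (meanOp ν f θ e x₀)
  rw [sub_add_cancel] at h3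
  set m := ∫ ξ, dA A x₀ (f x₀ ξ θ) ∂ν
  have h4 : K * N * dA A x x₀ + N * (1 + m) ≤ N * (1 + K + m) * (1 + dA A x x₀) := by
    have : 0 ≤ N * K + N * dA A x x₀ + N * m * dA A x x₀ := by positivity
    linarith
  linarith

theorem kerOp_mem_E2 {e : X → ℝ} (he : e ∈ E2 A x₀) {θ : F} (hθ : θ ∈ Θ) :
    kerOp (transition ν f θ) e ∈ E2 A x₀ := by
  obtain ⟨N, hN, hb, h0⟩ := exists_bound_of_mem_E2 he
  have hK := hS.K_nonneg
  have hm : 0 ≤ ∫ ξ, dA A x₀ (f x₀ ξ θ) ∂ν := integral_nonneg fun ξ => dA_nonneg _ _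
  rw [hb.kerOp_eq hA hf hS hL hθ]
  exact (hb.meanOp hA hf hθ hL hS).mem_E2 (by positivity) (abs_meanOp_le hA hf hS hL hb h0 hθ)

theorem opENorm_kerOp_lt_top {θ : F} (hθ : θ ∈ Θ) :
    opENorm (E2 A x₀) (E2norm A x₀) (kerOp (transition ν f θ)) < ⊤ := by
  have hK := hS.K_nonneg
  have hm : 0 ≤ ∫ ξ, dA A x₀ (f x₀ ξ θ) ∂ν := integral_nonneg fun ξ => dA_nonneg _ _
  refine (opENorm_le (n₀ := 1 * (1 + K + ∫ ξ, dA A x₀ (f x₀ ξ θ) ∂ν)) (n₁ := K * 1)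
    (n₂ := K ^ 2 * 1 + L * 1) (by positivity)
    fun e he h0 => ?_).trans_lt ENNReal.ofReal_lt_top
  rw [he.kerOp_eq hA hf hS hL hθ]
  exact ⟨he.meanOp hA hf hθ hL hS, abs_meanOp_le hA hf hS hL he (by simpa using h0) hθ⟩

include hK1 in
theorem CostBound.iterate_kerOp_eq {e : X → ℝ} {n₁ n₂ : ℝ} (he : CostBound A e n₁ n₂) {θ : F}
    (hθ : θ ∈ Θ) (n : ℕ) :
    (kerOp (transition ν f θ))^[n] e = (StationaryDiff.meanOp ν f θ)^[n] e := by
  induction n with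
  | zero => rfl
  | succ n ih =>
    rw [Function.iterate_succ_apply', Function.iterate_succ_apply', ih,
      (he.iterate_meanOp hA hf hθ hS hL hK1 n).kerOp_eq hA hf hS hL hθ]

include hK1 in
/-- Geometric convergence of the iterates of the transition operator. -/
theorem opENorm_iterate_sub_le {θ : F} (hθ : θ ∈ Θ) {μ : Measure X} (hμ : μ ∈ P2A A x₀)
    (hi : Kernel.Invariant (transition ν f θ) μ) (n : ℕ) :
    opENorm (E2 A x₀) (E2norm A x₀) (fun e => (kerOp (transition ν f θ))^[n] e - constOp μ e) ≤
      ENNReal.ofReal ((1 + ∫ y, dA A y x₀ ∂μ + 1 + (1 + L / (K * (1 - K)))) * K ^ n) := by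
  have hK := hS.K_nonneg
  have hm : 0 ≤ ∫ y, dA A y x₀ ∂μ := integral_nonneg fun y => dA_nonneg _ _
  -- The three constants are the Lipschitz convergence to the mean and the decay of the two
  -- derivatives, for a cost with `n₁ = n₂ = 1`.
  refine (opENorm_le (n₀ := K ^ n * (1 + ∫ y, dA A y x₀ ∂μ)) (n₁ := K ^ n * 1)
    (n₂ := K ^ n * (1 + L / (K * (1 - K)) * 1)) (by positivity) fun e he _ => ?_).trans
    (ENNReal.ofReal_le_ofReal (le_of_eq (by ring)))
  rw [he.iterate_kerOp_eq hA hf hS hL hK1 hθ]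
  refine ⟨(he.iterate_meanOp hA hf hθ hS hL hK1 n).sub_const hA _, fun x => ?_⟩
  refine (abs_iterate_meanOp_sub_le hA hf hθ hS hμ hi zero_le_one (he.lipA hA) n x).trans ?_
  rw [mul_one, mul_assoc]
  have hd := dA_nonneg (A := A) x x₀
  refine mul_le_mul_of_nonneg_left ?_ (by positivity)
  nlinarith [mul_nonneg hm hd]

include hK1 in
theorem tsum_opENorm_iterate_sub_lt_top {θ : F} (hθ : θ ∈ Θ) {μ : Measure X} (hμ : μ ∈ P2A A x₀)
    (hi : Kernel.Invariant (transition ν f θ) μ) :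
    ∑' n : ℕ, opENorm (E2 A x₀) (E2norm A x₀)
      (fun e => (kerOp (transition ν f θ))^[n] e - constOp μ e) < ⊤ := by
  have hK := hS.K_nonneg
  have hR := curvature_nonneg hS hK1
  have hm : 0 ≤ ∫ y, dA A y x₀ ∂μ := integral_nonneg fun y => dA_nonneg _ _
  refine (ENNReal.tsum_le_tsum fun n => opENorm_iterate_sub_le hA hf hS hL hK1 hθ hμ hi n).trans_lt ?_
  rw [← ENNReal.ofReal_tsum_of_nonneg (fun n => by positivity)
    ((summable_geometric_of_lt_one hK hK1).mul_left _)]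
  exact ENNReal.ofReal_lt_top

variable [FiniteDimensional ℝ F]

theorem CostBound.hasFDerivAt_kerOp {e : X → ℝ} {n₁ n₂ : ℝ} (he : CostBound A e n₁ n₂) {θ : F}
    (hθ : θ ∈ Θ) (x : X) : HasFDerivAt (fun η => kerOp (transition ν f η) e x)
      (meanDeriv ν f θ e x) θ := by
  refine (hasFDerivAt_meanOp hA hf hS he hθ x).congr_of_eventuallyEq ?_
  filter_upwards [hf.isOpen.mem_nhds hθ] with η hη
  rw [he.kerOp_eq hA hf hS hL hη]

theorem CostBound.paramDeriv_eq {e : X → ℝ} {n₁ n₂ : ℝ} (he : CostBound A e n₁ n₂) {θ : F}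
    (hθ : θ ∈ Θ) : paramDeriv (transition ν f) θ e = meanDeriv ν f θ e :=
  funext fun x => (he.hasFDerivAt_kerOp hA hf hS hL hθ x).fderiv

variable {C : ℝ} (hC : 0 ≤ C)
  (hB : ∀ x y : X, |‖(B x : F →L[ℝ] F)‖ - ‖(B y : F →L[ℝ] F)‖| ≤ C * dA A x y)
  {π : F → Measure X}
  (hπ : ∀ θ ∈ Θ, π θ ∈ P2A A x₀ ∧ Kernel.Invariant (transition ν f θ) (π θ))
  {θ₀ : F} (hθ₀ : θ₀ ∈ Θ)
include hC hB hπ hθ₀ hK1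

/-- Second-order estimates, uniform near `θ₀` and over all costs. -/
theorem exists_local_bounds : ∃ r > 0, Metric.ball θ₀ r ⊆ Θ ∧ ∃ Q : ℝ, 0 ≤ Q ∧
    ∀ (e : X → ℝ) (n₁ n₂ : ℝ), CostBound A e n₁ n₂ →
      ‖∫ x, meanDeriv ν f θ₀ e x ∂(π θ₀)‖ ≤ Q * n₁ ∧
      ∀ θ ∈ Metric.ball θ₀ r,
        |∫ x, e x ∂(π θ) - ∫ x, e x ∂(π θ₀)| ≤ Q * n₁ * ‖θ - θ₀‖ ∧
        |∫ x, StationaryDiff.meanOp ν f θ e x ∂(π θ₀) -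
          ∫ x, StationaryDiff.meanOp ν f θ₀ e x ∂(π θ₀) -
          ∫ x, meanDeriv ν f θ₀ e x (θ - θ₀) ∂(π θ₀)| ≤ Q * (n₁ + n₂) * ‖θ - θ₀‖ ^ 2 ∧
        |∫ x, (StationaryDiff.meanOp ν f θ e x - StationaryDiff.meanOp ν f θ₀ e x) ∂(π θ) -
          ∫ x, (StationaryDiff.meanOp ν f θ e x - StationaryDiff.meanOp ν f θ₀ e x) ∂(π θ₀)| ≤
          Q * (n₁ + n₂) * ‖θ - θ₀‖ ^ 2 := by
  have hK := hS.K_nonneg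
  have hL0 := hS.L_nonneg
  have h1K : 0 < 1 - K := by linarith
  obtain ⟨r, hr, hball⟩ := Metric.isOpen_iff.1 hf.isOpen θ₀ hθ₀
  have hU := convex_ball θ₀ r
  have h0 := Metric.mem_ball_self (x := θ₀) hr
  obtain ⟨c, hc0, hc⟩ := exists_noise_bound hA hf (x₀ := x₀) hθ₀
  -- A noise constant valid on the whole ball. It leads to `b`, which bounds the root-mean-square of
  -- `‖B‖` under every `π θ` with `θ` in the ball.
  let c' := L * (‖(B x₀ : F →L[ℝ] F)‖ * r) + c
  have hc' : 0 ≤ c' := by positivity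
  let b := ‖(B x₀ : F →L[ℝ] F)‖ + C * (c' / (1 - K))
  have hb0 : 0 ≤ b := by positivity
  have hb : ∀ θ ∈ Metric.ball θ₀ r,
      ∫⁻ x, ENNReal.ofReal ‖(B x : F →L[ℝ] F)‖ ^ 2 ∂(π θ) ≤ ENNReal.ofReal b ^ 2 := by
    intro θ hθ
    obtain ⟨hμ, hi⟩ := hπ θ (hball hθ)
    have := hμ.1
    refine lintegral_norm_B_sq_le hA hB hC (by positivity)
      (moment_le_of_invariant hA hf hS hK1 (hball hθ) hc' ?_ hμ hi)
    refine (noise_bound_of_mem hA hf hS hU hball ⟨θ₀, h0⟩ ⟨θ, hθ⟩ hc0 hc).trans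
      (pow_le_pow_left' (ENNReal.ofReal_le_ofReal ?_) 2)
    have h1 : ‖θ₀ - θ‖ ≤ r := by rw [← dist_eq_norm, dist_comm]; exact (Metric.mem_ball.1 hθ).le
    have h2 := ((B x₀ : F →L[ℝ] F).le_opNorm (θ₀ - θ)).trans
      (mul_le_mul_of_nonneg_left h1 (norm_nonneg _))
    exact add_le_add_left (mul_le_mul_of_nonneg_left h2 hL0) c
  let κ := L * b / (1 - K)
  have hκ : 0 ≤ κ := by positivity
  let Q₁ := L * b
  let Q₂ := (L ^ 2 + L) * b ^ 2
  let Q₃ := (L * K + L) * ((b + C * (κ * r)) * κ)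
  have q1 : 0 ≤ Q₁ := by positivity
  have q2 : 0 ≤ Q₂ := by positivity
  have q3 : 0 ≤ Q₃ := by positivity
  obtain ⟨hμ, hi⟩ := hπ θ₀ hθ₀
  refine ⟨r, hr, hball, κ + Q₁ + Q₂ + Q₃, by positivity, fun e n₁ n₂ he => ⟨?_, fun θ hθ => ?_⟩⟩
  · have hn1 := he.nonneg₁
    refine (norm_integral_meanDeriv_le hA hf hθ₀ hS hL hB hμ hb0 he (hb θ₀ h0)).trans ?_
    calc n₁ * L * b = Q₁ * n₁ := by simp only [Q₁]; ring
      _ ≤ (κ + Q₁ + Q₂ + Q₃) * n₁ := by gcongr; linarith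
  · have hn1 := he.nonneg₁
    have hn2 := he.nonneg₂
    obtain ⟨hμ', hi'⟩ := hπ θ (hball hθ)
    have hδ : ‖θ - θ₀‖ ≤ r := by rw [← dist_eq_norm]; exact (Metric.mem_ball.1 hθ).le
    have eκ : L * b * ‖θ - θ₀‖ / (1 - K) = κ * ‖θ - θ₀‖ := by simp only [κ]; ring
    refine ⟨?_, ?_, ?_⟩
    · refine (abs_integral_cost_sub_le hA hf hS hL hK1 hC hB hμ hb0 hU hball (η := ⟨θ₀, h0⟩)
        (η' := ⟨θ, hθ⟩) hμ' hi hi' (hb θ hθ) he).trans ?_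
      simp only [eκ]
      calc n₁ * (κ * ‖θ - θ₀‖) = κ * n₁ * ‖θ - θ₀‖ := by ring
        _ ≤ (κ + Q₁ + Q₂ + Q₃) * n₁ * ‖θ - θ₀‖ := by gcongr; linarith
    · refine (abs_integral_remainder_le hA hf hS hL hB hμ hb0 hU hball (η := ⟨θ₀, h0⟩)
        (η' := ⟨θ, hθ⟩) hK he (hb θ₀ h0)).trans ?_
      simp only
      calc (n₂ * L ^ 2 + n₁ * L) * (b * ‖θ - θ₀‖) ^ 2
          ≤ ((n₁ + n₂) * (L ^ 2 + L)) * (b * ‖θ - θ₀‖) ^ 2 := by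
            gcongr
            have : 0 ≤ n₁ * L ^ 2 + n₂ * L := by positivity
            linarith
        _ = Q₂ * (n₁ + n₂) * ‖θ - θ₀‖ ^ 2 := by simp only [Q₂]; ring
        _ ≤ (κ + Q₁ + Q₂ + Q₃) * (n₁ + n₂) * ‖θ - θ₀‖ ^ 2 := by gcongr; linarith
    · refine (abs_integral_cross_le hA hf hS hL hK1 hC hB hμ hb0 hU hball (η := ⟨θ₀, h0⟩)
        (η' := ⟨θ, hθ⟩) hμ' hi hi' (hb θ hθ) he).trans ?_
      simp only [eκ]
      calc (n₂ * L * K + n₁ * L) * ‖θ - θ₀‖ * ((b + C * (κ * ‖θ - θ₀‖)) * (κ * ‖θ - θ₀‖))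
          ≤ ((n₁ + n₂) * (L * K + L)) * ‖θ - θ₀‖ * ((b + C * (κ * r)) * (κ * ‖θ - θ₀‖)) := by
            gcongr
            have : 0 ≤ n₁ * (L * K) + n₂ * L := by positivity
            linarith
        _ = Q₃ * (n₁ + n₂) * ‖θ - θ₀‖ ^ 2 := by simp only [Q₃]; ring
        _ ≤ (κ + Q₁ + Q₂ + Q₃) * (n₁ + n₂) * ‖θ - θ₀‖ ^ 2 := by gcongr; linarith

theorem kernelConditions :
    KernelConditions (E2 A x₀) (E2norm A x₀) (P2A A x₀) Θ (transition ν f) π θ₀ := by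
  obtain ⟨hμ, hi⟩ := hπ θ₀ hθ₀
  have hK := hS.K_nonneg
  obtain ⟨r, hr, hball, Q, hQ, hb⟩ := exists_local_bounds hA hf hS hL hK1 hC hB hπ hθ₀
  have hev : ∀ᶠ Δ : F in 𝓝 0, θ₀ + Δ ∈ Metric.ball θ₀ r := by
    have hc : Continuous (fun Δ : F => θ₀ + Δ) := by fun_prop
    exact (hc.tendsto 0).eventually (by
      rw [add_zero]; exact Metric.ball_mem_nhds θ₀ hr)
  exact
  { markov := fun θ hθ => isMarkovKernel_transition hA hf hθ
    measure_mem := fun θ hθ μ h => bind_mem_P2A hA hf hS hθ h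
    stationary := hπ
    integrable := fun θ hθ e he x => by
      obtain ⟨N, hN, hb, -⟩ := exists_bound_of_mem_E2 he
      rw [integrable_transition_iff hA hf hθ (continuous_of_contDiffOn hA hb.contDiff)]
      exact integrable_comp_f hA hf hθ hb x
    cost_mem := fun θ hθ e he => kerOp_mem_E2 hA hf hS hL he hθ
    bounded := fun θ hθ => opENorm_kerOp_lt_top hA hf hS hL hθ
    deviation := tsum_opENorm_iterate_sub_lt_top hA hf hS hL hK1 hθ₀ hμ hi
    differentiable := fun e he x => by
      obtain ⟨N, hN, hb, -⟩ := exists_bound_of_mem_E2 he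
      exact (hb.hasFDerivAt_kerOp hA hf hS hL hθ₀ x).differentiableAt
    integrable_deriv := fun e he => by
      obtain ⟨N, hN, hb, -⟩ := exists_bound_of_mem_E2 he
      rw [hb.paramDeriv_eq hA hf hS hL hθ₀]
      exact integrable_meanDeriv hA hf hθ₀ hS hL hB hb hμ
    bounded_deriv := by
      refine (funENorm_le (A := A) (Q := Q * 1) (by positivity) fun e he => ?_).trans_lt
        ENNReal.ofReal_lt_top
      rw [he.paramDeriv_eq hA hf hS hL hθ₀]
      exact (hb e 1 1 he).1
    remainder := by
      refine tendsto_div_enorm_of_le_sq (Q := Q * (1 + 1)) (by positivity) ?_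
      filter_upwards [hev] with Δ hΔ
      refine funENorm_le (A := A) (by positivity) fun e he => ?_
      have h := ((hb e 1 1 he).2 _ hΔ).2.1
      rw [add_sub_cancel_left] at h
      rw [he.paramDeriv_eq hA hf hS hL hθ₀, he.kerOp_eq hA hf hS hL hθ₀,
        he.kerOp_eq hA hf hS hL (hball hΔ), Real.norm_eq_abs]
      exact h
    cross_remainder := by
      refine tendsto_div_enorm_of_le_sq (Q := Q * (1 + 1)) (by positivity) ?_
      filter_upwards [hev] with Δ hΔ
      refine funENorm_le (A := A) (by positivity) fun e he => ?_
      have h := ((hb e 1 1 he).2 _ hΔ).2.2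
      rw [add_sub_cancel_left] at h
      rw [he.kerOp_eq hA hf hS hL hθ₀, he.kerOp_eq hA hf hS hL (hball hΔ), Real.norm_eq_abs]
      exact h }

/-- The derivative of the stationary expectation is `∑ₙ π_{θ₀} (∂_θ P_{θ₀}) P_{θ₀}ⁿ e`. -/
theorem CostBound.hasFDerivAt_integral {e : X → ℝ} {n₁ n₂ : ℝ} (he : CostBound A e n₁ n₂) :
    HasFDerivAt (fun θ => ∫ x, e x ∂(π θ))
      (∑' n, ∫ x, meanDeriv ν f θ₀ ((StationaryDiff.meanOp ν f θ₀)^[n] e) x ∂(π θ₀)) θ₀ := by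
  obtain ⟨hμ, hi⟩ := hπ θ₀ hθ₀
  have := hμ.1
  have hn1 := he.nonneg₁
  have hn2 := he.nonneg₂
  have hK := hS.K_nonneg
  have hR := curvature_nonneg hS hK1
  obtain ⟨r, hr, hball, Q, hQ, hb⟩ := exists_local_bounds hA hf hS hL hK1 hC hB hπ hθ₀
  set R := L / (K * (1 - K))
  set W := n₁ + (n₂ + R * n₁) with hW
  have hW0 : 0 ≤ W := by positivity
  let g : ℕ → X → ℝ := fun n => (StationaryDiff.meanOp ν f θ₀)^[n] e
  have hg : ∀ n, CostBound A (g n) (K ^ n * n₁) (K ^ n * (n₂ + R * n₁)) :=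
    he.iterate_meanOp hA hf hθ₀ hS hL hK1
  have hgs : ∀ n, g (n + 1) = StationaryDiff.meanOp ν f θ₀ (g n) := fun n =>
    Function.iterate_succ_apply' _ _ _
  let l : ℕ → F →L[ℝ] ℝ := fun n => ∫ x, meanDeriv ν f θ₀ (g n) x ∂(π θ₀)
  have hgeo := summable_geometric_of_lt_one hK hK1
  have hl : Summable l := by
    refine Summable.of_norm_bounded (hgeo.mul_left (Q * n₁)) fun n => ?_
    refine ((hb (g n) _ _ (hg n)).1).trans (le_of_eq ?_)
    ring
  have main : ∀ θ ∈ Metric.ball θ₀ r, |∫ x, e x ∂(π θ) - ∫ x, e x ∂(π θ₀) - (∑' n, l n) (θ - θ₀)| ≤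
      (2 * Q * W * ∑' n : ℕ, K ^ n) * ‖θ - θ₀‖ ^ 2 := by
    intro θ hθ
    obtain ⟨hμ', hi'⟩ := hπ θ (hball hθ)
    have := hμ'.1
    set δ := ‖θ - θ₀‖
    -- By stationarity of `π θ` and `π θ₀` the difference splits into the cross remainder and the
    -- first-order remainder for the cost `g n`. Both are quadratic in `δ`, with constants decaying
    -- like `Kⁿ`.
    have step : ∀ n, |(∫ x, g n x ∂(π θ) - ∫ x, g n x ∂(π θ₀)) -
        (∫ x, g (n + 1) x ∂(π θ) - ∫ x, g (n + 1) x ∂(π θ₀)) - l n (θ - θ₀)| ≤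
        2 * Q * W * K ^ n * δ ^ 2 := by
      intro n
      have hn := hg n
      have hc := continuous_of_contDiffOn hA hn.contDiff
      have p := hn.nonneg₁
      have m0 := hn.meanOp hA hf hθ₀ hL hS
      have m1 := hn.meanOp hA hf (hball hθ) hL hS
      obtain ⟨-, h2, h3⟩ := (hb (g n) _ _ hn).2 θ hθ
      have e1 := integral_meanOp hA hf (hball hθ) hi' hc ((hn.lipA hA).integrable hA p hμ')
      have e2 : l n (θ - θ₀) = ∫ x, meanDeriv ν f θ₀ (g n) x (θ - θ₀) ∂(π θ₀) :=
        ContinuousLinearMap.integral_apply (integrable_meanDeriv hA hf hθ₀ hS hL hB hn hμ) _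
      have e3 := integral_meanOp hA hf hθ₀ hi hc ((hn.lipA hA).integrable hA p hμ)
      rw [integral_sub ((m1.lipA hA).integrable hA m1.nonneg₁ hμ')
        ((m0.lipA hA).integrable hA m0.nonneg₁ hμ'),
        integral_sub ((m1.lipA hA).integrable hA m1.nonneg₁ hμ)
        ((m0.lipA hA).integrable hA m0.nonneg₁ hμ), e1, e3] at h3
      rw [e3] at h2
      rw [hgs, e2, e3]
      have e4 : Q * (K ^ n * n₁ + K ^ n * (n₂ + R * n₁)) * δ ^ 2 = Q * W * K ^ n * δ ^ 2 := by
        rw [hW]; ring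
      rw [e4] at h2 h3
      refine le_trans (le_of_eq (congrArg abs ?_)) ((abs_add_le _ _).trans
        ((add_le_add h2 h3).trans (le_of_eq (by ring))))
      ring
    have tele : ∀ N, |(∫ x, e x ∂(π θ) - ∫ x, e x ∂(π θ₀)) -
        (∫ x, g N x ∂(π θ) - ∫ x, g N x ∂(π θ₀)) - (∑ n ∈ Finset.range N, l n) (θ - θ₀)| ≤
        (2 * Q * W * ∑ n ∈ Finset.range N, K ^ n) * δ ^ 2 := by
      intro N
      induction N with
      | zero => simp [g]
      | succ N ih =>
        rw [Finset.sum_range_succ, Finset.sum_range_succ, add_apply]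
        refine le_trans (le_of_eq (congrArg abs ?_)) ((abs_add_le _ _).trans
          ((add_le_add ih (step N)).trans (le_of_eq (by ring))))
        ring
    -- The leftover of the telescoping sum vanishes since `g N` is `K^N n₁`-Lipschitz and stationary
    -- expectations are Lipschitz in `θ` with a constant proportional to this.
    have t1 : Tendsto (fun N => ∫ x, g N x ∂(π θ) - ∫ x, g N x ∂(π θ₀)) atTop (𝓝 0) := by
      refine squeeze_zero_norm (fun N => ((hb (g N) _ _ (hg N)).2 θ hθ).1) ?_
      have := (tendsto_pow_atTop_nhds_zero_of_lt_one hK hK1).mul_const (Q * n₁ * δ)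
      rw [zero_mul] at this
      exact this.congr fun N => by ring
    have t2 : Tendsto (fun N => (∑ n ∈ Finset.range N, l n) (θ - θ₀)) atTop
        (𝓝 ((∑' n, l n) (θ - θ₀))) :=
      ((ContinuousLinearMap.apply ℝ ℝ (θ - θ₀)).continuous.tendsto _).comp
        hl.hasSum.tendsto_sum_nat
    have t3 := ((tendsto_const_nhds (x := ∫ x, e x ∂(π θ) - ∫ x, e x ∂(π θ₀))).sub t1).sub t2
    rw [sub_zero] at t3
    exact le_of_tendsto_of_tendsto' t3.abs
      ((hgeo.hasSum.tendsto_sum_nat.const_mul (2 * Q * W)).mul_const (δ ^ 2)) tele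
  have hq : (fun θ => ∫ x, e x ∂(π θ) - ∫ x, e x ∂(π θ₀) - (∑' n, l n) (θ - θ₀))
      =O[𝓝 θ₀] fun θ => ‖θ - θ₀‖ ^ 2 := by
    refine Asymptotics.IsBigO.of_bound (2 * Q * W * ∑' n : ℕ, K ^ n) ?_
    filter_upwards [Metric.ball_mem_nhds θ₀ hr] with θ hθ
    rw [Real.norm_eq_abs, Real.norm_of_nonneg (by positivity)]
    exact main θ hθ
  refine .of_isLittleO (hq.trans_isLittleO ?_)
  have h2 : (fun η : F => ‖η - θ₀‖ ^ 2) =o[𝓝 θ₀] fun η => ‖η - θ₀‖ ^ 1 :=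
    (Asymptotics.isLittleO_pow_pow (𝕜 := ℝ) one_lt_two).comp_tendsto (by
      have : Continuous (fun η : F => ‖η - θ₀‖) := by fun_prop
      simpa using this.tendsto θ₀)
  simpa using h2

end Conditions
end StationaryDiff
end

/-! ### The theorem. -/

open StationaryDiff
theorem theorem4p1 {E F Ξ : Type*}
    [NormedAddCommGroup E] [NormedSpace ℝ E] [FiniteDimensional ℝ E]
    [MeasurableSpace E] [BorelSpace E]
    [NormedAddCommGroup F] [NormedSpace ℝ F] [FiniteDimensional ℝ F]
    [MeasurableSpace Ξ] (ν : Measure Ξ) [IsProbabilityMeasure ν]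
    (X : Set E) (Θ : Set F) (f : X → Ξ → F → X)
    (A : X → E ≃L[ℝ] E) (B : X → F ≃L[ℝ] F) (K_X : ℝ)
    (hA : FinslerConditions X A)
    (hf : SystemConditions ν Θ f A)
    (hB : WeightCondition A B)
    (hL : BoundConditions ν Θ f A B K_X)
    (x₀ : X) :
    StateSpaceConditions (E2 A x₀) (E2norm A x₀) (P2A A x₀) ∧
    (∀ θ ∈ Θ, ∃! μ : Measure X, μ ∈ P2A A x₀ ∧ Kernel.Invariant (transition ν f θ) μ) ∧
    ∀ π : F → Measure X,
      (∀ θ ∈ Θ, π θ ∈ P2A A x₀ ∧ Kernel.Invariant (transition ν f θ) (π θ)) →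
      ∀ θ₀ ∈ Θ,
        KernelConditions (E2 A x₀) (E2norm A x₀) (P2A A x₀) Θ (transition ν f) π θ₀ ∧
        (∃ ρ : ℝ, 0 ≤ ρ ∧ ∀ n : ℕ,
          opENorm (E2 A x₀) (E2norm A x₀)
            (fun e => (kerOp (transition ν f θ₀))^[n] e - constOp (π θ₀) e)
            ≤ ENNReal.ofReal (ρ * K_X ^ n)) ∧
        ∀ e ∈ E2 A x₀, DifferentiableAt ℝ (fun θ => ∫ x, e x ∂(π θ)) θ₀ := by
  have := FiniteDimensional.complete ℝ E
  obtain ⟨L, hS⟩ := exists_sysBounds hL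
  obtain ⟨C, hC⟩ := hB
  -- The given Lipschitz constant may be negative; the estimates need a nonnegative one.
  have hB' : ∀ x y : X, |‖(B x : F →L[ℝ] F)‖ - ‖(B y : F →L[ℝ] F)‖| ≤ max C 0 * dA A x y :=
    fun x y => (hC x y).trans
      (mul_le_mul_of_nonneg_right (le_max_left C 0) (dA_nonneg x y))
  refine ⟨stateSpaceConditions hA, fun θ hθ => ?_, fun π hπ θ₀ hθ₀ => ⟨?_, ?_, fun e he => ?_⟩⟩
  · obtain ⟨μ, hμ, hi⟩ := exists_invariant hA hf hθ hS hL.lt_one x₀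
    exact ⟨μ, ⟨hμ, hi⟩, fun μ' h =>
      invariant_unique hA hf hθ hS hL.lt_one h.1 hμ h.2 hi⟩
  · exact kernelConditions hA hf hS hL hL.lt_one (le_max_right C 0) hB' hπ hθ₀
  · have h1 : 0 ≤ ∫ y, dA A y x₀ ∂(π θ₀) := integral_nonneg fun y => dA_nonneg _ _
    have h2 := curvature_nonneg hS hL.lt_one
    exact ⟨1 + ∫ y, dA A y x₀ ∂(π θ₀) + 1 + (1 + L / (K_X * (1 - K_X))), by positivity,
      opENorm_iterate_sub_le hA hf hS hL hL.lt_one hθ₀ (hπ θ₀ hθ₀).1 (hπ θ₀ hθ₀).2⟩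
  · obtain ⟨N, hN, hb, -⟩ := exists_bound_of_mem_E2 he
    exact (hb.hasFDerivAt_integral hA hf hS hL hL.lt_one (le_max_right C 0) hB' hπ
      hθ₀).differentiableAt
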